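/- **Setting.** All $*$-algebras are complex and unital. A *state* on a $*$-algebra $\mathcal A$ is a linear functional $\phi$ with $\phi(1)=1$ and $\phi(a^*a)\ge 0$ for all $a$; it is *tracial* if $\phi(ab)=\phi(ba)$ for all $a,b$. Let $\mathcal A\sqcup\mathcal B$ be the free product of $*$-algebras with units identified, with legs $a\mapsto a^{(1)}$ and $b\mapsto b^{(2)}$. For $n\ge 1$ let $U_n^{\mathrm{nc}}$ be the universal $*$-algebra generated by $u_{ij}$ $(1\le i,j\le n)$ with the relations $\sum_k u_{ki}^*u_{kj}=\delta_{ij}=\sum_k u_{ik}u_{jk}^*$, and let $\Delta:U_n^{\mathrm{nc}}\to U_n^{\mathrm{nc}}\sqcup U_n^{\mathrm{nc}}$ and $\delta:U_n^{\mathrm{nc}}\to\mathbb C$ be the unital $*$-homomorphisms with $\Delta(u_{ij})=\sum_k u_{ik}^{(1)}u_{kj}^{(2)}$ and $\delta(u_{ij})=\delta_{ij}$; these are the algebra, the coproduct and the counit of the unitary dual group $U\langle n\rangle$. For states $\phi_1$ on $\mathcal A_1$ and $\phi_2$ on $\mathcal A_2$ the following relations, required for all $m\ge1$ and all $A_1,\dots,A_m$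 with $A_i\in\mathcal A_{\epsilon_i}$ and $\epsilon_1\ne\epsilon_2\ne\cdots\ne\epsilon_m$, define unital linear functionals on $\mathcal A_1\sqcup\mathcal A_2$: * free product: $(\phi_1*\phi_2)(A_1\cdots A_m)=0$ whenever $\phi_{\epsilon_i}(A_i)=0$ for all $i$; * tensor product: $(\phi_1\otimes\phi_2)(A_1\cdots A_m)=\phi_1\big(\prod_{\epsilon_i=1}A_i\big)\,\phi_2\big(\prod_{\epsilon_i=2}A_i\big)$; and, when $\mathcal A_1=\mathcal A_2=U_n^{\mathrm{nc}}$ and all $A_i\in\ker\delta$, * boolean product: $(\phi_1\diamond\phi_2)(A_1\cdots A_m)=\prod_i\phi_{\epsilon_i}(A_i)$; * monotone product: $(\phi_1\rhd\phi_2)(A_1\cdots A_m)=\phi_1\big(\prod_{\epsilon_i=1}A_i\big)\prod_{\epsilon_i=2}\phi_2(A_i)$; * anti-monotone product: $(\phi_1\lhd\phi_2)(A_1\cdots A_m)=\prod_{\epsilon_i=1}\phi_1(A_i)\;\phi_2\big(\prod_{\epsilon_i=2}A_i\big)$. The corresponding convolution $\phi\star\psi$ of two states on $U_n^{\mathrm{nc}}$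 is the composition of the product of $\phi$ and $\psi$ with $\Delta$. A *Haar trace* on $U\langle n\rangle$ for a given convolution is a tracial state $h$ on $U_n^{\mathrm{nc}}$ such that $\phi\star h=h=h\star\phi$ for every tracial state $\phi$ on $U_n^{\mathrm{nc}}$. **Theorem.** 1. For every $n\ge 2$ there is no Haar trace on $U\langle n\rangle$ for the boolean, the monotone or the anti-monotone convolution. 2. For every $n\ge 1$ there is exactly one Haar trace on $U\langle n\rangle$ for the free convolution, and exactly one for the tensor convolution. They are given as follows. * *Free case.* Let $E_{ij}$ be the matrix units and $\mathrm{tr}_n=\frac1n\mathrm{Tr}$ the normalized trace of $\mathcal M_n(\mathbb C)$. For every $*$-algebra $\mathcal A$ with a state $\phi$ and every Haar unitary $U\in\mathcal A$ (that is, $U$ is unitary and $\phi(U^k)=0$ for all $k\ge1$) there is a unital $*$-homomorphism $j_U:U_n^{\mathrm{nc}}\to E_{11}(\mathcal A\sqcup\mathcal M_n(\mathbb C))E_{11}$ (a $*$-algebra with unit $E_{11}$) with $j_U(u_{ij})=E_{1i}UE_{j1}$, and the free Haar trace is $h=n\,(\phi*\mathrm{tr}_n)\circ j_U$. * *Tensor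 case.* Let $H=\ell^2(\mathbb Z)\otimes\bigotimes_{k\in\mathbb Z}\mathcal M_n(\mathbb C)$, where $\mathcal M_n(\mathbb C)$ has the inner product $\mathrm{tr}_n(A^*B)$ and the infinite tensor product of Hilbert spaces is spanned by the elementary tensors with all but finitely many factors equal to $I_n$, and let $\Omega=\delta_0\otimes\bigotimes_k I_n$. There is a unital $*$-homomorphism $j:U_n^{\mathrm{nc}}\to B(H)$ with $$j(u_{ij})\big(\delta_k\otimes(\cdots\otimes M_{k-1}\otimes M_k\otimes M_{k+1}\otimes\cdots)\big)=\delta_{k+1}\otimes(\cdots\otimes M_{k-1}\otimes E_{ji}M_k\otimes M_{k+1}\otimes\cdots),$$ and the tensor Haar trace is $h(a)=\langle\Omega,j(a)\Omega\rangle$. -/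

import Mathlib

open scoped ComplexOrder TensorProduct

set_option linter.unusedSectionVars false

noncomputable section

namespace UDual

/-! ### Free `*`-algebras -/

/-- The free unital complex `*`-algebra on a set `X` carrying an involution: words in `X`, where the
`*`-operation is conjugate linear, reverses products, and sends a generator `x` to `star x`. -/
def FreeStar (X : Type*) : Type _ := FreeAlgebra ℂ X

namespace FreeStar

variable {X : Type*}

instance : Ring (FreeStar X) := inferInstanceAs (Ring (FreeAlgebra ℂ X))
instance : Algebra ℂ (FreeStar X) := inferInstanceAs (Algebra ℂ (FreeAlgebra ℂ X))

/-- The generator of the free `*`-algebra attached to `x`. -/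
def gen (x : X) : FreeStar X := FreeAlgebra.ι ℂ x

/-- The algebra homomorphism extending a map on generators. -/
def liftAlg {B : Type*} [Ring B] [Algebra ℂ B] (f : X → B) : FreeStar X →ₐ[ℂ] B :=
  FreeAlgebra.lift ℂ f

@[simp] theorem liftAlg_gen {B : Type*} [Ring B] [Algebra ℂ B] (f : X → B) (x : X) :
    liftAlg f (gen x) = f x := FreeAlgebra.lift_ι_apply f x

theorem induct {p : FreeStar X → Prop} (hs : ∀ c : ℂ, p (algebraMap ℂ _ c))
    (hg : ∀ x, p (gen x)) (hm : ∀ a b, p a → p b → p (a * b)) (ha : ∀ a b, p a → p b → p (a + b))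
    (a : FreeStar X) : p a :=
  FreeAlgebra.induction ℂ X hs hg hm ha a

variable [InvolutiveStar X]

/-- The conjugate linear antihomomorphism extending `star` on the generators. -/
def starAux : FreeStar X →+* (FreeStar X)ᵐᵒᵖ :=
  letI : Algebra ℂ (FreeStar X)ᵐᵒᵖ := Algebra.compHom _ (starRingEnd ℂ)
  (FreeAlgebra.lift ℂ (fun x : X => MulOpposite.op (gen (star x)))).toRingHom

theorem starAux_gen (x : X) : starAux (gen x) = MulOpposite.op (gen (star x)) := by
  let _ : Algebra ℂ (FreeStar X)ᵐᵒᵖ := Algebra.compHom _ (starRingEnd ℂ)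
  exact FreeAlgebra.lift_ι_apply (fun x : X => MulOpposite.op (gen (star x))) x

theorem starAux_algebraMap (c : ℂ) : starAux (algebraMap ℂ (FreeStar X) c) =
    MulOpposite.op (algebraMap ℂ (FreeStar X) (star c)) := by
  let _ : Algebra ℂ (FreeStar X)ᵐᵒᵖ := Algebra.compHom _ (starRingEnd ℂ)
  exact (FreeAlgebra.lift ℂ (fun x : X => MulOpposite.op (gen (star x)))).commutes c

instance : StarRing (FreeStar X) where
  star a := (starAux a).unop
  star_involutive a := by
    induction a using induct with
    | hs c => simp [starAux_algebraMap]
    | hg x => simp [starAux_gen]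
    | hm a b ha hb => simp [ha, hb]
    | ha a b ha hb => simp [ha, hb]
  star_mul a b := by simp
  star_add a b := by simp

theorem star_gen (x : X) : star (gen x) = gen (star x) :=
  congrArg MulOpposite.unop (starAux_gen x)

theorem star_algMap (c : ℂ) : star (algebraMap ℂ (FreeStar X) c) =
    algebraMap ℂ (FreeStar X) (star c) :=
  congrArg MulOpposite.unop (starAux_algebraMap c)

instance : StarModule ℂ (FreeStar X) where
  star_smul c a := by
    rw [Algebra.smul_def, star_mul, star_algMap, Algebra.smul_def, Algebra.commutes]

end FreeStar

/-! ### `*`-algebras given by generators and relations -/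

/-- The smallest `*`-closed set of relations containing `r`. -/
def starClosure {X : Type*} [InvolutiveStar X] (r : FreeStar X → FreeStar X → Prop) :
    FreeStar X → FreeStar X → Prop :=
  fun a b => r a b ∨ r (star a) (star b)

/-- The universal unital complex `*`-algebra generated by `X` with the relations `r`. -/
def Pres {X : Type*} [InvolutiveStar X] (r : FreeStar X → FreeStar X → Prop) : Type _ :=
  RingQuot (starClosure r)

namespace Pres

variable {X : Type*} [InvolutiveStar X] (r : FreeStar X → FreeStar X → Prop)

instance : Ring (Pres r) := inferInstanceAs (Ring (RingQuot (starClosure r)))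
instance : Algebra ℂ (Pres r) := inferInstanceAs (Algebra ℂ (RingQuot (starClosure r)))

/-- The quotient map from the free `*`-algebra. -/
def mk : FreeStar X →ₐ[ℂ] Pres r := RingQuot.mkAlgHom ℂ (starClosure r)

theorem mk_surjective : Function.Surjective (mk r) :=
  RingQuot.mkAlgHom_surjective ℂ (starClosure r)

variable {r}

theorem mk_eq_of_closure {a b : FreeStar X} (h : starClosure r a b) : mk r a = mk r b :=
  RingQuot.mkAlgHom_rel ℂ h

theorem mk_eq {a b : FreeStar X} (h : r a b) : mk r a = mk r b := mk_eq_of_closure (Or.inl h)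

/-- An algebra homomorphism compatible with the relations and their adjoints factors through the
quotient. -/
def liftAlg {B : Type*} [Ring B] [Algebra ℂ B] (f : FreeStar X →ₐ[ℂ] B)
    (hf : ∀ ⦃a b⦄, starClosure r a b → f a = f b) : Pres r →ₐ[ℂ] B :=
  RingQuot.liftAlgHom ℂ ⟨f, hf⟩

@[simp] theorem liftAlg_mk {B : Type*} [Ring B] [Algebra ℂ B] (f : FreeStar X →ₐ[ℂ] B)
    (hf : ∀ ⦃a b⦄, starClosure r a b → f a = f b) (a : FreeStar X) :
    liftAlg f hf (mk r a) = f a :=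
  RingQuot.liftAlgHom_mkAlgHom_apply ℂ f hf a

variable (r)

/-- The adjoint on the quotient, as a homomorphism to the opposite ring. -/
def starAux : Pres r →+* (Pres r)ᵐᵒᵖ :=
  RingQuot.lift ⟨(mk r).toRingHom.op.comp FreeStar.starAux, by
    intro a b h
    have h2 : starClosure r (star a) (star b) := by
      rcases h with h | h
      · right; simpa using h
      · left; exact h
    exact congrArg MulOpposite.op (mk_eq_of_closure h2)⟩

theorem starAux_mk (a : FreeStar X) : starAux r (mk r a) = MulOpposite.op (mk r (star a)) := by
  have h : mk r a = RingQuot.mkRingHom (starClosure r) a := by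
    unfold mk
    rw [← RingQuot.mkAlgHom_coe ℂ (starClosure r)]
    rfl
  rw [h]
  exact RingQuot.lift_mkRingHom_apply _ _ a

instance : StarRing (Pres r) where
  star a := (starAux r a).unop
  star_involutive a := by
    obtain ⟨a, rfl⟩ := mk_surjective r a
    simp [starAux_mk]
  star_mul a b := by simp
  star_add a b := by simp

theorem star_mk (a : FreeStar X) : star (mk r a) = mk r (star a) :=
  congrArg MulOpposite.unop (starAux_mk r a)

instance : StarModule ℂ (Pres r) where
  star_smul c a := by
    obtain ⟨a, rfl⟩ := mk_surjective r a
    rw [← map_smul, star_mk, star_smul, map_smul, star_mk]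

/-- The universal property: a `*`-compatible assignment on the generators that satisfies the
relations extends to a unital `*`-homomorphism. -/
def lift {r : FreeStar X → FreeStar X → Prop} {B : Type*} [Ring B] [StarRing B] [Algebra ℂ B]
    [StarModule ℂ B] (f : X → B) (hs : ∀ x, f (star x) = star (f x))
    (hr : ∀ ⦃a b⦄, r a b → FreeStar.liftAlg f a = FreeStar.liftAlg f b) : Pres r →⋆ₐ[ℂ] B :=
  have hstar : ∀ a : FreeStar X, FreeStar.liftAlg f (star a) = star (FreeStar.liftAlg f a) := by
    intro a
    induction a using FreeStar.induct with
    | hs c => rw [FreeStar.star_algMap, AlgHom.commutes, AlgHom.commutes, algebraMap_star_comm]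
    | hg x => rw [FreeStar.star_gen, FreeStar.liftAlg_gen, FreeStar.liftAlg_gen, hs]
    | hm a b ha hb => rw [star_mul, map_mul, map_mul, star_mul, ha, hb]
    | ha a b ha hb => rw [star_add, map_add, map_add, star_add, ha, hb]
  have hc : ∀ ⦃a b⦄, starClosure r a b → FreeStar.liftAlg f a = FreeStar.liftAlg f b := by
    rintro a b (h | h)
    · exact hr h
    · have := hr h
      rw [hstar, hstar] at this
      exact star_injective this
  { liftAlg (FreeStar.liftAlg f) hc with
    map_star' := by
      intro a
      obtain ⟨a, rfl⟩ := mk_surjective r a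
      rw [star_mk]
      exact (liftAlg_mk _ hc _).trans ((hstar a).trans
        (congrArg star (liftAlg_mk _ hc a).symm)) }

theorem lift_mk_gen {r : FreeStar X → FreeStar X → Prop} {B : Type*} [Ring B] [StarRing B]
    [Algebra ℂ B] [StarModule ℂ B] (f : X → B) (hs : ∀ x, f (star x) = star (f x))
    (hr : ∀ ⦃a b⦄, r a b → FreeStar.liftAlg f a = FreeStar.liftAlg f b) (x : X) :
    lift f hs hr (mk r (FreeStar.gen x)) = f x :=
  (liftAlg_mk (FreeStar.liftAlg f) _ (FreeStar.gen x)).trans (FreeStar.liftAlg_gen f x)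

end Pres

/-! ### The free product of two unital `*`-algebras -/

/-- Generators of the free product: a copy of `A` and a copy of `B`. -/
inductive CoprodGen (A B : Type*)
  | left (a : A)
  | right (b : B)

instance {A B : Type*} [InvolutiveStar A] [InvolutiveStar B] : InvolutiveStar (CoprodGen A B) where
  star
    | .left a => .left (star a)
    | .right b => .right (star b)
  star_involutive x := by cases x <;> simp

section Coprod

variable (A B : Type*) [Ring A] [StarRing A] [Algebra ℂ A] [StarModule ℂ A]
  [Ring B] [StarRing B] [Algebra ℂ B] [StarModule ℂ B]

open FreeStar CoprodGen in
/-- The relations making the two copies of `A` and `B` unital subalgebras. -/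
inductive CoprodRel : FreeStar (CoprodGen A B) → FreeStar (CoprodGen A B) → Prop
  | left_add (a a' : A) : CoprodRel (gen (left (a + a'))) (gen (left a) + gen (left a'))
  | left_mul (a a' : A) : CoprodRel (gen (left (a * a'))) (gen (left a) * gen (left a'))
  | left_scalar (c : ℂ) : CoprodRel (gen (left (algebraMap ℂ A c))) (algebraMap ℂ _ c)
  | right_add (b b' : B) : CoprodRel (gen (right (b + b'))) (gen (right b) + gen (right b'))
  | right_mul (b b' : B) : CoprodRel (gen (right (b * b'))) (gen (right b) * gen (right b'))
  | right_scalar (c : ℂ) : CoprodRel (gen (right (algebraMap ℂ B c))) (algebraMap ℂ _ c)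

/-- The free product `A ⊔ B` of the unital `*`-algebras `A` and `B` (units identified). -/
abbrev Coprod : Type _ := Pres (CoprodRel A B)

namespace Coprod

/-- The embedding `a ↦ a⁽¹⁾` of the left leg. -/
def inl : A →⋆ₐ[ℂ] Coprod A B where
  toFun a := Pres.mk _ (FreeStar.gen (.left a))
  map_one' := by
    have := Pres.mk_eq (CoprodRel.left_scalar (A := A) (B := B) 1)
    simpa using this
  map_mul' a a' := by rw [Pres.mk_eq (CoprodRel.left_mul a a'), map_mul]
  map_zero' := by
    have := Pres.mk_eq (CoprodRel.left_scalar (A := A) (B := B) 0)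
    simpa using this
  map_add' a a' := by rw [Pres.mk_eq (CoprodRel.left_add a a'), map_add]
  commutes' c := by rw [Pres.mk_eq (CoprodRel.left_scalar c), AlgHom.commutes]
  map_star' a := by rw [Pres.star_mk, FreeStar.star_gen]; rfl

/-- The embedding `b ↦ b⁽²⁾` of the right leg. -/
def inr : B →⋆ₐ[ℂ] Coprod A B where
  toFun b := Pres.mk _ (FreeStar.gen (.right b))
  map_one' := by
    have := Pres.mk_eq (CoprodRel.right_scalar (A := A) (B := B) 1)
    simpa using this
  map_mul' b b' := by rw [Pres.mk_eq (CoprodRel.right_mul b b'), map_mul]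
  map_zero' := by
    have := Pres.mk_eq (CoprodRel.right_scalar (A := A) (B := B) 0)
    simpa using this
  map_add' b b' := by rw [Pres.mk_eq (CoprodRel.right_add b b'), map_add]
  commutes' c := by rw [Pres.mk_eq (CoprodRel.right_scalar c), AlgHom.commutes]
  map_star' b := by rw [Pres.star_mk, FreeStar.star_gen]; rfl

variable {A B}

/-- The homomorphism out of the free product given by a pair of algebra homomorphisms. -/
def liftAlg {C : Type*} [Ring C] [Algebra ℂ C] (f : A →ₐ[ℂ] C) (g : B →ₐ[ℂ] C) :
    Coprod A B →ₐ[ℂ] C :=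
  Pres.liftAlg
    (FreeStar.liftAlg fun x => match x with
      | .left a => f a
      | .right b => g b) (by
    have key : ∀ a b, CoprodRel A B a b →
        FreeStar.liftAlg (fun x : CoprodGen A B => match x with
          | .left a => f a
          | .right b => g b) a = FreeStar.liftAlg (fun x => match x with
          | .left a => f a
          | .right b => g b) b := by
      intro a b h
      cases h <;> simp
    have hcl : ∀ a b, CoprodRel A B a b → CoprodRel A B (star a) (star b) := by
      have hl : ∀ a : A, star (FreeStar.gen (CoprodGen.left (B := B) a)) =
          FreeStar.gen (.left (star a)) := fun a => FreeStar.star_gen _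
      have hr : ∀ b : B, star (FreeStar.gen (CoprodGen.right (A := A) b)) =
          FreeStar.gen (.right (star b)) := fun b => FreeStar.star_gen _
      intro a b h
      cases h with
      | left_add a a' => rw [star_add, hl, hl, hl, star_add]; exact .left_add _ _
      | left_mul a a' => rw [star_mul, hl, hl, hl, star_mul]; exact .left_mul _ _
      | left_scalar c =>
        rw [hl, FreeStar.star_algMap, ← algebraMap_star_comm]; exact .left_scalar _
      | right_add b b' => rw [star_add, hr, hr, hr, star_add]; exact .right_add _ _
      | right_mul b b' => rw [star_mul, hr, hr, hr, star_mul]; exact .right_mul _ _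
      | right_scalar c =>
        rw [hr, FreeStar.star_algMap, ← algebraMap_star_comm]; exact .right_scalar _
    rintro a b (h | h)
    · exact key a b h
    · have h2 := hcl _ _ h
      rw [star_star, star_star] at h2
      exact key a b h2)

@[simp] theorem liftAlg_inl {C : Type*} [Ring C] [Algebra ℂ C] (f : A →ₐ[ℂ] C) (g : B →ₐ[ℂ] C)
    (a : A) : liftAlg f g (inl A B a) = f a :=
  (Pres.liftAlg_mk _ _ _).trans (FreeStar.liftAlg_gen _ _)

@[simp] theorem liftAlg_inr {C : Type*} [Ring C] [Algebra ℂ C] (f : A →ₐ[ℂ] C) (g : B →ₐ[ℂ] C)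
    (b : B) : liftAlg f g (inr A B b) = g b :=
  (Pres.liftAlg_mk _ _ _).trans (FreeStar.liftAlg_gen _ _)

end Coprod

end Coprod

/-! ### The unitary dual group -/

/-- Generators `u i j` and their formal adjoints `uStar i j`. -/
inductive UGen (n : ℕ)
  | u (i j : Fin n)
  | uStar (i j : Fin n)

instance (n : ℕ) : InvolutiveStar (UGen n) where
  star
    | .u i j => .uStar i j
    | .uStar i j => .u i j
  star_involutive x := by cases x <;> rfl

theorem UGen.star_u {n : ℕ} (i j : Fin n) : star (UGen.u i j) = UGen.uStar i j := rfl

open FreeStar in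
/-- The relations `∑ₖ uₖᵢ* uₖⱼ = δᵢⱼ` and `∑ₖ uᵢₖ uⱼₖ* = δᵢⱼ`. -/
inductive URel (n : ℕ) : FreeStar (UGen n) → FreeStar (UGen n) → Prop
  | star_mul (i j : Fin n) : URel n
      (∑ k, star (gen (UGen.u k i)) * gen (UGen.u k j)) (if i = j then 1 else 0)
  | mul_star (i j : Fin n) : URel n
      (∑ k, gen (UGen.u i k) * star (gen (UGen.u j k))) (if i = j then 1 else 0)

/-- The Brown algebra `Uₙⁿᶜ`: the universal unital `*`-algebra generated by the entries of a
unitary `n × n` matrix. -/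
abbrev UAlg (n : ℕ) : Type := Pres (URel n)

namespace UAlg

/-- The generator `uᵢⱼ`. -/
def u {n : ℕ} (i j : Fin n) : UAlg n := Pres.mk _ (FreeStar.gen (.u i j))

/-- The matrix of generators, which is unitary. -/
def uMat (n : ℕ) : unitary (Matrix (Fin n) (Fin n) (UAlg n)) :=
  ⟨Matrix.of u, by
    rw [Unitary.mem_iff]
    constructor
    · ext i j
      have := Pres.mk_eq (URel.star_mul i j)
      simpa [Matrix.mul_apply, Matrix.star_apply, Matrix.one_apply, u, Pres.star_mk, apply_ite]
        using this
    · ext i j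
      have := Pres.mk_eq (URel.mul_star i j)
      simpa [Matrix.mul_apply, Matrix.star_apply, Matrix.one_apply, u, Pres.star_mk, apply_ite]
        using this⟩

section

variable {n : ℕ} {B : Type*} [Ring B] [StarRing B] [Algebra ℂ B] [StarModule ℂ B]

/-- The unital `*`-homomorphism `Uₙⁿᶜ → B` determined by a unitary matrix over `B`. -/
def lift (V : unitary (Matrix (Fin n) (Fin n) B)) : UAlg n →⋆ₐ[ℂ] B :=
  Pres.lift
    (fun x => match x with
      | .u i j => V.1 i j
      | .uStar i j => star (V.1 i j))
    (by rintro (⟨i, j⟩ | ⟨i, j⟩) <;> simp [star])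
    (by
      rintro _ _ (⟨i, j⟩ | ⟨i, j⟩)
      · have h : star V.1 * V.1 = 1 := Unitary.star_mul_self_of_mem V.2
        have := congrArg (fun M : Matrix (Fin n) (Fin n) B => M i j) h
        simp only [Matrix.mul_apply, Matrix.one_apply, Matrix.star_apply] at this
        simpa [FreeStar.star_gen, UGen.star_u, apply_ite] using this
      · have h : V.1 * star V.1 = 1 := Unitary.mul_star_self_of_mem V.2
        have := congrArg (fun M : Matrix (Fin n) (Fin n) B => M i j) h
        simp only [Matrix.mul_apply, Matrix.one_apply, Matrix.star_apply] at this
        simpa [FreeStar.star_gen, UGen.star_u, apply_ite] using this)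

theorem lift_u (V : unitary (Matrix (Fin n) (Fin n) B)) (i j : Fin n) :
    lift V (u i j) = V.1 i j := Pres.lift_mk_gen _ _ _ _

/-- The image of a unitary matrix under an entrywise `*`-homomorphism. -/
def mapUnitary {C : Type*} [Ring C] [StarRing C] [Algebra ℂ C]
    (f : B →⋆ₐ[ℂ] C) (V : unitary (Matrix (Fin n) (Fin n) B)) :
    unitary (Matrix (Fin n) (Fin n) C) :=
  ⟨V.1.map f, by
    have h : ∀ M : Matrix (Fin n) (Fin n) B, star (M.map f) = (star M).map f := by
      intro M
      ext i j
      exact (map_star f (M j i)).symm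
    rw [Unitary.mem_iff, h, ← Matrix.map_mul, ← Matrix.map_mul,
      Unitary.star_mul_self_of_mem V.2, Unitary.mul_star_self_of_mem V.2]
    simp⟩

end

/-- The coproduct: `Δ(uᵢⱼ) = ∑ₖ uᵢₖ⁽¹⁾ uₖⱼ⁽²⁾`. -/
def Δ (n : ℕ) : UAlg n →⋆ₐ[ℂ] Coprod (UAlg n) (UAlg n) :=
  lift (mapUnitary (Coprod.inl _ _) (uMat n) * mapUnitary (Coprod.inr _ _) (uMat n))

theorem Δ_u {n : ℕ} (i j : Fin n) :
    Δ n (u i j) = ∑ k, Coprod.inl _ _ (u i k) * Coprod.inr _ _ (u k j) := by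
  rw [Δ, lift_u]
  rfl

/-- The counit: `δ(uᵢⱼ) = δᵢⱼ`. -/
def δ (n : ℕ) : UAlg n →⋆ₐ[ℂ] ℂ := lift 1

theorem δ_u {n : ℕ} (i j : Fin n) : δ n (u i j) = if i = j then 1 else 0 := by
  rw [δ, lift_u]
  exact Matrix.one_apply

end UAlg

/-! ### States -/

/-- A state on a unital `*`-algebra: a unital positive linear functional. -/
structure State (A : Type*) [Ring A] [StarRing A] [Algebra ℂ A] where
  /-- The underlying linear functional. -/
  toLin : A →ₗ[ℂ] ℂ
  map_one : toLin 1 = 1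
  nonneg : ∀ a : A, 0 ≤ toLin (star a * a)

instance {A : Type*} [Ring A] [StarRing A] [Algebra ℂ A] : CoeFun (State A) (fun _ => A → ℂ) :=
  ⟨fun φ => φ.toLin⟩

/-- A state is tracial if `φ(ab) = φ(ba)`. -/
def State.IsTracial {A : Type*} [Ring A] [StarRing A] [Algebra ℂ A] (φ : State A) : Prop :=
  ∀ a b : A, φ (a * b) = φ (b * a)

/-! ### The five products of functionals on a free product

A word in the free product is a list of letters from `A` or from `B`. -/

section Products

variable {A B : Type*} [Ring A] [StarRing A] [Algebra ℂ A] [StarModule ℂ A]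
  [Ring B] [StarRing B] [Algebra ℂ B] [StarModule ℂ B]

/-- Consecutive letters of the word come from different legs. -/
def Alternating (w : List (A ⊕ B)) : Prop := w.IsChain (fun x y => x.isLeft ≠ y.isLeft)

/-- The product of the letters of a word in `A ⊔ B`. -/
def wordProd (w : List (A ⊕ B)) : Coprod A B :=
  (w.map (Sum.elim (Coprod.inl A B) (Coprod.inr A B))).prod

/-- The letters of a word that come from `A`, in order. -/
def lefts : List (A ⊕ B) → List A
  | [] => []
  | .inl a :: w => a :: lefts w
  | .inr _ :: w => lefts w

/-- The letters of a word that come from `B`, in order. -/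
def rights : List (A ⊕ B) → List B
  | [] => []
  | .inl _ :: w => rights w
  | .inr b :: w => b :: rights w

/-- All letters of the word lie in the kernels of the given functionals. -/
def LettersInKer (f : A → ℂ) (g : B → ℂ) (w : List (A ⊕ B)) : Prop :=
  ∀ x ∈ w, Sum.elim f g x = 0

/-- `Φ` is the free product of `φ` and `ψ`: it is unital and vanishes on nonempty alternating
products of centred elements. -/
def IsFreeProduct (φ : A →ₗ[ℂ] ℂ) (ψ : B →ₗ[ℂ] ℂ) (Φ : Coprod A B →ₗ[ℂ] ℂ) : Prop :=
  Φ 1 = 1 ∧ ∀ w : List (A ⊕ B), w ≠ [] → Alternating w → LettersInKer φ ψ w → Φ (wordProd w) = 0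

/-- `Φ` is the tensor product of `φ` and `ψ`. -/
def IsTensorProduct (φ : A →ₗ[ℂ] ℂ) (ψ : B →ₗ[ℂ] ℂ) (Φ : Coprod A B →ₗ[ℂ] ℂ) : Prop :=
  ∀ w : List (A ⊕ B), Alternating w → Φ (wordProd w) = φ (lefts w).prod * ψ (rights w).prod

/-- `Φ` is the boolean product of `φ` and `ψ`, with respect to the decompositions
`A = ℂ1 ⊕ ker εA` and `B = ℂ1 ⊕ ker εB` given by two characters. -/
def IsBooleanProduct (εA : A →⋆ₐ[ℂ] ℂ) (εB : B →⋆ₐ[ℂ] ℂ) (φ : A →ₗ[ℂ] ℂ) (ψ : B →ₗ[ℂ] ℂ)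
    (Φ : Coprod A B →ₗ[ℂ] ℂ) : Prop :=
  ∀ w : List (A ⊕ B), Alternating w → LettersInKer εA εB w →
    Φ (wordProd w) = (w.map (Sum.elim φ ψ)).prod

/-- `Φ` is the monotone product of `φ` and `ψ`, with respect to the decompositions
`A = ℂ1 ⊕ ker εA` and `B = ℂ1 ⊕ ker εB`. -/
def IsMonotoneProduct (εA : A →⋆ₐ[ℂ] ℂ) (εB : B →⋆ₐ[ℂ] ℂ) (φ : A →ₗ[ℂ] ℂ) (ψ : B →ₗ[ℂ] ℂ)
    (Φ : Coprod A B →ₗ[ℂ] ℂ) : Prop :=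
  ∀ w : List (A ⊕ B), Alternating w → LettersInKer εA εB w →
    Φ (wordProd w) = φ (lefts w).prod * ((rights w).map ψ).prod

/-- `Φ` is the anti-monotone product of `φ` and `ψ`, with respect to the decompositions
`A = ℂ1 ⊕ ker εA` and `B = ℂ1 ⊕ ker εB`. -/
def IsAntimonotoneProduct (εA : A →⋆ₐ[ℂ] ℂ) (εB : B →⋆ₐ[ℂ] ℂ) (φ : A →ₗ[ℂ] ℂ) (ψ : B →ₗ[ℂ] ℂ)
    (Φ : Coprod A B →ₗ[ℂ] ℂ) : Prop :=
  ∀ w : List (A ⊕ B), Alternating w → LettersInKer εA εB w →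
    Φ (wordProd w) = ((lefts w).map φ).prod * ψ (rights w).prod

/-! #### Existence of the five products -/

/-- The functional `x ↦ ω(x v)` on `A ⊔ B`, for an action of `A` and an action of `B` on a common
vector space `V`. -/
def vacuum {V : Type*} [AddCommGroup V] [Module ℂ V] (f : A →ₐ[ℂ] Module.End ℂ V)
    (g : B →ₐ[ℂ] Module.End ℂ V) (ω : V →ₗ[ℂ] ℂ) (v : V) : Coprod A B →ₗ[ℂ] ℂ :=
  ω ∘ₗ LinearMap.applyₗ v ∘ₗ (Coprod.liftAlg f g).toLinearMap

/-- The vector obtained by applying a word to `v`. -/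
def wordAct {V : Type*} [AddCommGroup V] [Module ℂ V] (f : A →ₐ[ℂ] Module.End ℂ V)
    (g : B →ₐ[ℂ] Module.End ℂ V) (v : V) : List (A ⊕ B) → V
  | [] => v
  | .inl a :: w => f a (wordAct f g v w)
  | .inr b :: w => g b (wordAct f g v w)

theorem vacuum_wordProd {V : Type*} [AddCommGroup V] [Module ℂ V] (f : A →ₐ[ℂ] Module.End ℂ V)
    (g : B →ₐ[ℂ] Module.End ℂ V) (ω : V →ₗ[ℂ] ℂ) (v : V) (w : List (A ⊕ B)) :
    vacuum f g ω v (wordProd w) = ω (wordAct f g v w) := by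
  have h : Coprod.liftAlg f g (wordProd w) v = wordAct f g v w := by
    induction w with
    | nil => simp [wordProd, wordAct]
    | cons x w ih =>
      rw [wordProd, List.map_cons, List.prod_cons, map_mul, Module.End.mul_apply]
      change Coprod.liftAlg f g _ (Coprod.liftAlg f g (wordProd w) v) = _
      rw [ih]
      cases x <;> simp [wordAct]
  exact congrArg ω h

/-- A homomorphism that is multiplicative but not unital, restricted to the kernel of a character
and extended to a unital homomorphism. -/
def augExt {R : Type*} [Ring R] [Algebra ℂ R] (ε : A →⋆ₐ[ℂ] ℂ) (T : A →ₗ[ℂ] R)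
    (hT : ∀ a b, T (a * b) = T a * T b) : A →ₐ[ℂ] R :=
  AlgHom.ofLinearMap
    (T - (ε.toAlgHom.toLinearMap).smulRight (T 1) + (ε.toAlgHom.toLinearMap).smulRight 1)
    (by simp) (by
      intro a b
      have h1 : T 1 * T b = T b := by rw [← hT, one_mul]
      have h2 : T a * T 1 = T a := by rw [← hT, mul_one]
      have h3 : T 1 * T 1 = T 1 := by rw [← hT, mul_one]
      simp [hT, mul_add, add_mul, mul_sub, sub_mul, h1, h2, h3, smul_smul, smul_sub, mul_comm (ε b)]
      abel)

theorem augExt_of_ker {R : Type*} [Ring R] [Algebra ℂ R] (ε : A →⋆ₐ[ℂ] ℂ) (T : A →ₗ[ℂ] R)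
    (hT : ∀ a b, T (a * b) = T a * T b) {a : A} (ha : ε a = 0) : augExt ε T hT a = T a := by
  simp [augExt, ha]

/-- `a` acts by `x ⊗ y ↦ a x ⊗ ψ(y) 1`. -/
def actL (ψ : B →ₗ[ℂ] ℂ) : A →ₗ[ℂ] Module.End ℂ (A ⊗[ℂ] B) :=
  (TensorProduct.mapBilinear (.id ℂ) A B A B).flip (ψ.smulRight 1) ∘ₗ LinearMap.mul ℂ A

/-- `b` acts by `x ⊗ y ↦ φ(x) 1 ⊗ b y`. -/
def actR (φ : A →ₗ[ℂ] ℂ) : B →ₗ[ℂ] Module.End ℂ (A ⊗[ℂ] B) :=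
  (TensorProduct.mapBilinear (.id ℂ) A B A B) (φ.smulRight 1) ∘ₗ LinearMap.mul ℂ B

theorem actL_tmul (ψ : B →ₗ[ℂ] ℂ) (a x : A) (y : B) :
    actL ψ a (x ⊗ₜ[ℂ] y) = (a * x) ⊗ₜ[ℂ] (ψ y • 1) := rfl

theorem actR_tmul (φ : A →ₗ[ℂ] ℂ) (b : B) (x : A) (y : B) :
    actR φ b (x ⊗ₜ[ℂ] y) = (φ x • 1) ⊗ₜ[ℂ] (b * y) := rfl

theorem actL_mul (ψ : B →ₗ[ℂ] ℂ) (hψ : ψ 1 = 1) (a a' : A) :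
    actL ψ (a * a') = actL ψ a * actL ψ a' := by
  ext x y
  simp [actL_tmul, hψ, mul_assoc]

theorem actR_mul (φ : A →ₗ[ℂ] ℂ) (hφ : φ 1 = 1) (b b' : B) :
    actR φ (b * b') = actR φ b * actR φ b' := by
  ext x y
  simp [actR_tmul, hφ, mul_assoc]

/-- Left multiplication by `a` on the left tensor factor. -/
def mulL : A →ₐ[ℂ] Module.End ℂ (A ⊗[ℂ] B) :=
  (Algebra.lmul ℂ (A ⊗[ℂ] B)).comp Algebra.TensorProduct.includeLeft

/-- Left multiplication by `b` on the right tensor factor. -/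
def mulR : B →ₐ[ℂ] Module.End ℂ (A ⊗[ℂ] B) :=
  (Algebra.lmul ℂ (A ⊗[ℂ] B)).comp Algebra.TensorProduct.includeRight

theorem mulL_tmul (a x : A) (y : B) : mulL a (x ⊗ₜ[ℂ] y) = (a * x) ⊗ₜ[ℂ] y := by
  simp [mulL]

theorem mulR_tmul (b : B) (x : A) (y : B) : mulR b (x ⊗ₜ[ℂ] y) = x ⊗ₜ[ℂ] (b * y) := by
  simp [mulR]

/-- The functional `x ⊗ y ↦ φ(x) ψ(y)`. -/
def tmulFun (φ : A →ₗ[ℂ] ℂ) (ψ : B →ₗ[ℂ] ℂ) : A ⊗[ℂ] B →ₗ[ℂ] ℂ :=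
  LinearMap.mul' ℂ ℂ ∘ₗ TensorProduct.map φ ψ

theorem tmulFun_tmul (φ : A →ₗ[ℂ] ℂ) (ψ : B →ₗ[ℂ] ℂ) (x : A) (y : B) :
    tmulFun φ ψ (x ⊗ₜ[ℂ] y) = φ x * ψ y := rfl

theorem exists_isTensorProduct (φ : A →ₗ[ℂ] ℂ) (ψ : B →ₗ[ℂ] ℂ) :
    ∃ Φ, IsTensorProduct φ ψ Φ := by
  refine ⟨vacuum mulL mulR (tmulFun φ ψ) (1 ⊗ₜ 1), fun w hw => ?_⟩
  clear hw
  have h : wordAct mulL mulR ((1 : A) ⊗ₜ[ℂ] (1 : B)) w = (lefts w).prod ⊗ₜ (rights w).prod := by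
    induction w with
    | nil => rfl
    | cons x w ih => cases x <;> simp [wordAct, ih, lefts, rights, mulL_tmul, mulR_tmul]
  rw [vacuum_wordProd, h, tmulFun_tmul]

theorem exists_isMonotoneProduct (εA : A →⋆ₐ[ℂ] ℂ) (εB : B →⋆ₐ[ℂ] ℂ) (φ : A →ₗ[ℂ] ℂ)
    (ψ : B →ₗ[ℂ] ℂ) (hψ : ψ 1 = 1) : ∃ Φ, IsMonotoneProduct εA εB φ ψ Φ := by
  refine ⟨vacuum (augExt εA (actL ψ) (actL_mul ψ hψ)) mulR (tmulFun φ ψ) (1 ⊗ₜ 1),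
    fun w hw hk => ?_⟩
  rw [vacuum_wordProd]
  have h : ∃ y : B, wordAct (augExt εA (actL ψ) (actL_mul ψ hψ)) mulR ((1 : A) ⊗ₜ[ℂ] (1 : B)) w =
      (lefts w).prod ⊗ₜ y ∧ ψ y = ((rights w).map ψ).prod ∧
      ((∀ b w', w ≠ .inr b :: w') → ∃ c : ℂ, y = c • 1) := by
    induction w with
    | nil => exact ⟨1, rfl, by simp [rights, hψ], fun _ => ⟨1, by simp⟩⟩
    | cons x w ih =>
      obtain ⟨y, h1, h2, h3⟩ := ih hw.tail (fun z hz => hk z (List.mem_cons_of_mem _ hz))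
      cases x with
      | inl a =>
        have ha : εA a = 0 := hk (.inl a) List.mem_cons_self
        refine ⟨ψ y • 1, ?_, by simp [hψ, h2, rights], fun _ => ⟨ψ y, rfl⟩⟩
        simp [wordAct, augExt_of_ker _ _ _ ha, h1, actL_tmul, lefts]
      | inr b =>
        refine ⟨b * y, by simp [wordAct, h1, mulR_tmul, lefts], ?_, fun h => (h b w rfl).elim⟩
        obtain ⟨c, rfl⟩ := h3 (by
          rintro b' w' rfl
          simp [Alternating] at hw)
        rw [map_smul, hψ] at h2
        simp [rights] at h2 ⊢
        rw [h2, mul_comm]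
  obtain ⟨y, h1, h2, -⟩ := h
  rw [h1, tmulFun_tmul, h2]

theorem exists_isAntimonotoneProduct (εA : A →⋆ₐ[ℂ] ℂ) (εB : B →⋆ₐ[ℂ] ℂ) (φ : A →ₗ[ℂ] ℂ)
    (ψ : B →ₗ[ℂ] ℂ) (hφ : φ 1 = 1) : ∃ Φ, IsAntimonotoneProduct εA εB φ ψ Φ := by
  refine ⟨vacuum mulL (augExt εB (actR φ) (actR_mul φ hφ)) (tmulFun φ ψ) (1 ⊗ₜ 1),
    fun w hw hk => ?_⟩
  rw [vacuum_wordProd]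
  have h : ∃ x : A, wordAct mulL (augExt εB (actR φ) (actR_mul φ hφ)) ((1 : A) ⊗ₜ[ℂ] (1 : B)) w =
      x ⊗ₜ (rights w).prod ∧ φ x = ((lefts w).map φ).prod ∧
      ((∀ a w', w ≠ .inl a :: w') → ∃ c : ℂ, x = c • 1) := by
    induction w with
    | nil => exact ⟨1, rfl, by simp [lefts, hφ], fun _ => ⟨1, by simp⟩⟩
    | cons x w ih =>
      obtain ⟨y, h1, h2, h3⟩ := ih hw.tail (fun z hz => hk z (List.mem_cons_of_mem _ hz))
      cases x with
      | inr b =>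
        have hb : εB b = 0 := hk (.inr b) List.mem_cons_self
        refine ⟨φ y • 1, ?_, by simp [hφ, h2, lefts], fun _ => ⟨φ y, rfl⟩⟩
        simp [wordAct, augExt_of_ker _ _ _ hb, h1, actR_tmul, rights]
      | inl a =>
        refine ⟨a * y, by simp [wordAct, h1, mulL_tmul, rights], ?_, fun h => (h a w rfl).elim⟩
        obtain ⟨c, rfl⟩ := h3 (by
          rintro b' w' rfl
          simp [Alternating] at hw)
        rw [map_smul, hφ] at h2
        simp [lefts] at h2 ⊢
        rw [h2, mul_comm]
  obtain ⟨y, h1, h2, -⟩ := h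
  rw [h1, tmulFun_tmul, h2]

theorem exists_isBooleanProduct (εA : A →⋆ₐ[ℂ] ℂ) (εB : B →⋆ₐ[ℂ] ℂ) (φ : A →ₗ[ℂ] ℂ)
    (ψ : B →ₗ[ℂ] ℂ) (hφ : φ 1 = 1) (hψ : ψ 1 = 1) : ∃ Φ, IsBooleanProduct εA εB φ ψ Φ := by
  refine ⟨vacuum (augExt εA (actL ψ) (actL_mul ψ hψ)) (augExt εB (actR φ) (actR_mul φ hφ))
    (tmulFun φ ψ) (1 ⊗ₜ 1), fun w hw hk => ?_⟩
  rw [vacuum_wordProd]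
  have h : ∃ (x : A) (y : B), wordAct (augExt εA (actL ψ) (actL_mul ψ hψ))
      (augExt εB (actR φ) (actR_mul φ hφ)) ((1 : A) ⊗ₜ[ℂ] (1 : B)) w = x ⊗ₜ y ∧
      φ x * ψ y = (w.map (Sum.elim φ ψ)).prod ∧
      ((∀ a w', w ≠ .inl a :: w') → ∃ c : ℂ, x = c • 1) ∧
      ((∀ b w', w ≠ .inr b :: w') → ∃ c : ℂ, y = c • 1) := by
    induction w with
    | nil => exact ⟨1, 1, rfl, by simp [hφ, hψ], fun _ => ⟨1, by simp⟩, fun _ => ⟨1, by simp⟩⟩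
    | cons x w ih =>
      obtain ⟨x', y, h1, h2, h3, h4⟩ := ih hw.tail (fun z hz => hk z (List.mem_cons_of_mem _ hz))
      cases x with
      | inl a =>
        have ha : εA a = 0 := hk (.inl a) List.mem_cons_self
        obtain ⟨c, rfl⟩ := h3 (by
          rintro b' w' rfl
          simp [Alternating] at hw)
        refine ⟨a * c • 1, ψ y • 1, ?_, ?_, fun h => (h a w rfl).elim, fun _ => ⟨ψ y, rfl⟩⟩
        · simp only [wordAct, augExt_of_ker _ _ _ ha, h1, actL_tmul]
        · rw [List.map_cons, List.prod_cons, ← h2]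
          simp [hφ, hψ]
          ring
      | inr b =>
        have hb : εB b = 0 := hk (.inr b) List.mem_cons_self
        obtain ⟨c, rfl⟩ := h4 (by
          rintro b' w' rfl
          simp [Alternating] at hw)
        refine ⟨φ x' • 1, b * c • 1, ?_, ?_, fun _ => ⟨φ x', rfl⟩, fun h => (h b w rfl).elim⟩
        · simp only [wordAct, augExt_of_ker _ _ _ hb, h1, actR_tmul]
        · rw [List.map_cons, List.prod_cons, ← h2]
          simp [hφ, hψ]
          ring
  obtain ⟨x, y, h1, h2, -, -⟩ := h
  rw [h1, tmulFun_tmul, h2]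

/-! The free product is realised on the vector space of words whose letters index bases of the two
spaces of centred elements. To obtain an action on the space spanned by *all* words, a word with an
initial run of letters of `A` of even length is treated as a word that does not start in `A`. -/

section FreeModel

variable {L I : Type*} (dec : L → Option I) (enc : I → L)

/-- The initial run of letters of the given kind has even length. -/
def evenRun : List L → Bool
  | [] => true
  | l :: w => if (dec l).isSome then !evenRun w else true

variable (φ : A →ₗ[ℂ] ℂ) (hφ : φ 1 = 1) (bas : Module.Basis I ℂ (LinearMap.ker φ))

/-- The projection `a ↦ a - φ(a)1` onto the centred elements. -/
def centre : A →ₗ[ℂ] LinearMap.ker φ :=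
  (LinearMap.id - φ.smulRight (1 : A)).codRestrict (LinearMap.ker φ) (by
    intro a
    simp [hφ])

theorem centre_coe (a : A) : (centre φ hφ a : A) = a - φ a • 1 := rfl

/-- `a ↦ φ(a) w + ∑ₛ aₛ (s w)`, where `a - φ(a)1 = ∑ₛ aₛ bas s`. -/
def prep (w : List L) : A →ₗ[ℂ] (List L →₀ ℂ) :=
  φ.smulRight (Finsupp.single w 1) +
    Finsupp.lmapDomain ℂ ℂ (fun s => enc s :: w) ∘ₗ bas.repr.toLinearMap ∘ₗ centre φ hφ

/-- The action on a word: the first letter is multiplied if it has the right kind. -/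
def freeOn : List L → (A →ₗ[ℂ] (List L →₀ ℂ))
  | [] => prep enc φ hφ bas []
  | l :: w => match dec l with
    | none => prep enc φ hφ bas (l :: w)
    | some s => if evenRun dec w then
        prep enc φ hφ bas w ∘ₗ LinearMap.mulRight ℂ (bas s : A) else prep enc φ hφ bas (l :: w)

/-- The action on the space spanned by words. -/
def freeLin : A →ₗ[ℂ] Module.End ℂ (List L →₀ ℂ) :=
  (Finsupp.linearCombination ℂ (freeOn dec enc φ hφ bas)).flip

theorem freeLin_single (a : A) (w : List L) :
    freeLin dec enc φ hφ bas a (Finsupp.single w 1) = freeOn dec enc φ hφ bas w a := by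
  simp [freeLin]

theorem prep_one (w : List L) : prep enc φ hφ bas w 1 = Finsupp.single w 1 := by
  have : centre φ hφ 1 = 0 := by
    apply Subtype.ext
    simp [centre_coe, hφ]
  simp [prep, this, hφ]

theorem centre_ker (a : LinearMap.ker φ) : centre φ hφ (a : A) = a := by
  apply Subtype.ext
  have h : φ (a : A) = 0 := a.2
  simp [centre_coe, h]

theorem prep_ker (w : List L) (a : LinearMap.ker φ) : prep enc φ hφ bas w (a : A) =
    Finsupp.mapDomain (fun s => enc s :: w) (bas.repr a) := by
  simp [prep, centre_ker]

theorem freeOn_even {w : List L} (hw : evenRun dec w = true) :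
    freeOn dec enc φ hφ bas w = prep enc φ hφ bas w := by
  cases w with
  | nil => rfl
  | cons l w =>
    rw [freeOn]
    cases h : dec l with
    | none => rfl
    | some s =>
      simp [evenRun, h] at hw
      simp [hw]

theorem freeOn_enc (hd : ∀ l s, dec l = some s ↔ l = enc s) {w : List L}
    (hw : evenRun dec w = true) (s : I) :
    freeOn dec enc φ hφ bas (enc s :: w) =
      prep enc φ hφ bas w ∘ₗ LinearMap.mulRight ℂ (bas s : A) := by
  rw [freeOn]
  simp [(hd (enc s) s).2 rfl, hw]

theorem freeLin_prep (hd : ∀ l s, dec l = some s ↔ l = enc s) {w : List L}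
    (hw : evenRun dec w = true) (a x : A) :
    freeLin dec enc φ hφ bas a (prep enc φ hφ bas w x) = prep enc φ hφ bas w (a * x) := by
  have h1 : ∀ y : LinearMap.ker φ, freeLin dec enc φ hφ bas a (prep enc φ hφ bas w (y : A)) =
      prep enc φ hφ bas w (a * (y : A)) := by
    have h2 : freeLin dec enc φ hφ bas a ∘ₗ prep enc φ hφ bas w ∘ₗ (LinearMap.ker φ).subtype =
        prep enc φ hφ bas w ∘ₗ LinearMap.mulLeft ℂ a ∘ₗ (LinearMap.ker φ).subtype := by
      refine bas.ext fun s => ?_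
      simp [prep_ker, freeLin_single, freeOn_enc dec enc φ hφ bas hd hw]
    exact fun y => LinearMap.congr_fun h2 y
  have hx : x = φ x • 1 + (centre φ hφ x : A) := by simp [centre_coe]
  rw [hx, map_add, map_add, h1, map_smul, map_smul, prep_one, freeLin_single,
    freeOn_even dec enc φ hφ bas hw, mul_add, map_add, mul_smul_comm, map_smul, mul_one]

/-- The action by algebra endomorphisms. -/
def freeAct (hd : ∀ l s, dec l = some s ↔ l = enc s) :
    A →ₐ[ℂ] Module.End ℂ (List L →₀ ℂ) :=
  have key : ∀ w : List L, ∃ v, evenRun dec v = true ∧ ∃ y : A,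
      freeOn dec enc φ hφ bas w = prep enc φ hφ bas v ∘ₗ LinearMap.mulRight ℂ y ∧
      prep enc φ hφ bas v y = Finsupp.single w 1 := by
    intro w
    by_cases hw : evenRun dec w = true
    · refine ⟨w, hw, 1, ?_, prep_one enc φ hφ bas w⟩
      rw [freeOn_even dec enc φ hφ bas hw]
      ext a : 1
      simp
    · cases w with
      | nil => simp [evenRun] at hw
      | cons l w =>
        cases h : dec l with
        | none => simp [evenRun, h] at hw
        | some s =>
          obtain rfl := (hd l s).1 h
          have hw' : evenRun dec w = true := by simpa [evenRun, h] using hw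
          exact ⟨w, hw', bas s, freeOn_enc dec enc φ hφ bas hd hw' s, by simp [prep_ker]⟩
  AlgHom.ofLinearMap (freeLin dec enc φ hφ bas)
    (by
      refine Finsupp.lhom_ext' fun w => LinearMap.ext_ring ?_
      obtain ⟨v, hv, y, h1, h2⟩ := key w
      simp [freeLin_single, h1, h2])
    (by
      intro a b
      refine Finsupp.lhom_ext' fun w => LinearMap.ext_ring ?_
      obtain ⟨v, hv, y, h1, h2⟩ := key w
      simp [freeLin_single, h1, freeLin_prep dec enc φ hφ bas hd hv, mul_assoc])

/-- A centred element adds one letter to each word that does not start with its kind. -/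
theorem freeAct_mem (hd : ∀ l s, dec l = some s ↔ l = enc s) {a : A} (ha : φ a = 0)
    {P Q : Set (List L)} (hP : ∀ w ∈ P, evenRun dec w = true ∧ ∀ s, enc s :: w ∈ Q)
    {v : List L →₀ ℂ} (hv : v ∈ Finsupp.supported ℂ ℂ P) :
    freeAct dec enc φ hφ bas hd a v ∈ Finsupp.supported ℂ ℂ Q := by
  classical
  have h : Finsupp.supported ℂ ℂ P ≤
      (Finsupp.supported ℂ ℂ Q).comap (freeAct dec enc φ hφ bas hd a) := by
    rw [Finsupp.supported_eq_span_single, Submodule.span_le]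
    rintro _ ⟨w, hw, rfl⟩
    change freeLin dec enc φ hφ bas a (Finsupp.single w 1) ∈ Finsupp.supported ℂ ℂ Q
    rw [freeLin_single, freeOn_even dec enc φ hφ bas (hP w hw).1]
    have := prep_ker enc φ hφ bas w ⟨a, ha⟩
    rw [this]
    refine (Finsupp.mem_supported ℂ _).2 ?_
    intro l hl
    have := Finsupp.mapDomain_support hl
    obtain ⟨s, -, rfl⟩ := Finset.mem_image.1 this
    exact (hP w hw).2 s
  exact h hv

end FreeModel

theorem exists_isFreeProduct (φ : A →ₗ[ℂ] ℂ) (ψ : B →ₗ[ℂ] ℂ) (hφ : φ 1 = 1) (hψ : ψ 1 = 1) :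
    ∃ Φ, IsFreeProduct φ ψ Φ := by
  let bA := Module.Basis.ofVectorSpace ℂ (LinearMap.ker φ)
  let bB := Module.Basis.ofVectorSpace ℂ (LinearMap.ker ψ)
  let IA := Module.Basis.ofVectorSpaceIndex ℂ (LinearMap.ker φ)
  let IB := Module.Basis.ofVectorSpaceIndex ℂ (LinearMap.ker ψ)
  have hdA : ∀ (l : IA ⊕ IB) s, l.getLeft? = some s ↔ l = .inl s := by
    rintro (l | l) s <;> simp
  have hdB : ∀ (l : IA ⊕ IB) s, l.getRight? = some s ↔ l = .inr s := by
    rintro (l | l) s <;> simp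
  let f := freeAct (L := IA ⊕ IB) Sum.getLeft? Sum.inl φ hφ bA hdA
  let g := freeAct (L := IA ⊕ IB) Sum.getRight? Sum.inr ψ hψ bB hdB
  refine ⟨vacuum f g (Finsupp.lapply []) (Finsupp.single [] 1), ?_, ?_⟩
  · exact (vacuum_wordProd f g _ _ []).trans (by simp [wordAct])
  · intro w hne hw hk
    rw [vacuum_wordProd]
    have h : wordAct f g (Finsupp.single [] 1) w ∈
        Finsupp.supported ℂ ℂ {l : List (IA ⊕ IB) | l.map Sum.isLeft = w.map Sum.isLeft} := by
      clear hne
      induction w with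
      | nil => exact Finsupp.single_mem_supported ℂ 1 (by simp)
      | cons x w ih =>
        have ih := ih hw.tail (fun z hz => hk z (List.mem_cons_of_mem _ hz))
        have hx := hk x List.mem_cons_self
        have hhead : ∀ l : List (IA ⊕ IB), l.map Sum.isLeft = w.map Sum.isLeft →
            ∀ y l', l = y :: l' → y.isLeft ≠ x.isLeft := by
          rintro l hl y l' rfl
          cases w with
          | nil => simp at hl
          | cons z w =>
            simp [Alternating] at hw hl
            rw [hl.1]
            exact fun h => hw.1 h.symm
        cases x with
        | inl a =>
          refine freeAct_mem Sum.getLeft? Sum.inl φ hφ bA hdA hx ?_ ih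
          intro l hl
          refine ⟨?_, fun s => congrArg (List.cons _) hl⟩
          cases l with
          | nil => rfl
          | cons y l' =>
            have := hhead _ hl y l' rfl
            cases y <;> simp [evenRun] at this ⊢
        | inr b =>
          refine freeAct_mem Sum.getRight? Sum.inr ψ hψ bB hdB hx ?_ ih
          intro l hl
          refine ⟨?_, fun s => congrArg (List.cons _) hl⟩
          cases l with
          | nil => rfl
          | cons y l' =>
            have := hhead _ hl y l' rfl
            cases y <;> simp [evenRun] at this ⊢
    have h0 := (Finsupp.mem_supported' ℂ _).1 h [] (by
      intro h
      apply hne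
      simpa using h.symm)
    exact h0

/-! #### The five products of states -/

/-- The free product of two states. -/
def freeProd (φ : State A) (ψ : State B) : Coprod A B →ₗ[ℂ] ℂ :=
  (exists_isFreeProduct φ.toLin ψ.toLin φ.map_one ψ.map_one).choose

/-- The tensor product of two states. -/
def tensorProd (φ : State A) (ψ : State B) : Coprod A B →ₗ[ℂ] ℂ :=
  (exists_isTensorProduct φ.toLin ψ.toLin).choose

/-- The boolean product of two states. -/
def booleanProd (εA : A →⋆ₐ[ℂ] ℂ) (εB : B →⋆ₐ[ℂ] ℂ) (φ : State A) (ψ : State B) :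
    Coprod A B →ₗ[ℂ] ℂ :=
  (exists_isBooleanProduct εA εB φ.toLin ψ.toLin φ.map_one ψ.map_one).choose

/-- The monotone product of two states. -/
def monotoneProd (εA : A →⋆ₐ[ℂ] ℂ) (εB : B →⋆ₐ[ℂ] ℂ) (φ : State A) (ψ : State B) :
    Coprod A B →ₗ[ℂ] ℂ :=
  (exists_isMonotoneProduct εA εB φ.toLin ψ.toLin ψ.map_one).choose

/-- The anti-monotone product of two states. -/
def antimonotoneProd (εA : A →⋆ₐ[ℂ] ℂ) (εB : B →⋆ₐ[ℂ] ℂ) (φ : State A) (ψ : State B) :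
    Coprod A B →ₗ[ℂ] ℂ :=
  (exists_isAntimonotoneProduct εA εB φ.toLin ψ.toLin φ.map_one).choose

end Products

/-! ### Convolutions and Haar traces -/

section Convolution

variable {n : ℕ}

/-- `φ ⋆_F ψ = (φ ∗ ψ) ∘ Δ`. -/
def freeConv (φ ψ : State (UAlg n)) : UAlg n →ₗ[ℂ] ℂ :=
  freeProd φ ψ ∘ₗ (UAlg.Δ n).toAlgHom.toLinearMap

/-- `φ ⋆_T ψ = (φ ⊗ ψ) ∘ Δ`. -/
def tensorConv (φ ψ : State (UAlg n)) : UAlg n →ₗ[ℂ] ℂ :=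
  tensorProd φ ψ ∘ₗ (UAlg.Δ n).toAlgHom.toLinearMap

/-- `φ ⋆_B ψ = (φ ⋄ ψ) ∘ Δ`, for the decomposition `ℂ1 ⊕ ker δ`. -/
def booleanConv (φ ψ : State (UAlg n)) : UAlg n →ₗ[ℂ] ℂ :=
  booleanProd (UAlg.δ n) (UAlg.δ n) φ ψ ∘ₗ (UAlg.Δ n).toAlgHom.toLinearMap

/-- `φ ⋆_M ψ = (φ ▷ ψ) ∘ Δ`, for the decomposition `ℂ1 ⊕ ker δ`. -/
def monotoneConv (φ ψ : State (UAlg n)) : UAlg n →ₗ[ℂ] ℂ :=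
  monotoneProd (UAlg.δ n) (UAlg.δ n) φ ψ ∘ₗ (UAlg.Δ n).toAlgHom.toLinearMap

/-- `φ ⋆_AM ψ = (φ ◁ ψ) ∘ Δ`, for the decomposition `ℂ1 ⊕ ker δ`. -/
def antimonotoneConv (φ ψ : State (UAlg n)) : UAlg n →ₗ[ℂ] ℂ :=
  antimonotoneProd (UAlg.δ n) (UAlg.δ n) φ ψ ∘ₗ (UAlg.Δ n).toAlgHom.toLinearMap

/-- `h` is a Haar trace for the convolution `conv`: a tracial state that absorbs every tracial
state on both sides. -/
def IsHaarTrace (conv : State (UAlg n) → State (UAlg n) → (UAlg n →ₗ[ℂ] ℂ))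
    (h : State (UAlg n)) : Prop :=
  h.IsTracial ∧ ∀ φ : State (UAlg n), φ.IsTracial → conv φ h = h.toLin ∧ conv h φ = h.toLin

end Convolution

/-! ### The compression of a Haar unitary -/

/-- The normalized trace `tr_n = Tr / n` on `n × n` matrices. -/
def ntr (n : ℕ) : Matrix (Fin n) (Fin n) ℂ →ₗ[ℂ] ℂ :=
  (n : ℂ)⁻¹ • Matrix.traceLinearMap (Fin n) ℂ ℂ

/-- The normalized trace as a state. -/
def trState (n : ℕ) (hn : 1 ≤ n) : State (Matrix (Fin n) (Fin n) ℂ) where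
  toLin := ntr n
  map_one := by
    have : (n : ℂ) ≠ 0 := by exact_mod_cast (by omega : n ≠ 0)
    simp [ntr, this]
  nonneg a := by
    have h : 0 ≤ (star a * a).trace := (Matrix.posSemidef_conjTranspose_mul_self a).trace_nonneg
    have h2 : (0 : ℂ) ≤ (n : ℂ)⁻¹ := by positivity
    simpa [ntr] using mul_nonneg h2 h

/-- `U` is a Haar unitary in the noncommutative probability space `(A, φ)`. -/
def IsHaarUnitary {A : Type*} [Ring A] [StarRing A] [Algebra ℂ A] (φ : State A) (U : A) : Prop :=
  U ∈ unitary A ∧ ∀ k : ℕ, 1 ≤ k → φ (U ^ k) = 0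

/-- `j : Uₙⁿᶜ → E₁₁ (A ⊔ Mₙ) E₁₁` is the `*`-homomorphism with `j(uᵢⱼ) = E₁ᵢ U Eⱼ₁`. The corner has
unit `E₁₁`, so that, as a map to `A ⊔ Mₙ`, `j` is a non-unital `*`-homomorphism with
`j(1) = E₁₁`. The index `1` is the element `0` of `Fin n`. -/
def IsCompression {A : Type*} [Ring A] [StarRing A] [Algebra ℂ A] [StarModule ℂ A] {n : ℕ}
    (hn : 1 ≤ n) (U : A) (j : UAlg n →⋆ₙₐ[ℂ] Coprod A (Matrix (Fin n) (Fin n) ℂ)) : Prop :=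
  j 1 = Coprod.inr A _ (Matrix.single ⟨0, hn⟩ ⟨0, hn⟩ 1) ∧
  ∀ k l : Fin n, j (UAlg.u k l) =
    Coprod.inr A _ (Matrix.single ⟨0, hn⟩ k 1) * Coprod.inl A _ U *
      Coprod.inr A _ (Matrix.single l ⟨0, hn⟩ 1)

/-! ### The Hilbert space `ℓ²(ℤ) ⊗ ⨂_{k ∈ ℤ} Mₙ` -/

/-- Families of matrices indexed by `ℤ`, all but finitely many of which are the identity. -/
def MatFamily (n : ℕ) : Type :=
  {M : ℤ → Matrix (Fin n) (Fin n) ℂ // {p | M p ≠ 1}.Finite}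

namespace MatFamily

/-- The family of identity matrices. -/
def one (n : ℕ) : MatFamily n := ⟨fun _ => 1, by simp⟩

/-- Multiply the matrix at position `p` by `X` from the left. -/
def mulAt {n : ℕ} (p : ℤ) (X : Matrix (Fin n) (Fin n) ℂ) (M : MatFamily n) : MatFamily n :=
  ⟨Function.update M.1 p (X * M.1 p), (M.2.insert p).subset (by
    intro q hq
    by_cases h : q = p
    · exact Or.inl h
    · right
      simpa [Function.update_of_ne h] using hq)⟩

end MatFamily

/-- The Hilbert space `H`, with the vectors `e k M = δ_k ⊗ ⨂_p M_p`, is the Hilbert space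
`ℓ²(ℤ) ⊗ ⨂_{p ∈ ℤ} Mₙ`, where `Mₙ` has the inner product `tr_n(A* B)` and the infinite tensor
product is taken along the identity matrices: the elementary tensors have the inner products
`⟨δ_k ⊗ ⨂ M_p, δ_l ⊗ ⨂ N_p⟩ = δ_{kl} ∏_p tr_n(M_p* N_p)` and span a dense subspace. -/
structure IsShiftSpace (n : ℕ) {H : Type*} [NormedAddCommGroup H] [InnerProductSpace ℂ H]
    (e : ℤ → MatFamily n → H) : Prop where
  inner_eq : ∀ k l M N, inner ℂ (e k M) (e l N) =
    if k = l then ∏ᶠ p, ntr n (star (M.1 p) * N.1 p) else 0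
  dense : Dense (Submodule.span ℂ {x | ∃ k M, x = e k M} : Set H)

/-- `j : Uₙⁿᶜ → B(H)` sends `uᵢⱼ` to the operator
`δ_k ⊗ (… ⊗ M_k ⊗ …) ↦ δ_{k+1} ⊗ (… ⊗ Eⱼᵢ M_k ⊗ …)`. -/
def IsShiftRep {n : ℕ} {H : Type*} [NormedAddCommGroup H] [InnerProductSpace ℂ H]
    [CompleteSpace H] (e : ℤ → MatFamily n → H) (j : UAlg n →⋆ₐ[ℂ] (H →L[ℂ] H)) : Prop :=
  ∀ (i l : Fin n) (k : ℤ) (M : MatFamily n),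
    j (UAlg.u i l) (e k M) = e (k + 1) (M.mulAt k (Matrix.single l i 1))

end UDual

end

open UDual

/-! Non-existence. In the boolean and the anti-monotone product a word a⁽¹⁾ b⁽²⁾ a'⁽¹⁾ with φ(a) = 0
has the value δ(b) φ(aa'): the inner letter is seen only through the counit
(`SplitsInner.apply_of_eq_zero`). Expanding Δ(uᵢⱼ uₖₗ*) then gives (φ ⋆ h)(uᵢⱼ uₖₗ*) = φ(uᵢⱼ uₖₗ*)
for every φ with vanishing first moments, whatever h is. An absorbing h would share these second
moments with all tracial φ of this kind. The average of the characters u ↦ V and u ↦ -V has second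
moments Vᵢⱼ times the conjugate of Vₖₗ, which depend on V when n ≥ 2. The monotone product is
treated with the legs exchanged.

Free case. Work with n × n matrices over the Brown algebra, which are generated by the unitary U =
(uᵢⱼ) and the scalar matrices. Splitting a scalar matrix into a traceless part and a multiple of the
unit, and cancelling U^s U^{-s}, writes every matrix as a combination of scalar matrices times
reduced words (`redSpan_eq_top`). Hence a unital functional annihilating the entries of all nonempty
reduced words (`IsFreeHaar`) is unique, and the same cancellation shows that it is tracial and, by a
recursion for Gram matrices (`IsFreeHaar.gram_eq`), positive. Convolution replaces U by U⁽¹⁾U⁽²⁾. By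
freeness of the legs, a leg that is free Haar stays so relative to all matrices over the other leg
(`IsFreeIn.apply_mul_evalW`), and conjugation by the other unitary preserves the trace because φ is
tracial. So φ ⋆ h and h ⋆ φ annihilate reduced words and equal h. The compression of any Haar
unitary gives such a functional, since A ⊔ Mₙ is identified with matrices over the commutant of Mₙ;
the circle provides a Haar unitary.

Tensor case. The vector state of Ω is a trace because right multiplications combined with the shift
commute with the representation. Modulo cyclic rotation, a word in the generators either is properly
nested, each u being matched by a later u*, or has unequal numbers of u and u* (`ext_of_tracial`).
Unbalanced words shift the level in ℓ²(ℤ), so both h and φ ⋆ h vanish on them. On nested words (id ⊗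
j)Δ(x) = 1 ⊗ j(x), because the matrix unit product Eₗₚ E_{qm} left at a fresh site is δ_{pq} Eₗₘ.
This gives absorption from the left, and transposition gives it from the right.

Uniqueness of any Haar trace is formal: two of them both equal their convolution. -/

noncomputable section

namespace UDual

/-! ### Tracial states on the Brown algebra given by scalar unitaries -/

section General

variable {A : Type*} [Ring A] [StarRing A] [Algebra ℂ A] [StarModule ℂ A]

/-- The average of two characters, as a state. -/
def charAvg (f g : A →⋆ₐ[ℂ] ℂ) : State A where
  toLin := (2 : ℂ)⁻¹ • (f.toAlgHom.toLinearMap + g.toAlgHom.toLinearMap)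
  map_one := by simp; norm_num
  nonneg a := by
    have h : ∀ f : A →⋆ₐ[ℂ] ℂ, 0 ≤ f (star a * a) := fun f => by
      rw [map_mul, map_star]
      exact star_mul_self_nonneg (f a)
    have h2 : (0 : ℂ) ≤ 2⁻¹ := by positivity
    exact mul_nonneg h2 (add_nonneg (h f) (h g))

theorem charAvg_apply (f g : A →⋆ₐ[ℂ] ℂ) (a : A) : charAvg f g a = 2⁻¹ * (f a + g a) := rfl

theorem charAvg_isTracial (f g : A →⋆ₐ[ℂ] ℂ) : (charAvg f g).IsTracial := by
  intro a b
  simp only [charAvg_apply, map_mul, mul_comm]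

end General

section NoHaar

variable {n : ℕ}

/-- The average of the characters `u ↦ V` and `u ↦ -V`. -/
def signAvg (V : unitary (Matrix (Fin n) (Fin n) ℂ)) : State (UAlg n) :=
  charAvg (UAlg.lift V) (UAlg.lift (-V))

/-- Words of odd length cancel between V and -V, while words of length two have the same value at
both. This kills the first moments and keeps the second ones. -/
theorem signAvg_u (V : unitary (Matrix (Fin n) (Fin n) ℂ)) (i j : Fin n) :
    signAvg V (UAlg.u i j) = 0 := by
  have h : (-V).1 i j = -V.1 i j := rfl
  simp [signAvg, charAvg_apply, UAlg.lift_u, h]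

theorem signAvg_star_u (V : unitary (Matrix (Fin n) (Fin n) ℂ)) (i j : Fin n) :
    signAvg V (star (UAlg.u i j)) = 0 := by
  have h : (-V).1 i j = -V.1 i j := rfl
  simp [h, signAvg, charAvg_apply, UAlg.lift_u, map_star]

theorem signAvg_u_star_u (V : unitary (Matrix (Fin n) (Fin n) ℂ)) (i j k l : Fin n) :
    signAvg V (UAlg.u i j * star (UAlg.u k l)) = V.1 i j * star (V.1 k l) := by
  have h : ∀ i j, (-V).1 i j = -V.1 i j := fun _ _ => rfl
  simp [h, signAvg, charAvg_apply, UAlg.lift_u, map_star]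
  ring

theorem signAvg_star_u_u (V : unitary (Matrix (Fin n) (Fin n) ℂ)) (i j k l : Fin n) :
    signAvg V (star (UAlg.u i j) * UAlg.u k l) = star (V.1 i j) * V.1 k l := by
  have h : ∀ i j, (-V).1 i j = -V.1 i j := fun _ _ => rfl
  simp [h, signAvg, charAvg_apply, UAlg.lift_u, map_star]
  ring

/-- The diagonal unitary with `-1` in the first place and `1` elsewhere. -/
def reflUnitary (n : ℕ) : unitary (Matrix (Fin n) (Fin n) ℂ) :=
  ⟨Matrix.diagonal fun i => if i.1 = 0 then -1 else 1, by
    have h : star (Matrix.diagonal fun i : Fin n => if i.1 = 0 then (-1 : ℂ) else 1) =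
        Matrix.diagonal fun i : Fin n => if i.1 = 0 then (-1 : ℂ) else 1 := by
      rw [Matrix.star_eq_conjTranspose, Matrix.diagonal_conjTranspose]
      congr 1
      ext i
      simp only [Pi.star_apply]
      split_ifs <;> simp
    have h2 : (Matrix.diagonal fun i : Fin n => if i.1 = 0 then (-1 : ℂ) else 1) *
        (Matrix.diagonal fun i : Fin n => if i.1 = 0 then (-1 : ℂ) else 1) = 1 := by
      rw [Matrix.diagonal_mul_diagonal, ← Matrix.diagonal_one]
      congr 1
      ext i
      split_ifs <;> simp
    rw [Unitary.mem_iff, h, h2]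
    exact ⟨rfl, rfl⟩⟩

/-- No linear functional agrees on all `uᵢⱼ uₖₗ*` with every `signAvg V`. -/
theorem signAvg_ne (hn : 2 ≤ n) (F : Fin n → Fin n → Fin n → Fin n → ℂ)
    (hF : ∀ (V : unitary (Matrix (Fin n) (Fin n) ℂ)) i j k l,
      F i j k l = V.1 i j * star (V.1 k l)) : False := by
  -- The (0,0) entry times the conjugate of the (1,1) entry is 1 at the unit matrix and -1 at the
  -- reflection. A second index requires n ≥ 2.
  have h1 := hF 1 ⟨0, by omega⟩ ⟨0, by omega⟩ ⟨1, by omega⟩ ⟨1, by omega⟩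
  have h2 := hF (reflUnitary n) ⟨0, by omega⟩ ⟨0, by omega⟩ ⟨1, by omega⟩ ⟨1, by omega⟩
  rw [h1] at h2
  simp [reflUnitary] at h2
  norm_num at h2

/-! ### Three-letter words in the boolean, monotone and anti-monotone products -/

/-- `Φ` factorizes on three-letter words whose inner letter lies in the kernel of a character. -/
def SplitsInner {A B E : Type*} [Ring A] [StarRing A] [Algebra ℂ A] [Ring B] [StarRing B]
    [Algebra ℂ B] [Ring E] [StarRing E] [Algebra ℂ E] (f : A →⋆ₐ[ℂ] E) (g : B →⋆ₐ[ℂ] E)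
    (εB : B →⋆ₐ[ℂ] ℂ) (φ : A →ₗ[ℂ] ℂ) (ψ : B →ₗ[ℂ] ℂ) (Φ : E →ₗ[ℂ] ℂ) : Prop :=
  (∀ a, Φ (f a) = φ a) ∧ ∀ a b a', εB b = 0 → Φ (f a * g b * f a') = φ a * ψ b * φ a'

section Splits

variable {A B E : Type*} [Ring A] [StarRing A] [Algebra ℂ A] [Ring B] [StarRing B]
    [Algebra ℂ B] [Ring E] [StarRing E] [Algebra ℂ E] {f : A →⋆ₐ[ℂ] E} {g : B →⋆ₐ[ℂ] E}
    {εA : A →⋆ₐ[ℂ] ℂ} {εB : B →⋆ₐ[ℂ] ℂ} {φ : A →ₗ[ℂ] ℂ} {ψ : B →ₗ[ℂ] ℂ} {Φ : E →ₗ[ℂ] ℂ}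

/-- The products are prescribed only on letters in the kernels of the characters. An outer letter is
a multiple of the unit plus a kernel element, so linearity and the shorter words cover arbitrary
outer letters. The inner letter has to stay in the kernel. -/
theorem splitsInner_of_ker (hφ : φ 1 = 1) (h1 : Φ 1 = 1) (hA : ∀ a, εA a = 0 → Φ (f a) = φ a)
    (hB : ∀ b, εB b = 0 → Φ (g b) = ψ b)
    (hAB : ∀ a b, εA a = 0 → εB b = 0 → Φ (f a * g b) = φ a * ψ b)
    (hBA : ∀ a b, εA a = 0 → εB b = 0 → Φ (g b * f a) = ψ b * φ a)
    (hABA : ∀ a b a', εA a = 0 → εB b = 0 → εA a' = 0 →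
      Φ (f a * g b * f a') = φ a * ψ b * φ a') : SplitsInner f g εB φ ψ Φ := by
  have hdec : ∀ a : A, ∃ c : ℂ, ∃ x : A, εA x = 0 ∧ a = c • 1 + x := fun a =>
    ⟨εA a, a - εA a • 1, by simp, by simp⟩
  constructor
  · intro a
    obtain ⟨c, x, hx, rfl⟩ := hdec a
    simp [h1, hφ, hA x hx]
  · intro a b a' hb
    obtain ⟨c, x, hx, rfl⟩ := hdec a
    obtain ⟨c', x', hx', rfl⟩ := hdec a'
    simp only [map_add, map_smul, map_one, add_mul, mul_add, smul_mul_assoc, mul_smul_comm,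
      one_mul, mul_one, hφ, hB b hb, hAB x b hx hb, hBA x' b hx' hb, hABA x b x' hx hb hx',
      smul_eq_mul]
    ring

/-- Write b = ε(b)1 + b₀. The term with b₀ carries the factor φ(a) = 0, and in the other term the
outer letters meet and multiply. The functional ψ drops out altogether. -/
theorem SplitsInner.apply_of_eq_zero (h : SplitsInner f g εB φ ψ Φ) {a : A} (ha : φ a = 0)
    (b : B) (a' : A) : Φ (f a * g b * f a') = εB b * φ (a * a') := by
  have h1 := h.2 a (b - εB b • 1) a' (by simp)
  rw [ha, map_sub, map_smul, map_one, mul_sub, sub_mul, map_sub, mul_smul_comm, mul_one,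
    smul_mul_assoc, map_smul, ← map_mul, h.1] at h1
  simpa [sub_eq_zero] using h1

end Splits

section Legs

variable {A B : Type*} [Ring A] [StarRing A] [Algebra ℂ A] [StarModule ℂ A]
  [Ring B] [StarRing B] [Algebra ℂ B] [StarModule ℂ B] {εA : A →⋆ₐ[ℂ] ℂ} {εB : B →⋆ₐ[ℂ] ℂ}
  {φ : A →ₗ[ℂ] ℂ} {ψ : B →ₗ[ℂ] ℂ} {Φ : Coprod A B →ₗ[ℂ] ℂ}

theorem wordProd_nil : wordProd ([] : List (A ⊕ B)) = 1 := rfl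

theorem wordProd_cons_inl (a : A) (w : List (A ⊕ B)) :
    wordProd (.inl a :: w) = Coprod.inl A B a * wordProd w := by
  simp [wordProd]

theorem wordProd_cons_inr (b : B) (w : List (A ⊕ B)) :
    wordProd (.inr b :: w) = Coprod.inr A B b * wordProd w := by
  simp [wordProd]

theorem IsBooleanProduct.splitsInner (hφ : φ 1 = 1) (h : IsBooleanProduct εA εB φ ψ Φ) :
    SplitsInner (Coprod.inl A B) (Coprod.inr A B) εB φ ψ Φ := by
  refine splitsInner_of_ker (εA := εA) hφ ?_ ?_ ?_ ?_ ?_ ?_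
  · simpa [wordProd_nil] using h [] (by simp [Alternating]) (by simp [LettersInKer])
  · intro a ha
    simpa [wordProd] using h [.inl a] (by simp [Alternating]) (by simp [LettersInKer, ha])
  · intro b hb
    simpa [wordProd] using h [.inr b] (by simp [Alternating]) (by simp [LettersInKer, hb])
  · intro a b ha hb
    simpa [wordProd] using
      h [.inl a, .inr b] (by simp [Alternating]) (by simp [LettersInKer, ha, hb])
  · intro a b ha hb
    simpa [wordProd] using
      h [.inr b, .inl a] (by simp [Alternating]) (by simp [LettersInKer, ha, hb])
  · intro a b a' ha hb ha'
    simpa [wordProd, mul_assoc] using h [.inl a, .inr b, .inl a'] (by simp [Alternating])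
      (by simp [LettersInKer, ha, hb, ha'])

theorem IsAntimonotoneProduct.splitsInner (hφ : φ 1 = 1) (hψ : ψ 1 = 1)
    (h : IsAntimonotoneProduct εA εB φ ψ Φ) :
    SplitsInner (Coprod.inl A B) (Coprod.inr A B) εB φ ψ Φ := by
  refine splitsInner_of_ker (εA := εA) hφ ?_ ?_ ?_ ?_ ?_ ?_
  · simpa [wordProd_nil, lefts, rights, hψ] using
      h [] (by simp [Alternating]) (by simp [LettersInKer])
  · intro a ha
    simpa [wordProd, lefts, rights, hψ] using
      h [.inl a] (by simp [Alternating]) (by simp [LettersInKer, ha])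
  · intro b hb
    simpa [wordProd, lefts, rights, hφ] using
      h [.inr b] (by simp [Alternating]) (by simp [LettersInKer, hb])
  · intro a b ha hb
    simpa [wordProd, lefts, rights] using
      h [.inl a, .inr b] (by simp [Alternating]) (by simp [LettersInKer, ha, hb])
  · intro a b ha hb
    simpa [wordProd, lefts, rights, mul_comm (φ a)] using
      h [.inr b, .inl a] (by simp [Alternating]) (by simp [LettersInKer, ha, hb])
  · intro a b a' ha hb ha'
    have := h [.inl a, .inr b, .inl a'] (by simp [Alternating])
      (by simp [LettersInKer, ha, hb, ha'])
    simp only [wordProd, lefts, rights, List.map_cons, List.map_nil, List.prod_cons,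
      List.prod_nil, Sum.elim_inl, Sum.elim_inr, mul_one] at this
    rw [mul_assoc, this]
    ring

/-- The monotone product evaluates the letters of the second leg one by one, so here the outer
letters come from the second leg and the inner one from the first. -/
theorem IsMonotoneProduct.splitsInner (hφ : φ 1 = 1) (hψ : ψ 1 = 1)
    (h : IsMonotoneProduct εA εB φ ψ Φ) :
    SplitsInner (Coprod.inr A B) (Coprod.inl A B) εA ψ φ Φ := by
  refine splitsInner_of_ker (εA := εB) hψ ?_ ?_ ?_ ?_ ?_ ?_
  · simpa [wordProd_nil, lefts, rights, hφ] using
      h [] (by simp [Alternating]) (by simp [LettersInKer])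
  · intro b hb
    simpa [wordProd, lefts, rights, hφ] using
      h [.inr b] (by simp [Alternating]) (by simp [LettersInKer, hb])
  · intro a ha
    simpa [wordProd, lefts, rights] using
      h [.inl a] (by simp [Alternating]) (by simp [LettersInKer, ha])
  · intro b a hb ha
    simpa [wordProd, lefts, rights, mul_comm (φ a)] using
      h [.inr b, .inl a] (by simp [Alternating]) (by simp [LettersInKer, ha, hb])
  · intro b a hb ha
    simpa [wordProd, lefts, rights] using
      h [.inl a, .inr b] (by simp [Alternating]) (by simp [LettersInKer, ha, hb])
  · intro b a b' hb ha hb'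
    have := h [.inr b, .inl a, .inr b'] (by simp [Alternating])
      (by simp [LettersInKer, ha, hb, hb'])
    simp only [wordProd, lefts, rights, List.map_cons, List.map_nil, List.prod_cons,
      List.prod_nil, Sum.elim_inl, Sum.elim_inr, mul_one] at this
    rw [mul_assoc, this]
    ring

end Legs

/-! ### Second moments of the convolutions and non-existence of Haar traces -/

theorem Δ_star_u (i j : Fin n) : UAlg.Δ n (star (UAlg.u i j)) =
    ∑ k, Coprod.inr _ _ (star (UAlg.u k j)) * Coprod.inl _ _ (star (UAlg.u i k)) := by
  rw [map_star, UAlg.Δ_u, star_sum]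
  simp only [star_mul, map_star]

/-- In the expansion of Δ(uᵢⱼ)Δ(uₖₗ)* the letters of the second leg are adjacent and form a single
inner letter. Its counit is δ_{pj} δ_{ql}, which selects one summand. -/
theorem left_second_moment {φ ψ : UAlg n →ₗ[ℂ] ℂ} {Φ : Coprod (UAlg n) (UAlg n) →ₗ[ℂ] ℂ}
    (h : SplitsInner (Coprod.inl _ _) (Coprod.inr _ _) (UAlg.δ n) φ ψ Φ)
    (hφ : ∀ i j, φ (UAlg.u i j) = 0) (i j k l : Fin n) :
    Φ (UAlg.Δ n (UAlg.u i j * star (UAlg.u k l))) = φ (UAlg.u i j * star (UAlg.u k l)) := by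
  have h1 : ∀ p q, Φ (Coprod.inl _ _ (UAlg.u i p) * Coprod.inr _ _ (UAlg.u p j) *
      (Coprod.inr _ _ (star (UAlg.u q l)) * Coprod.inl _ _ (star (UAlg.u k q)))) =
      (if p = j then 1 else 0) * (if q = l then 1 else 0) *
        φ (UAlg.u i p * star (UAlg.u k q)) := by
    intro p q
    have := h.apply_of_eq_zero (hφ i p) (UAlg.u p j * star (UAlg.u q l)) (star (UAlg.u k q))
    rw [map_mul (Coprod.inr _ _), ← mul_assoc] at this
    rw [← mul_assoc, this]
    rw [map_mul, map_star, UAlg.δ_u, UAlg.δ_u]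
    split_ifs <;> simp
  rw [map_mul, UAlg.Δ_u, Δ_star_u, Finset.sum_mul_sum, map_sum]
  simp only [map_sum, h1]
  simp

/-- With the adjoint in front, the letters of the first leg are the adjacent ones, and the counit
acts on them. -/
theorem right_second_moment {φ ψ : UAlg n →ₗ[ℂ] ℂ} {Φ : Coprod (UAlg n) (UAlg n) →ₗ[ℂ] ℂ}
    (h : SplitsInner (Coprod.inr _ _) (Coprod.inl _ _) (UAlg.δ n) φ ψ Φ)
    (hφ : ∀ i j, φ (star (UAlg.u i j)) = 0) (i j k l : Fin n) :
    Φ (UAlg.Δ n (star (UAlg.u i j) * UAlg.u k l)) = φ (star (UAlg.u i j) * UAlg.u k l) := by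
  have h1 : ∀ p q, Φ (Coprod.inr _ _ (star (UAlg.u p j)) * Coprod.inl _ _ (star (UAlg.u i p)) *
      (Coprod.inl _ _ (UAlg.u k q) * Coprod.inr _ _ (UAlg.u q l))) =
      (if i = p then 1 else 0) * (if k = q then 1 else 0) *
        φ (star (UAlg.u p j) * UAlg.u q l) := by
    intro p q
    have := h.apply_of_eq_zero (hφ p j) (star (UAlg.u i p) * UAlg.u k q) (UAlg.u q l)
    rw [map_mul (Coprod.inl _ _), ← mul_assoc] at this
    rw [← mul_assoc, this]
    rw [map_mul, map_star, UAlg.δ_u, UAlg.δ_u]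
    split_ifs <;> simp
  rw [map_mul, UAlg.Δ_u, Δ_star_u, Finset.sum_mul_sum, map_sum]
  simp only [map_sum, h1]
  simp

theorem not_exists_isHaarTrace_of_left (hn : 2 ≤ n)
    {conv : State (UAlg n) → State (UAlg n) → (UAlg n →ₗ[ℂ] ℂ)}
    (hc : ∀ φ ψ : State (UAlg n), ∃ Φ : Coprod (UAlg n) (UAlg n) →ₗ[ℂ] ℂ,
      (∀ a, conv φ ψ a = Φ (UAlg.Δ n a)) ∧
      SplitsInner (Coprod.inl _ _) (Coprod.inr _ _) (UAlg.δ n) φ.toLin ψ.toLin Φ) :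
    ¬ ∃ h : State (UAlg n), IsHaarTrace conv h := by
  rintro ⟨h, -, hh⟩
  refine signAvg_ne hn (fun i j k l => h (UAlg.u i j * star (UAlg.u k l))) fun V i j k l => ?_
  obtain ⟨Φ, hΦ, hs⟩ := hc (signAvg V) h
  rw [← (hh (signAvg V) (charAvg_isTracial _ _)).1, hΦ,
    left_second_moment hs (signAvg_u V), signAvg_u_star_u]

theorem not_exists_isHaarTrace_of_right (hn : 2 ≤ n)
    {conv : State (UAlg n) → State (UAlg n) → (UAlg n →ₗ[ℂ] ℂ)}
    (hc : ∀ φ ψ : State (UAlg n), ∃ Φ : Coprod (UAlg n) (UAlg n) →ₗ[ℂ] ℂ,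
      (∀ a, conv φ ψ a = Φ (UAlg.Δ n a)) ∧
      SplitsInner (Coprod.inr _ _) (Coprod.inl _ _) (UAlg.δ n) ψ.toLin φ.toLin Φ) :
    ¬ ∃ h : State (UAlg n), IsHaarTrace conv h := by
  rintro ⟨h, -, hh⟩
  refine signAvg_ne hn (fun i j k l => h (star (UAlg.u k l) * UAlg.u i j)) fun V i j k l => ?_
  obtain ⟨Φ, hΦ, hs⟩ := hc h (signAvg V)
  rw [← (hh (signAvg V) (charAvg_isTracial _ _)).2, hΦ,
    right_second_moment hs (signAvg_star_u V), signAvg_star_u_u, mul_comm]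

theorem not_exists_isHaarTrace_booleanConv (hn : 2 ≤ n) :
    ¬ ∃ h : State (UAlg n), IsHaarTrace booleanConv h :=
  not_exists_isHaarTrace_of_left hn fun φ ψ => ⟨_, fun _ => rfl,
    IsBooleanProduct.splitsInner φ.map_one (exists_isBooleanProduct (UAlg.δ n) (UAlg.δ n)
      φ.toLin ψ.toLin φ.map_one ψ.map_one).choose_spec⟩

theorem not_exists_isHaarTrace_antimonotoneConv (hn : 2 ≤ n) :
    ¬ ∃ h : State (UAlg n), IsHaarTrace antimonotoneConv h :=
  not_exists_isHaarTrace_of_left hn fun φ ψ => ⟨_, fun _ => rfl,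
    IsAntimonotoneProduct.splitsInner φ.map_one ψ.map_one (exists_isAntimonotoneProduct
      (UAlg.δ n) (UAlg.δ n) φ.toLin ψ.toLin φ.map_one).choose_spec⟩

theorem not_exists_isHaarTrace_monotoneConv (hn : 2 ≤ n) :
    ¬ ∃ h : State (UAlg n), IsHaarTrace monotoneConv h :=
  not_exists_isHaarTrace_of_right hn fun φ ψ => ⟨_, fun _ => rfl,
    IsMonotoneProduct.splitsInner φ.map_one ψ.map_one (exists_isMonotoneProduct
      (UAlg.δ n) (UAlg.δ n) φ.toLin ψ.toLin ψ.map_one).choose_spec⟩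

end NoHaar

/-! ### Reduced words in a matrix and in scalar matrices -/

section Words

variable {ι : Type*} [Fintype ι] [DecidableEq ι]
variable {C E : Type*} [Ring C] [Algebra ℂ C] [Ring E] [Algebra ℂ E]

/-- Scalar matrices inside the matrices over `C`. -/
def scal (ι : Type*) [Fintype ι] [DecidableEq ι] (C : Type*) [Ring C] [Algebra ℂ C] :
    Matrix ι ι ℂ →ₐ[ℂ] Matrix ι ι C :=
  (Algebra.ofId ℂ C).mapMatrix

theorem scal_apply (d : Matrix ι ι ℂ) (i j : ι) : scal ι C d i j = algebraMap ℂ C (d i j) := rfl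

theorem mapMatrix_scal (g : C →ₐ[ℂ] E) (d : Matrix ι ι ℂ) :
    g.mapMatrix (scal ι C d) = scal ι E d := by
  ext i j
  simp [scal_apply]

/-- The product `V^{s₁} b₁ V^{s₂} b₂ ⋯ V^{sₘ} bₘ`, where `V^{true}` and `V^{false}` are two given
matrices. -/
def evalW (V : Bool → Matrix ι ι E) : List (Bool × Matrix ι ι E) → Matrix ι ι E
  | [] => 1
  | x :: w => V x.1 * x.2 * evalW V w

theorem evalW_append (V : Bool → Matrix ι ι E) (v w : List (Bool × Matrix ι ι E)) :
    evalW V (v ++ w) = evalW V v * evalW V w := by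
  induction v with
  | nil => simp [evalW]
  | cons x v ih => simp [evalW, ih, mul_assoc]

/-- The word `V^{s₁} d₁ ⋯ V^{sₘ} dₘ` with scalar matrices `dᵢ`. -/
def evalS (V : Bool → Matrix ι ι E) (w : List (Bool × Matrix ι ι ℂ)) : Matrix ι ι E :=
  evalW V (w.map (Prod.map id (scal ι E)))

theorem evalS_nil (V : Bool → Matrix ι ι E) : evalS V [] = 1 := rfl

theorem evalS_cons (V : Bool → Matrix ι ι E) (x : Bool × Matrix ι ι ℂ)
    (w : List (Bool × Matrix ι ι ℂ)) :
    evalS V (x :: w) = V x.1 * scal ι E x.2 * evalS V w := rfl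

theorem evalS_append (V : Bool → Matrix ι ι E) (v w : List (Bool × Matrix ι ι ℂ)) :
    evalS V (v ++ w) = evalS V v * evalS V w := by
  simp [evalS, evalW_append]

theorem mapMatrix_evalS (g : C →ₐ[ℂ] E) (V : Bool → Matrix ι ι C)
    (w : List (Bool × Matrix ι ι ℂ)) :
    g.mapMatrix (evalS V w) = evalS (fun s => g.mapMatrix (V s)) w := by
  induction w with
  | nil => simp [evalS_nil]
  | cons x w ih => rw [evalS_cons, evalS_cons, map_mul, map_mul, ih, mapMatrix_scal]

/-- At every change of exponent the matrix in between is annihilated by `τ`. -/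
def ReducedFor {M : Type*} (τ : M → ℂ) (w : List (Bool × M)) : Prop :=
  w.IsChain (fun x y => x.1 ≠ y.1 → τ x.2 = 0)

/-- At every change of exponent the scalar matrix in between is traceless. -/
abbrev Reduced (w : List (Bool × Matrix ι ι ℂ)) : Prop := ReducedFor Matrix.trace w

/-- All entries of nonempty reduced words in `V` and the scalar matrices are centred. For a unitary
`V` this says that `V` is a Haar unitary that is free from the scalar matrices. -/
def IsFreeHaar (V : Bool → Matrix ι ι C) (L : C →ₗ[ℂ] ℂ) : Prop :=
  ∀ w : List (Bool × Matrix ι ι ℂ), w ≠ [] → Reduced w → ∀ i j, L (evalS V w i j) = 0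

theorem isFreeHaar_comp {g : C →ₐ[ℂ] E} {V : Bool → Matrix ι ι C} {L : E →ₗ[ℂ] ℂ}
    (h : IsFreeHaar (fun s => g.mapMatrix (V s)) L) : IsFreeHaar V (L ∘ₗ g.toLinearMap) := by
  intro w hw hr i j
  have := h w hw hr i j
  rw [← mapMatrix_evalS] at this
  exact this

/-- Reducedness puts no condition on the last matrix of a word, so a factor on the right is absorbed
there. The compression uses this for the matrix unit that closes the corner. -/
theorem exists_evalW_mul_right {τ : Matrix ι ι C → ℂ} (g : C →ₐ[ℂ] E)
    (V : Bool → Matrix ι ι E) (b : Matrix ι ι C) (x : Bool × Matrix ι ι C)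
    (w : List (Bool × Matrix ι ι C)) (hw : ReducedFor τ (x :: w)) :
    ∃ y v, y.1 = x.1 ∧ ReducedFor τ (y :: v) ∧
      evalW V ((x :: w).map (Prod.map id g.mapMatrix)) * g.mapMatrix b =
        evalW V ((y :: v).map (Prod.map id g.mapMatrix)) := by
  induction w generalizing x with
  | nil => exact ⟨(x.1, x.2 * b), [], rfl, by simp [ReducedFor], by simp [evalW, mul_assoc]⟩
  | cons z w ih =>
    obtain ⟨y, v, h1, h2, h3⟩ := ih z hw.tail
    refine ⟨x, y :: v, rfl, ?_, ?_⟩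
    · refine List.isChain_cons_cons.2 ⟨?_, h2⟩
      rw [h1]
      exact (List.isChain_cons_cons.1 hw).1
    · rw [List.map_cons, evalW, mul_assoc, h3]
      rfl

end Words

/-! ### Alternating products of centred elements -/

section Free

variable {B C E : Type*} [Ring B] [Algebra ℂ B] [Ring C] [Algebra ℂ C] [Ring E] [Algebra ℂ E]

/-- Alternating products of centred elements of `B` and `C`; the index tells whether the first
factor comes from `B`. -/
inductive AltProd (f : B →ₐ[ℂ] E) (g : C →ₐ[ℂ] E) (φ : B →ₗ[ℂ] ℂ) (ψ : C →ₗ[ℂ] ℂ) :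
    Bool → E → Prop
  | left (b : B) : φ b = 0 → AltProd f g φ ψ true (f b)
  | right (c : C) : ψ c = 0 → AltProd f g φ ψ false (g c)
  | left_mul (b : B) (x : E) : φ b = 0 → AltProd f g φ ψ false x → AltProd f g φ ψ true (f b * x)
  | right_mul (c : C) (x : E) : ψ c = 0 → AltProd f g φ ψ true x →
      AltProd f g φ ψ false (g c * x)

/-- `Φ` makes the images of `B` and `C` free. -/
def IsFreeIn (f : B →ₐ[ℂ] E) (g : C →ₐ[ℂ] E) (φ : B →ₗ[ℂ] ℂ) (ψ : C →ₗ[ℂ] ℂ)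
    (Φ : E →ₗ[ℂ] ℂ) : Prop :=
  ∀ s x, AltProd f g φ ψ s x → Φ x = 0

variable {f : B →ₐ[ℂ] E} {g : C →ₐ[ℂ] E} {φ : B →ₗ[ℂ] ℂ} {ψ : C →ₗ[ℂ] ℂ} {Φ : E →ₗ[ℂ] ℂ}

theorem AltProd.swap {s : Bool} {x : E} (h : AltProd f g φ ψ s x) : AltProd g f ψ φ (!s) x := by
  induction h with
  | left b hb => exact .right b hb
  | right c hc => exact .left c hc
  | left_mul b x hb _ ih => exact .right_mul b x hb ih
  | right_mul c x hc _ ih => exact .left_mul c x hc ih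

theorem IsFreeIn.swap (h : IsFreeIn f g φ ψ Φ) : IsFreeIn g f ψ φ Φ :=
  fun _ _ hx => h _ _ hx.swap

theorem IsFreeProduct.isFreeIn {A B : Type*} [Ring A] [StarRing A] [Algebra ℂ A] [StarModule ℂ A]
    [Ring B] [StarRing B] [Algebra ℂ B] [StarModule ℂ B] {φ : A →ₗ[ℂ] ℂ} {ψ : B →ₗ[ℂ] ℂ}
    {Φ : Coprod A B →ₗ[ℂ] ℂ} (h : IsFreeProduct φ ψ Φ) :
    IsFreeIn (Coprod.inl A B).toAlgHom (Coprod.inr A B).toAlgHom φ ψ Φ := by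
  have key : ∀ s x, AltProd (Coprod.inl A B).toAlgHom (Coprod.inr A B).toAlgHom φ ψ s x →
      ∃ (y : A ⊕ B) (w : List (A ⊕ B)), y.isLeft = s ∧ Alternating (y :: w) ∧
        LettersInKer φ ψ (y :: w) ∧ wordProd (y :: w) = x := by
    intro s x hx
    induction hx with
    | left b hb =>
      exact ⟨.inl b, [], rfl, by simp [Alternating], by simp [LettersInKer, hb], by simp [wordProd]⟩
    | right c hc =>
      exact ⟨.inr c, [], rfl, by simp [Alternating], by simp [LettersInKer, hc], by simp [wordProd]⟩
    | left_mul b x hb _ ih =>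
      obtain ⟨y, w, h1, h2, h3, rfl⟩ := ih
      refine ⟨.inl b, y :: w, rfl, List.isChain_cons_cons.2 ⟨by simp [h1], h2⟩, ?_,
        wordProd_cons_inl b (y :: w)⟩
      intro z hz
      rcases List.mem_cons.1 hz with rfl | hz
      · exact hb
      · exact h3 z hz
    | right_mul c x hc _ ih =>
      obtain ⟨y, w, h1, h2, h3, rfl⟩ := ih
      refine ⟨.inr c, y :: w, rfl, List.isChain_cons_cons.2 ⟨by simp [h1], h2⟩, ?_,
        wordProd_cons_inr c (y :: w)⟩
      intro z hz
      rcases List.mem_cons.1 hz with rfl | hz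
      · exact hc
      · exact h3 z hz
  intro s x hx
  obtain ⟨y, w, -, h2, h3, rfl⟩ := key s x hx
  exact h.2 _ (List.cons_ne_nil _ _) h2 h3

variable (f g φ ψ) in
/-- The span of the alternating products of centred elements with a given kind of first factor. -/
def altSpan (s : Bool) : Submodule ℂ E := Submodule.span ℂ {x | AltProd f g φ ψ s x}

theorem IsFreeIn.apply_altSpan (h : IsFreeIn f g φ ψ Φ) {s : Bool} {x : E}
    (hx : x ∈ altSpan f g φ ψ s) : Φ x = 0 := by
  have : altSpan f g φ ψ s ≤ LinearMap.ker Φ := Submodule.span_le.2 fun x hx => h s x hx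
  exact this hx

theorem left_mul_mem_altSpan {b : B} (hb : φ b = 0) {x : E} (hx : x ∈ altSpan f g φ ψ false) :
    f b * x ∈ altSpan f g φ ψ true := by
  have : altSpan f g φ ψ false ≤ (altSpan f g φ ψ true).comap (LinearMap.mulLeft ℂ (f b)) :=
    Submodule.span_le.2 fun x hx => Submodule.subset_span (.left_mul b x hb hx)
  exact this hx

theorem right_mul_mem_altSpan {c : C} (hc : ψ c = 0) {x : E} (hx : x ∈ altSpan f g φ ψ true) :
    g c * x ∈ altSpan f g φ ψ false := by
  have : altSpan f g φ ψ true ≤ (altSpan f g φ ψ false).comap (LinearMap.mulLeft ℂ (g c)) :=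
    Submodule.span_le.2 fun x hx => Submodule.subset_span (.right_mul c x hc hx)
  exact this hx

variable {ι : Type*} [Fintype ι] [DecidableEq ι] {V : Bool → Matrix ι ι C}

variable (f g φ ψ V) in
/-- The span of the products of a nonempty reduced word in `V`, with first exponent `s`, and a
matrix which is either the unit or has entries in the span of alternating products that start in
`B`. -/
def headSpan (s : Bool) : Submodule ℂ (Matrix ι ι E) :=
  Submodule.span ℂ {x | ∃ (y : Bool × Matrix ι ι ℂ) (w : List (Bool × Matrix ι ι ℂ))
    (Y : Matrix ι ι E), y.1 = s ∧ Reduced (y :: w) ∧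
    (Y = 1 ∨ ∀ i j, Y i j ∈ altSpan f g φ ψ true) ∧ x = g.mapMatrix (evalS V (y :: w)) * Y}

/-- The entries of a nonempty reduced word in V are centred elements of C. Each summand of an entry
of the product with Y is therefore one letter of C, alone or in front of an alternating product that
starts in B. -/
theorem apply_mem_of_mem_headSpan (hV : IsFreeHaar V ψ) {s : Bool} {x : Matrix ι ι E}
    (hx : x ∈ headSpan f g φ ψ V s) (i j : ι) : x i j ∈ altSpan f g φ ψ false := by
  have : headSpan f g φ ψ V s ≤
      (altSpan f g φ ψ false).comap (Matrix.entryLinearMap ℂ E i j) := by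
    refine Submodule.span_le.2 ?_
    rintro _ ⟨y, w, Y, -, hw, hY, rfl⟩
    have h0 := hV (y :: w) (List.cons_ne_nil _ _) hw
    rcases hY with rfl | hY
    · rw [mul_one]
      exact Submodule.subset_span (.right _ (h0 i j))
    · change (g.mapMatrix (evalS V (y :: w)) * Y) i j ∈ altSpan f g φ ψ false
      rw [Matrix.mul_apply]
      exact Submodule.sum_mem _ fun k _ => right_mul_mem_altSpan (h0 i k) (hY k j)
  exact this hx

/-- A matrix over `B` is the sum of a scalar matrix and a matrix with centred entries. -/
theorem exists_scal_add_centred (hφ : φ 1 = 1) (b : Matrix ι ι B) :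
    ∃ b₀ : Matrix ι ι B, (∀ i j, φ (b₀ i j) = 0) ∧ b = scal ι B (b.map φ) + b₀ := by
  refine ⟨b - scal ι B (b.map φ), fun i j => ?_, by simp⟩
  simp [scal_apply, Algebra.algebraMap_eq_smul_one, hφ]

theorem centred_mul_apply_mem (hV : IsFreeHaar V ψ) {b : Matrix ι ι B} (hb : ∀ i j, φ (b i j) = 0)
    {s : Bool} {x : Matrix ι ι E} (hx : x ∈ headSpan f g φ ψ V s) (i j : ι) :
    (f.mapMatrix b * x) i j ∈ altSpan f g φ ψ true := by
  rw [Matrix.mul_apply]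
  exact Submodule.sum_mem _ fun k _ =>
    left_mul_mem_altSpan (hb i k) (apply_mem_of_mem_headSpan hV hx k j)

/-- Each matrix over B is a scalar matrix plus a matrix with centred entries. The scalar part
lengthens the reduced word at the head of what follows; at a change of exponent it is traceless, its
trace being φ of the trace. The centred part ends the reduced word after one letter and begins a
letter of B in front of what follows. -/
theorem evalW_mem_headSpan (hφ : φ 1 = 1) (hV : IsFreeHaar V ψ) (x : Bool × Matrix ι ι B)
    (w : List (Bool × Matrix ι ι B)) (hw : ReducedFor (fun b => φ b.trace) (x :: w)) :
    evalW (fun s => g.mapMatrix (V s)) ((x :: w).map (Prod.map id f.mapMatrix)) ∈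
      headSpan f g φ ψ V x.1 := by
  have hone : ∀ s, g.mapMatrix (V s) = g.mapMatrix (evalS V [(s, 1)]) := fun s => by
    simp [evalS_cons, evalS_nil]
  induction w generalizing x with
  | nil =>
    obtain ⟨b₀, h0, hb⟩ := exists_scal_add_centred hφ x.2
    simp only [List.map_cons, List.map_nil, evalW, mul_one, Prod.map, id]
    rw [hb, map_add, mul_add]
    refine Submodule.add_mem _ (Submodule.subset_span ?_) (Submodule.subset_span ?_)
    · refine ⟨(x.1, x.2.map φ), [], 1, rfl, by simp [ReducedFor], Or.inl rfl, ?_⟩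
      simp [evalS_cons, evalS_nil, mapMatrix_scal, -AlgHom.mapMatrix_apply]
    · refine ⟨(x.1, 1), [], f.mapMatrix b₀, rfl, by simp [ReducedFor], Or.inr fun i j => ?_, ?_⟩
      · exact Submodule.subset_span (.left _ (h0 i j))
      · rw [hone]
  | cons y w ih =>
    have ih := ih y hw.tail
    have hxy := (List.isChain_cons_cons.1 hw).1
    obtain ⟨b₀, h0, hb⟩ := exists_scal_add_centred hφ x.2
    have htr : (x.2.map φ).trace = φ x.2.trace := by simp [Matrix.trace]
    rw [List.map_cons, evalW]
    simp only [Prod.map, id]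
    rw [hb, map_add, mul_add, add_mul]
    refine Submodule.add_mem _ ?_ (Submodule.subset_span ?_)
    · have : headSpan f g φ ψ V y.1 ≤ (headSpan f g φ ψ V x.1).comap (LinearMap.mulLeft ℂ
          (g.mapMatrix (V x.1) * f.mapMatrix (scal ι B (x.2.map φ)))) := by
        refine Submodule.span_le.2 ?_
        rintro _ ⟨z, v, Y, hz, hv, hY, rfl⟩
        refine Submodule.subset_span ⟨(x.1, x.2.map φ), z :: v, Y, rfl,
          List.isChain_cons_cons.2 ⟨?_, hv⟩, hY, ?_⟩
        · rw [hz]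
          exact fun hne => htr.trans (hxy hne)
        · rw [LinearMap.mulLeft_apply, evalS_cons V (x.1, _), map_mul, map_mul, mapMatrix_scal,
            mapMatrix_scal, ← mul_assoc]
      exact this ih
    · refine ⟨(x.1, 1), [], _, rfl, by simp [ReducedFor],
        Or.inr (centred_mul_apply_mem hV h0 ih), ?_⟩
      rw [← hone, mul_assoc]

/-- If `V` over `C` is a Haar unitary free from the scalar matrices, then it stays so with respect
to all matrices over an algebra `B` that is free from `C`. -/
theorem IsFreeIn.apply_mul_evalW (h : IsFreeIn f g φ ψ Φ) (hφ : φ 1 = 1) (hV : IsFreeHaar V ψ)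
    (b : Matrix ι ι B) {w : List (Bool × Matrix ι ι B)} (hne : w ≠ [])
    (hw : ReducedFor (fun b => φ b.trace) w) (i j : ι) :
    Φ ((f.mapMatrix b *
      evalW (fun s => g.mapMatrix (V s)) (w.map (Prod.map id f.mapMatrix))) i j) = 0 := by
  obtain ⟨x, w, rfl⟩ := List.exists_cons_of_ne_nil hne
  have hm := evalW_mem_headSpan (f := f) (g := g) hφ hV x w hw
  obtain ⟨b₀, h0, hb⟩ := exists_scal_add_centred hφ b
  rw [hb, map_add, add_mul, Matrix.add_apply, map_add,
    h.apply_altSpan (centred_mul_apply_mem hV h0 hm i j), mapMatrix_scal, Matrix.mul_apply,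
    map_sum, add_zero]
  refine Finset.sum_eq_zero fun k _ => ?_
  rw [scal_apply, ← Algebra.smul_def, map_smul,
    h.apply_altSpan (apply_mem_of_mem_headSpan hV hm k j), smul_zero]

/-- Multiplying a free Haar unitary by matrices over a free algebra gives a free Haar unitary. -/
theorem IsFreeIn.isFreeHaar_mul (h : IsFreeIn f g φ ψ Φ) (hφ : φ 1 = 1) (hV : IsFreeHaar V ψ)
    (pre post : Bool → Matrix ι ι B)
    (hpp : ∀ s d, Matrix.trace d = 0 → φ (post s * scal ι B d * pre (!s)).trace = 0) :
    IsFreeHaar (fun s => f.mapMatrix (pre s) * g.mapMatrix (V s) * f.mapMatrix (post s)) Φ := by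
  intro w hne hw i j
  obtain ⟨x, w, rfl⟩ := List.exists_cons_of_ne_nil hne
  -- Regroup so that `post` of a letter, its scalar matrix and `pre` of the next letter form one
  -- matrix over B. Then `hpp` is the reducedness condition at a change of exponent, and the first
  -- `pre` remains as a leading factor.
  have key : ∃ y v, y.1 = x.1 ∧ ReducedFor (fun b => φ b.trace) (y :: v) ∧
      evalS (fun s => f.mapMatrix (pre s) * g.mapMatrix (V s) * f.mapMatrix (post s)) (x :: w) =
      f.mapMatrix (pre x.1) * evalW (fun s => g.mapMatrix (V s))
        ((y :: v).map (Prod.map id f.mapMatrix)) := by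
    clear hne
    induction w generalizing x with
    | nil =>
      refine ⟨(x.1, post x.1 * scal ι B x.2), [], rfl, by simp [ReducedFor], ?_⟩
      simp [evalS_cons, evalS_nil, evalW, mapMatrix_scal, mul_assoc, -AlgHom.mapMatrix_apply]
    | cons z w ih =>
      obtain ⟨y, v, h1, h2, h3⟩ := ih z hw.tail
      refine ⟨(x.1, post x.1 * scal ι B x.2 * pre z.1), y :: v, rfl,
        List.isChain_cons_cons.2 ⟨fun hs => ?_, h2⟩, ?_⟩
      · rw [h1] at hs
        have hz : z.1 = !x.1 := by simpa [Bool.eq_not] using fun h => hs h.symm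
        have := (List.isChain_cons_cons.1 hw).1 (by simp [hz])
        rw [hz]
        exact hpp _ _ this
      · rw [evalS_cons, h3]
        simp [evalW, mapMatrix_scal, mul_assoc, -AlgHom.mapMatrix_apply]
  obtain ⟨y, v, -, h2, h3⟩ := key
  rw [h3]
  exact h.apply_mul_evalW hφ hV _ (List.cons_ne_nil _ _) h2 i j

end Free

/-! ### Functionals on the Brown algebra that vanish on reduced words -/

theorem UAlg.induct {n : ℕ} {p : UAlg n → Prop} (hs : ∀ c : ℂ, p (algebraMap ℂ _ c))
    (hu : ∀ i j, p (UAlg.u i j)) (hu' : ∀ i j, p (star (UAlg.u i j)))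
    (hm : ∀ a b, p a → p b → p (a * b)) (ha : ∀ a b, p a → p b → p (a + b)) (a : UAlg n) : p a := by
  obtain ⟨a, rfl⟩ := Pres.mk_surjective _ a
  induction a using FreeStar.induct with
  | hs c => rw [AlgHom.commutes]; exact hs c
  | hg x =>
    cases x with
    | u i j => exact hu i j
    | uStar i j =>
      have := hu' i j
      rwa [UAlg.u, Pres.star_mk, FreeStar.star_gen] at this
  | hm a b h1 h2 => rw [map_mul]; exact hm _ _ h1 h2
  | ha a b h1 h2 => rw [map_add]; exact ha _ _ h1 h2

/-! ### Scalar matrices and the functional Tr ⊗ L -/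

section Matrices

variable {n : ℕ} {C : Type*} [Ring C] [Algebra ℂ C]

theorem scal_single (i j : Fin n) : scal (Fin n) C (Matrix.single i j 1) = Matrix.single i j 1 := by
  ext k l
  rw [scal_apply, Matrix.single_apply, Matrix.single_apply]
  split_ifs <;> simp

/-- Entries are recovered by multiplying with scalar matrix units, so U, its adjoint and the scalar
matrices generate all multiples of the unit by elements of the Brown algebra. -/
theorem scalar_apply_eq_sum (M : Matrix (Fin n) (Fin n) C) (i j : Fin n) :
    Matrix.scalar (Fin n) (M i j) = ∑ k, scal (Fin n) C (Matrix.single k i 1) * M *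
      scal (Fin n) C (Matrix.single j k 1) := by
  simp only [scal_single, Matrix.single_mul_mul_single, one_mul, mul_one]
  ext k l
  rw [Matrix.sum_apply]
  by_cases h : k = l
  · subst h
    simp [Matrix.single_apply]
  · rw [Finset.sum_eq_zero]
    · simp [h]
    · intro m _
      rw [Matrix.single_apply, if_neg]
      rintro ⟨rfl, rfl⟩
      exact h rfl

/-- The functional `Tr ⊗ L`. -/
def trL (L : C →ₗ[ℂ] ℂ) : Matrix (Fin n) (Fin n) C →ₗ[ℂ] ℂ := L ∘ₗ Matrix.traceLinearMap (Fin n) ℂ C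

theorem trL_apply (L : C →ₗ[ℂ] ℂ) (X : Matrix (Fin n) (Fin n) C) : trL L X = L X.trace := rfl

theorem trL_scalar (L : C →ₗ[ℂ] ℂ) (a : C) : trL L (Matrix.scalar (Fin n) a) = n * L a := by
  simp [trL_apply, ← nsmul_eq_mul]

theorem trL_scal (L : C →ₗ[ℂ] ℂ) (hL : L 1 = 1) (d : Matrix (Fin n) (Fin n) ℂ) :
    trL L (scal (Fin n) C d) = d.trace := by
  simp [trL_apply, Matrix.trace, scal_apply, Algebra.algebraMap_eq_smul_one, hL]

/-- The entries of d are central, so no traciality of L is involved. -/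
theorem trL_scal_mul_comm (L : C →ₗ[ℂ] ℂ) (d : Matrix (Fin n) (Fin n) ℂ)
    (X : Matrix (Fin n) (Fin n) C) :
    trL L (scal (Fin n) C d * X) = trL L (X * scal (Fin n) C d) := by
  simp only [trL_apply, Matrix.trace, Matrix.diag_apply, Matrix.mul_apply, scal_apply]
  rw [Finset.sum_comm]
  simp only [Algebra.commutes]

theorem IsTracial_trL {L : C →ₗ[ℂ] ℂ} (h : ∀ a b, L (a * b) = L (b * a))
    (X Y : Matrix (Fin n) (Fin n) C) : trL L (X * Y) = trL L (Y * X) := by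
  simp only [trL_apply, Matrix.trace, Matrix.diag_apply, Matrix.mul_apply, map_sum]
  rw [Finset.sum_comm]
  simp only [h]

theorem star_scal [StarRing C] [StarModule ℂ C] (d : Matrix (Fin n) (Fin n) ℂ) :
    star (scal (Fin n) C d) = scal (Fin n) C (star d) := by
  ext i j
  rw [Matrix.star_apply, scal_apply, scal_apply, Matrix.star_apply, algebraMap_star_comm]

/-- A square matrix is the sum of a multiple of the unit and a traceless matrix. -/
theorem exists_traceless (hn : 1 ≤ n) (d : Matrix (Fin n) (Fin n) ℂ) :
    ∃ d₀ : Matrix (Fin n) (Fin n) ℂ, d₀.trace = 0 ∧ d = d₀ + (d.trace / n) • 1 := by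
  have : (n : ℂ) ≠ 0 := by exact_mod_cast (by omega : n ≠ 0)
  refine ⟨d - (d.trace / n) • 1, ?_, by simp⟩
  simp [this]

end Matrices

/-! ### Reduced words span, and what this implies for functionals vanishing on them -/

section Spanning

variable {n : ℕ}

/-- The unitary matrix of generators and its adjoint. -/
def uPow (n : ℕ) (s : Bool) : Matrix (Fin n) (Fin n) (UAlg n) :=
  if s then (UAlg.uMat n).1 else star (UAlg.uMat n).1

theorem uPow_mul_uPow (s : Bool) : uPow n s * uPow n (!s) = 1 := by
  cases s
  · exact Unitary.star_mul_self_of_mem (UAlg.uMat n).2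
  · exact Unitary.mul_star_self_of_mem (UAlg.uMat n).2

theorem star_uPow (s : Bool) : star (uPow n s) = uPow n (!s) := by
  cases s <;> simp [uPow]

theorem uPow_true_apply (i j : Fin n) : uPow n true i j = UAlg.u i j := rfl

theorem uPow_false_apply (i j : Fin n) : uPow n false i j = star (UAlg.u j i) := rfl

/-- A set of matrices that is closed under multiplication and addition and contains the scalar
matrices and the matrix of generators contains the multiples of the unit by elements of the
Brown algebra. -/
theorem scalar_mem_of_closed {p : Matrix (Fin n) (Fin n) (UAlg n) → Prop}
    (hd : ∀ d, p (scal (Fin n) _ d)) (hu : ∀ s, p (uPow n s))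
    (hm : ∀ X Y, p X → p Y → p (X * Y)) (ha : ∀ X Y, p X → p Y → p (X + Y)) (a : UAlg n) :
    p (Matrix.scalar (Fin n) a) := by
  have hsum : ∀ M, p M → ∀ i j, p (Matrix.scalar (Fin n) (M i j)) := by
    intro M hM i j
    rw [scalar_apply_eq_sum]
    refine Finset.sum_induction _ p ha ?_ fun k _ => hm _ _ (hm _ _ (hd _) hM) (hd _)
    have := hd 0
    rwa [map_zero] at this
  induction a using UAlg.induct with
  | hs c =>
    have := hd (Matrix.scalar (Fin n) c)
    convert this using 1
    ext i j
    by_cases h : i = j <;> simp [scal_apply, h]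
  | hu i j => exact hsum _ (hu true) i j
  | hu' i j => exact hsum _ (hu false) j i
  | hm a b h1 h2 => rw [map_mul]; exact hm _ _ h1 h2
  | ha a b h1 h2 => rw [map_add]; exact ha _ _ h1 h2

/-- The span of the products of a scalar matrix and a reduced word. -/
def redSpan (n : ℕ) : Submodule ℂ (Matrix (Fin n) (Fin n) (UAlg n)) :=
  Submodule.span ℂ {x | ∃ d w, Reduced w ∧ x = scal (Fin n) _ d * evalS (uPow n) w}

/-- The span contains 1 and is stable under left multiplication by scalar matrices and by U and U*.
Only a piece U^s d U^{-s} can spoil reducedness: the traceless part of d is admissible, and the rest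
is a multiple of the unit, which cancels the two powers and leaves a scalar matrix times a shorter
reduced word. -/
theorem redSpan_eq_top (hn : 1 ≤ n) : redSpan n = ⊤ := by
  have hd : ∀ d, ∀ x ∈ redSpan n, scal (Fin n) _ d * x ∈ redSpan n := by
    intro d
    have : redSpan n ≤ (redSpan n).comap (LinearMap.mulLeft ℂ (scal (Fin n) _ d)) := by
      refine Submodule.span_le.2 ?_
      rintro _ ⟨c, w, hw, rfl⟩
      refine Submodule.subset_span ⟨d * c, w, hw, ?_⟩
      rw [LinearMap.mulLeft_apply, map_mul, mul_assoc]
    exact fun x hx => this hx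
  have hred : ∀ w, Reduced w → evalS (uPow n) w ∈ redSpan n := fun w hw =>
    Submodule.subset_span ⟨1, w, hw, by rw [map_one, one_mul]⟩
  have hu : ∀ s, ∀ x ∈ redSpan n, uPow n s * x ∈ redSpan n := by
    intro s
    have : redSpan n ≤ (redSpan n).comap (LinearMap.mulLeft ℂ (uPow n s)) := by
      refine Submodule.span_le.2 ?_
      rintro _ ⟨d, w, hw, rfl⟩
      change uPow n s * (scal (Fin n) _ d * evalS (uPow n) w) ∈ redSpan n
      rw [← mul_assoc]
      cases w with
      | nil => exact hred [(s, d)] (by simp [ReducedFor])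
      | cons y w =>
        by_cases hs : s = y.1
        · exact hred ((s, d) :: y :: w) (List.isChain_cons_cons.2 ⟨fun h => (h hs).elim, hw⟩)
        · obtain ⟨d₀, h0, h1⟩ := exists_traceless hn d
          rw [h1, map_add, mul_add, add_mul]
          refine Submodule.add_mem _ (hred ((s, d₀) :: y :: w)
            (List.isChain_cons_cons.2 ⟨fun _ => h0, hw⟩)) ?_
          have hy : y.1 = !s := by simpa [Bool.eq_not] using fun h => hs h.symm
          rw [map_smul, map_one, mul_smul_comm, mul_one, smul_mul_assoc, evalS_cons, hy,
            ← mul_assoc, ← mul_assoc, uPow_mul_uPow, one_mul]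
          exact Submodule.smul_mem _ _ (Submodule.subset_span ⟨y.2, w, hw.tail, rfl⟩)
    exact fun x hx => this hx
  have hscalar : ∀ a : UAlg n, ∀ x ∈ redSpan n, Matrix.scalar (Fin n) a * x ∈ redSpan n := by
    intro a
    refine scalar_mem_of_closed (p := fun X => ∀ x ∈ redSpan n, X * x ∈ redSpan n) hd hu ?_ ?_ a
    · intro X Y hX hY x hx
      rw [mul_assoc]
      exact hX _ (hY _ hx)
    · intro X Y hX hY x hx
      rw [add_mul]
      exact Submodule.add_mem _ (hX _ hx) (hY _ hx)
  refine eq_top_iff.2 fun X _ => ?_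
  have h1 : (1 : Matrix (Fin n) (Fin n) (UAlg n)) ∈ redSpan n := hred [] (by simp [ReducedFor])
  have hX : X = ∑ i, ∑ j, Matrix.scalar (Fin n) (X i j) *
      (scal (Fin n) _ (Matrix.single i j 1) * 1) := by
    conv_lhs => rw [Matrix.matrix_eq_sum_single X]
    refine Finset.sum_congr rfl fun i _ => Finset.sum_congr rfl fun j _ => ?_
    rw [mul_one, scal_single]
    ext k l
    simp [Matrix.single_apply]
  rw [hX]
  exact Submodule.sum_mem _ fun i _ => Submodule.sum_mem _ fun j _ =>
    hscalar _ _ (hd _ _ h1)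

variable {L L' : UAlg n →ₗ[ℂ] ℂ}

theorem IsFreeHaar.trL_evalS (hL : IsFreeHaar (uPow n) L) (d : Matrix (Fin n) (Fin n) ℂ)
    {w : List (Bool × Matrix (Fin n) (Fin n) ℂ)} (hne : w ≠ []) (hw : Reduced w) :
    trL L (scal (Fin n) _ d * evalS (uPow n) w) = 0 := by
  simp only [trL_apply, Matrix.trace, Matrix.diag_apply, Matrix.mul_apply, scal_apply, map_sum,
    ← Algebra.smul_def, map_smul, hL w hne hw, smul_zero, Finset.sum_const_zero]

theorem IsFreeHaar.trL_evalS' (hL : IsFreeHaar (uPow n) L)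
    {w : List (Bool × Matrix (Fin n) (Fin n) ℂ)} (hne : w ≠ []) (hw : Reduced w) :
    trL L (evalS (uPow n) w) = 0 := by
  simpa using hL.trL_evalS 1 hne hw

/-- A functional that vanishes on reduced words is determined by its value at the unit. -/
theorem IsFreeHaar.unique (hn : 1 ≤ n) (hL : IsFreeHaar (uPow n) L)
    (hL' : IsFreeHaar (uPow n) L') (h1 : L 1 = 1) (h1' : L' 1 = 1) : L = L' := by
  have h : redSpan n ≤ LinearMap.eqLocus (trL L) (trL L') := by
    refine Submodule.span_le.2 ?_
    rintro _ ⟨d, w, hw, rfl⟩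
    change trL L _ = trL L' _
    by_cases hne : w = []
    · subst hne
      rw [evalS_nil, mul_one, trL_scal L h1, trL_scal L' h1']
    · rw [hL.trL_evalS d hne hw, hL'.trL_evalS d hne hw]
  rw [redSpan_eq_top hn] at h
  ext a
  have := h (Submodule.mem_top (x := Matrix.scalar (Fin n) a))
  change trL L _ = trL L' _ at this
  rw [trL_scalar, trL_scalar] at this
  exact mul_left_cancel₀ (by exact_mod_cast (by omega : n ≠ 0)) this

/-- The trace of `U^s d w`, which equals that of `d w U^s`. -/
def cycVal (s : Bool) (d : Matrix (Fin n) (Fin n) ℂ) :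
    List (Bool × Matrix (Fin n) (Fin n) ℂ) → ℂ
  | [y] => if s = y.1 then 0 else d.trace / n * y.2.trace
  | _ => 0

/-- If w starts with the opposite exponent, split d. The traceless part gives a reduced word, of
trace zero. The remainder cancels U^s U^{-s} and leaves a scalar matrix times the tail of w, which
contributes only if the tail is empty. -/
theorem IsFreeHaar.trL_uPow_mul (hn : 1 ≤ n) (hL : IsFreeHaar (uPow n) L) (h1 : L 1 = 1) (s : Bool)
    (d : Matrix (Fin n) (Fin n) ℂ) {w : List (Bool × Matrix (Fin n) (Fin n) ℂ)} (hw : Reduced w) :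
    trL L (uPow n s * (scal (Fin n) _ d * evalS (uPow n) w)) = cycVal s d w := by
  rw [← mul_assoc, ← evalS_cons (uPow n) (s, d) w]
  cases w with
  | nil => exact hL.trL_evalS' (by simp) (by simp [ReducedFor])
  | cons y w =>
    by_cases hs : s = y.1
    · rw [hL.trL_evalS' (by simp) (List.isChain_cons_cons.2 ⟨fun h => (h hs).elim, hw⟩)]
      cases w <;> simp [cycVal, hs]
    · obtain ⟨d₀, h0, hd⟩ := exists_traceless hn d
      have hy : y.1 = !s := by simpa [Bool.eq_not] using fun h => hs h.symm
      have h2 : trL L (evalS (uPow n) ((s, d₀) :: y :: w)) = 0 :=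
        hL.trL_evalS' (by simp) (List.isChain_cons_cons.2 ⟨fun _ => h0, hw⟩)
      have h3 : evalS (uPow n) ((s, d) :: y :: w) = evalS (uPow n) ((s, d₀) :: y :: w) +
          (d.trace / n) • (scal (Fin n) _ y.2 * evalS (uPow n) w) := by
        conv_lhs => rw [evalS_cons, evalS_cons, hd]
        rw [map_add, mul_add, add_mul, map_smul, map_one, mul_smul_comm, mul_one, smul_mul_assoc,
          hy, ← mul_assoc (uPow n s), ← mul_assoc (uPow n s), uPow_mul_uPow, one_mul, evalS_cons,
          evalS_cons, hy]
      rw [h3, map_add, h2, map_smul, zero_add]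
      cases w with
      | nil => simp [cycVal, hs, evalS_nil, trL_scal L h1]
      | cons z w =>
        rw [hL.trL_evalS (w := z :: w) _ (by simp) hw.tail]
        simp [cycVal]

/-- The same cancellation takes place at the right end, where the last scalar matrix of w is split
instead of d. For a one-letter word with scalar matrix y the results agree, as Tr(d) Tr(y)/n is
symmetric in the two matrices. -/
theorem IsFreeHaar.trL_mul_uPow (hn : 1 ≤ n) (hL : IsFreeHaar (uPow n) L) (h1 : L 1 = 1) (s : Bool)
    (d : Matrix (Fin n) (Fin n) ℂ) {w : List (Bool × Matrix (Fin n) (Fin n) ℂ)} (hw : Reduced w) :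
    trL L (scal (Fin n) _ d * evalS (uPow n) w * uPow n s) = cycVal s d w := by
  have hone : uPow n s = evalS (uPow n) [(s, 1)] := by simp [evalS_cons, evalS_nil]
  conv_lhs => rw [hone]
  rw [mul_assoc, ← evalS_append]
  rcases List.eq_nil_or_concat w with rfl | ⟨v, y, rfl⟩
  · exact hL.trL_evalS _ (by simp) (by simp [ReducedFor])
  rw [List.concat_eq_append] at hw ⊢
  have hw' := List.isChain_append.1 hw
  by_cases hs : s = y.1
  · rw [hL.trL_evalS _ (by simp) (hw.append (by simp) (by simp [hs]))]
    cases v <;> simp [cycVal, hs]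
  · obtain ⟨d₀, h0, hd⟩ := exists_traceless hn y.2
    have hy : s = !y.1 := by simpa [Bool.eq_not] using hs
    have h2 : trL L (scal (Fin n) _ d * evalS (uPow n) (v ++ [(y.1, d₀)] ++ [(s, 1)])) = 0 := by
      refine hL.trL_evalS _ (by simp) (List.IsChain.append (hw'.1.append (by simp) ?_)
        (by simp) (by simp [h0]))
      intro x hx z hz
      have := hw'.2.2 x hx y (by simp)
      simp at hz
      subst hz
      exact this
    have h3 : evalS (uPow n) (v ++ [y] ++ [(s, 1)]) =
        evalS (uPow n) (v ++ [(y.1, d₀)] ++ [(s, 1)]) + (y.2.trace / n) • evalS (uPow n) v := by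
      simp only [evalS_append, evalS_cons, evalS_nil, mul_one, map_one]
      conv_lhs => rw [hd]
      rw [map_add, mul_add, mul_add, add_mul, map_smul, map_one, mul_smul_comm, mul_one,
        mul_smul_comm, smul_mul_assoc, hy, mul_assoc _ (uPow n y.1), uPow_mul_uPow, mul_one]
    rw [h3, mul_add, map_add, h2, mul_smul_comm, map_smul, zero_add]
    cases v with
    | nil =>
      simp [cycVal, hs, evalS_nil, trL_scal L h1]
      ring
    | cons z v => rw [hL.trL_evalS _ (by simp) hw'.1]; cases v <;> simp [cycVal]

/-- A unital functional that vanishes on reduced words is tracial. -/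
theorem IsFreeHaar.mul_comm (hn : 1 ≤ n) (hL : IsFreeHaar (uPow n) L) (h1 : L 1 = 1)
    (a b : UAlg n) : L (a * b) = L (b * a) := by
  have hu : ∀ s X, trL L (uPow n s * X) = trL L (X * uPow n s) := by
    intro s X
    have h : redSpan n ≤ LinearMap.eqLocus (trL L ∘ₗ LinearMap.mulLeft ℂ (uPow n s))
        (trL L ∘ₗ LinearMap.mulRight ℂ (uPow n s)) := by
      refine Submodule.span_le.2 ?_
      rintro _ ⟨d, w, hw, rfl⟩
      exact (hL.trL_uPow_mul hn h1 s d hw).trans (hL.trL_mul_uPow hn h1 s d hw).symm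
    rw [redSpan_eq_top hn] at h
    exact h (Submodule.mem_top (x := X))
  -- The matrices Y with (Tr ⊗ L)(YX) = (Tr ⊗ L)(XY) for all X are closed under sums and products,
  -- so the scalar matrices and U, U* suffice.
  have key := scalar_mem_of_closed (p := fun Y => ∀ X, trL L (Y * X) = trL L (X * Y))
    (fun d X => trL_scal_mul_comm L d X) hu
    (by
      intro X Y hX hY Z
      rw [mul_assoc, hX, mul_assoc, hY, mul_assoc])
    (by
      intro X Y hX hY Z
      rw [add_mul, mul_add, map_add, map_add, hX, hY]) a (Matrix.scalar (Fin n) b)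
  rw [← map_mul, ← map_mul, trL_scalar, trL_scalar] at key
  exact mul_left_cancel₀ (by exact_mod_cast (by omega : n ≠ 0)) key

/-! #### Positivity -/

/-- Letters move from v to w one at a time: if v = U^s e v', then v* d w = v'* e* (U^{-s} d w). The
exponent changes between U^{-s} and w exactly when v and w start with the same exponent, whence the
condition on d. At later stages e* is traceless where it must be because v is reduced. -/
theorem exists_star_evalS_mul {v w : List (Bool × Matrix (Fin n) (Fin n) ℂ)} (hv : Reduced v)
    (hw : Reduced w) (hne : v ≠ [] ∨ w ≠ []) (d : Matrix (Fin n) (Fin n) ℂ)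
    (hd : ∀ x ∈ v.head?, ∀ y ∈ w.head?, x.1 = y.1 → d.trace = 0) :
    ∃ c z, z ≠ [] ∧ Reduced z ∧ star (evalS (uPow n) v) * (scal (Fin n) _ d * evalS (uPow n) w) =
      scal (Fin n) _ c * evalS (uPow n) z := by
  induction v generalizing w d with
  | nil => exact ⟨d, w, by simpa using hne, hw, by simp [evalS_nil]⟩
  | cons x v ih =>
    have h1 : Reduced ((!x.1, d) :: w) := by
      refine List.isChain_cons.2 ⟨fun y hy hxy => hd x (by simp) y hy ?_, hw⟩
      simpa [Bool.not_eq] using hxy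
    obtain ⟨c, z, hz, hz', h⟩ := ih hv.tail h1 (by simp) (star x.2) (by
      intro y hy x' hx' hxy
      have := (List.isChain_cons.1 hv).1 y hy
      simp at hx'
      subst hx'
      rw [Matrix.star_eq_conjTranspose, Matrix.trace_conjTranspose, this (by simp [hxy]), star_zero])
    refine ⟨c, z, hz, hz', ?_⟩
    rw [← h, evalS_cons, star_mul, star_mul, star_uPow, star_scal, evalS_cons]
    simp only [mul_assoc]

/-- The inner product of two reduced words. -/
def gram (L : UAlg n →ₗ[ℂ] ℂ) (v w : List (Bool × Matrix (Fin n) (Fin n) ℂ)) : ℂ :=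
  trL L (star (evalS (uPow n) v) * evalS (uPow n) w)

/-- The traceless part of d turns the product into a scalar matrix times a nonempty reduced word, so
only the average Tr(d)/n survives. Two empty words leave no letter at all and are computed directly.
-/
theorem IsFreeHaar.trL_star_evalS_mul (hn : 1 ≤ n) (hL : IsFreeHaar (uPow n) L) (h1 : L 1 = 1)
    {v w : List (Bool × Matrix (Fin n) (Fin n) ℂ)} (hv : Reduced v) (hw : Reduced w)
    (d : Matrix (Fin n) (Fin n) ℂ) :
    trL L (star (evalS (uPow n) v) * (scal (Fin n) _ d * evalS (uPow n) w)) =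
      d.trace / n * gram L v w := by
  have hn' : (n : ℂ) ≠ 0 := by exact_mod_cast (by omega : n ≠ 0)
  by_cases hne : v ≠ [] ∨ w ≠ []
  · obtain ⟨d₀, h0, hd⟩ := exists_traceless hn d
    obtain ⟨c, z, hz, hz', h⟩ := exists_star_evalS_mul hv hw hne d₀ fun _ _ _ _ _ => h0
    conv_lhs => rw [hd]
    rw [map_add, add_mul, mul_add, map_add, h, hL.trL_evalS c hz hz', zero_add, map_smul, map_one,
      smul_mul_assoc, one_mul, mul_smul_comm, map_smul, gram, smul_eq_mul]
  · simp only [ne_eq, not_or, not_not] at hne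
    obtain ⟨rfl, rfl⟩ := hne
    simp only [gram, evalS_nil, star_one, one_mul, mul_one, trL_scal L h1]
    rw [← map_one (scal (Fin n) (UAlg n)), trL_scal L h1]
    simp [hn']

/-- Nothing cancels between v* and w, so the product is already reduced and nonempty. -/
theorem IsFreeHaar.gram_eq_zero (hL : IsFreeHaar (uPow n) L)
    {v w : List (Bool × Matrix (Fin n) (Fin n) ℂ)} (hv : Reduced v) (hw : Reduced w)
    (hne : v ≠ [] ∨ w ≠ []) (hd : ∀ x ∈ v.head?, ∀ y ∈ w.head?, x.1 ≠ y.1) : gram L v w = 0 := by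
  obtain ⟨c, z, hz, hz', h⟩ := exists_star_evalS_mul hv hw hne 1
    fun x hx y hy hxy => (hd x hx y hy hxy).elim
  rw [map_one, one_mul] at h
  rw [gram, h, hL.trL_evalS c hz hz']

/-- The contribution of the first letter of a word to its inner products. -/
def headCoeff (s : Bool) (p q : Fin n) : List (Bool × Matrix (Fin n) (Fin n) ℂ) → ℂ
  | [] => 0
  | x :: _ => if x.1 = s then x.2 p q else 0

theorem trace_star_mul (d e : Matrix (Fin n) (Fin n) ℂ) :
    (star d * e).trace = ∑ p, ∑ q, star (d p q) * e p q := by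
  rw [Matrix.trace, Finset.sum_comm]
  simp [Matrix.mul_apply]

/-- Equal first exponents cancel and leave a scalar matrix x*y between the tails, of which only the
normalized trace counts. Expanding Tr(x*y) over positions (p, q), and recording the exponent s,
exhibits the Gram matrix as a sum of Gram matrices of the tails weighted by rank one kernels; the
empty word adds one more rank one term. -/
theorem IsFreeHaar.gram_eq (hn : 1 ≤ n) (hL : IsFreeHaar (uPow n) L) (h1 : L 1 = 1)
    {v w : List (Bool × Matrix (Fin n) (Fin n) ℂ)} (hv : Reduced v) (hw : Reduced w) :
    gram L v w = n * (star (if v = [] then (1 : ℂ) else 0) * (if w = [] then 1 else 0)) +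
      ∑ s, ∑ p, ∑ q, (n : ℂ)⁻¹ * (star (headCoeff s p q v) * headCoeff s p q w *
        gram L v.tail w.tail) := by
  cases v with
  | nil =>
    cases w with
    | nil =>
      simp only [gram, evalS_nil, star_one, one_mul, headCoeff]
      rw [← map_one (scal (Fin n) (UAlg n)), trL_scal L h1]
      simp
    | cons y w =>
      rw [hL.gram_eq_zero hv hw (by simp) (by simp)]
      simp [headCoeff]
  | cons x v =>
    cases w with
    | nil =>
      rw [hL.gram_eq_zero hv hw (by simp) (by simp)]
      simp [headCoeff]
    | cons y w =>
      by_cases hxy : x.1 = y.1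
      · have h : gram L (x :: v) (y :: w) = (star x.2 * y.2).trace / n * gram L v w := by
          rw [← hL.trL_star_evalS_mul (v := v) (w := w) hn h1 hv.tail hw.tail, gram, evalS_cons, evalS_cons, star_mul,
            star_mul, star_uPow, star_scal, hxy, map_mul (scal (Fin n) (UAlg n))]
          have := uPow_mul_uPow (n := n) (!y.1)
          rw [Bool.not_not] at this
          simp only [mul_assoc]
          rw [← mul_assoc (uPow n _) (uPow n _), this, one_mul]
        rw [h, trace_star_mul]
        have h2 : ∀ s p q, star (headCoeff s p q (x :: v)) * headCoeff s p q (y :: w) =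
            if s = y.1 then star (x.2 p q) * y.2 p q else 0 := by
          intro s p q
          by_cases hs : y.1 = s
          · simp [headCoeff, hxy, hs]
          · simp [headCoeff, hxy, hs, Ne.symm hs]
        have h3 : ∀ s, (∑ p, ∑ q, (n : ℂ)⁻¹ * ((if s = y.1 then star (x.2 p q) * y.2 p q else 0) *
            gram L v w)) = if s = y.1 then
              ∑ p, ∑ q, (n : ℂ)⁻¹ * (star (x.2 p q) * y.2 p q * gram L v w) else 0 := by
          intro s
          by_cases hs : s = y.1 <;> simp [hs]
        simp only [h2, List.tail_cons, h3, Finset.sum_ite_eq', Finset.mem_univ, if_true]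
        simp only [List.cons_ne_nil, if_false, star_zero, mul_zero, zero_add, ← Finset.mul_sum,
          ← Finset.sum_mul]
        ring
      · rw [hL.gram_eq_zero hv hw (by simp) (by simpa using hxy)]
        have h2 : ∀ s p q, star (headCoeff s p q (x :: v)) * headCoeff s p q (y :: w) = 0 := by
          intro s p q
          by_cases hs : y.1 = s
          · have : x.1 ≠ s := fun h => hxy (h.trans hs.symm)
            simp [headCoeff, this]
          · simp [headCoeff, hs]
        simp only [h2]
        simp

/-- The Gram matrix of reduced words is positive. -/
theorem IsFreeHaar.gram_nonneg (hn : 1 ≤ n) (hL : IsFreeHaar (uPow n) L) (h1 : L 1 = 1)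
    {κ : Type*} [Fintype κ] (m : ℕ) (v : κ → List (Bool × Matrix (Fin n) (Fin n) ℂ))
    (hv : ∀ i, Reduced (v i)) (hm : ∀ i, (v i).length ≤ m) (c : κ → ℂ) :
    0 ≤ ∑ i, ∑ j, star (c i) * c j * gram L (v i) (v j) := by
  have hn0 : (0 : ℂ) ≤ n := by positivity
  have hn1 : (0 : ℂ) ≤ (n : ℂ)⁻¹ := by positivity
  have hsq : ∀ e : κ → ℂ, 0 ≤ ∑ i, ∑ j, star (e i) * e j := by
    intro e
    have : ∑ i, ∑ j, star (e i) * e j = star (∑ i, e i) * ∑ i, e i := by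
      rw [star_sum, Finset.sum_mul_sum]
    rw [this]
    exact star_mul_self_nonneg _
  induction m generalizing v c with
  | zero =>
    have h0 : ∀ i, v i = [] := fun i => List.length_eq_zero_iff.1 (Nat.le_zero.1 (hm i))
    have h2 : gram L [] [] = n := by
      simp only [gram, evalS_nil, star_one, one_mul]
      rw [← map_one (scal (Fin n) (UAlg n)), trL_scal L h1]
      simp
    simp only [h0, h2, ← Finset.sum_mul]
    exact mul_nonneg (hsq c) hn0
  | succ m ih =>
    -- Insert the recursion. The head coefficients are absorbed into the c's, and each summand
    -- becomes a Gram form of the tails, of length at most m.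
    have h3 : ∑ i, ∑ j, star (c i) * c j * gram L (v i) (v j) =
        n * ∑ i, ∑ j, star (c i * if v i = [] then 1 else 0) * (c j * if v j = [] then 1 else 0) +
        ∑ s, ∑ p, ∑ q, (n : ℂ)⁻¹ * ∑ i, ∑ j, star (c i * headCoeff s p q (v i)) *
          (c j * headCoeff s p q (v j)) * gram L (v i).tail (v j).tail := by
      have h4 : ∀ i j, star (c i) * c j * gram L (v i) (v j) =
          n * (star (c i * if v i = [] then 1 else 0) * (c j * if v j = [] then 1 else 0)) +
          ∑ s, ∑ p, ∑ q, (n : ℂ)⁻¹ * (star (c i * headCoeff s p q (v i)) *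
            (c j * headCoeff s p q (v j)) * gram L (v i).tail (v j).tail) := by
        intro i j
        rw [hL.gram_eq hn h1 (hv i) (hv j), mul_add]
        congr 1
        · simp only [star_mul']
          ring
        · simp only [Finset.mul_sum]
          refine Finset.sum_congr rfl fun s _ => Finset.sum_congr rfl fun p _ =>
            Finset.sum_congr rfl fun q _ => ?_
          simp only [star_mul']
          ring
      simp only [h4, Finset.sum_add_distrib, Finset.mul_sum]
      congr 1
      calc _ = ∑ i, ∑ s, ∑ j, ∑ p, ∑ q, (n : ℂ)⁻¹ * (star (c i * headCoeff s p q (v i)) *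
            (c j * headCoeff s p q (v j)) * gram L (v i).tail (v j).tail) :=
            Finset.sum_congr rfl fun i _ => Finset.sum_comm
        _ = ∑ s, ∑ i, ∑ j, ∑ p, ∑ q, (n : ℂ)⁻¹ * (star (c i * headCoeff s p q (v i)) *
            (c j * headCoeff s p q (v j)) * gram L (v i).tail (v j).tail) := Finset.sum_comm
        _ = ∑ s, ∑ i, ∑ p, ∑ j, ∑ q, (n : ℂ)⁻¹ * (star (c i * headCoeff s p q (v i)) *
            (c j * headCoeff s p q (v j)) * gram L (v i).tail (v j).tail) :=
            Finset.sum_congr rfl fun s _ => Finset.sum_congr rfl fun i _ => Finset.sum_comm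
        _ = ∑ s, ∑ p, ∑ i, ∑ j, ∑ q, (n : ℂ)⁻¹ * (star (c i * headCoeff s p q (v i)) *
            (c j * headCoeff s p q (v j)) * gram L (v i).tail (v j).tail) :=
            Finset.sum_congr rfl fun s _ => Finset.sum_comm
        _ = ∑ s, ∑ p, ∑ i, ∑ q, ∑ j, (n : ℂ)⁻¹ * (star (c i * headCoeff s p q (v i)) *
            (c j * headCoeff s p q (v j)) * gram L (v i).tail (v j).tail) :=
            Finset.sum_congr rfl fun s _ => Finset.sum_congr rfl fun p _ =>
              Finset.sum_congr rfl fun i _ => Finset.sum_comm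
        _ = _ := Finset.sum_congr rfl fun s _ => Finset.sum_congr rfl fun p _ => Finset.sum_comm
    rw [h3]
    refine add_nonneg (mul_nonneg hn0 (hsq _)) (Finset.sum_nonneg fun s _ =>
      Finset.sum_nonneg fun p _ => Finset.sum_nonneg fun q _ => mul_nonneg hn1 ?_)
    refine ih (fun i => (v i).tail) (fun i => (hv i).tail) (fun i => ?_) _
    have := hm i
    rw [List.length_tail]
    omega

/-- A unital functional that vanishes on reduced words is positive. -/
theorem IsFreeHaar.nonneg (hn : 1 ≤ n) (hL : IsFreeHaar (uPow n) L) (h1 : L 1 = 1) (a : UAlg n) :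
    0 ≤ L (star a * a) := by
  have hn' : (n : ℂ) ≠ 0 := by exact_mod_cast (by omega : n ≠ 0)
  have hn1 : (0 : ℂ) ≤ (n : ℂ)⁻¹ := by positivity
  have hX : ∀ X : Matrix (Fin n) (Fin n) (UAlg n), 0 ≤ trL L (star X * X) := by
    intro X
    have hmem : X ∈ redSpan n := by rw [redSpan_eq_top hn]; exact Submodule.mem_top
    obtain ⟨r, f, g, hg⟩ := Submodule.mem_span_set'.1 hmem
    choose d w hw hgw using fun i => (g i).2
    have hXs : X = ∑ i, scal (Fin n) _ (f i • d i) * evalS (uPow n) (w i) := by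
      rw [← hg]
      refine Finset.sum_congr rfl fun i _ => ?_
      rw [hgw, map_smul, smul_mul_assoc]
    -- Between two reduced words only the normalized trace of the product of scalar matrices counts,
    -- so every position (p, q) contributes a Gram form whose coefficients are the (p, q) entries.
    have h2 : trL L (star X * X) = ∑ p, ∑ q, (n : ℂ)⁻¹ * ∑ i, ∑ j,
        star ((f i • d i) p q) * (f j • d j) p q * gram L (w i) (w j) := by
      have h3 : ∀ i j, trL L (star (scal (Fin n) _ (f i • d i) * evalS (uPow n) (w i)) *
          (scal (Fin n) _ (f j • d j) * evalS (uPow n) (w j))) =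
          ∑ p, ∑ q, (n : ℂ)⁻¹ * (star ((f i • d i) p q) * (f j • d j) p q *
            gram L (w i) (w j)) := by
        intro i j
        rw [star_mul, star_scal, mul_assoc, ← mul_assoc (scal _ _ _), ← map_mul,
          hL.trL_star_evalS_mul hn h1 (hw i) (hw j), trace_star_mul]
        simp only [← Finset.mul_sum, ← Finset.sum_mul]
        ring
      rw [hXs, star_sum, Finset.sum_mul_sum]
      simp only [map_sum, h3, Finset.mul_sum]
      calc _ = ∑ i, ∑ p, ∑ j, ∑ q, (n : ℂ)⁻¹ * (star ((f i • d i) p q) * (f j • d j) p q *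
            gram L (w i) (w j)) := Finset.sum_congr rfl fun i _ => Finset.sum_comm
        _ = ∑ p, ∑ i, ∑ j, ∑ q, (n : ℂ)⁻¹ * (star ((f i • d i) p q) * (f j • d j) p q *
            gram L (w i) (w j)) := Finset.sum_comm
        _ = ∑ p, ∑ i, ∑ q, ∑ j, (n : ℂ)⁻¹ * (star ((f i • d i) p q) * (f j • d j) p q *
            gram L (w i) (w j)) := Finset.sum_congr rfl fun p _ => Finset.sum_congr rfl fun i _ =>
              Finset.sum_comm
        _ = _ := Finset.sum_congr rfl fun p _ => Finset.sum_comm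
    rw [h2]
    refine Finset.sum_nonneg fun p _ => Finset.sum_nonneg fun q _ => mul_nonneg hn1 ?_
    exact hL.gram_nonneg hn h1 (Finset.univ.sup fun i => (w i).length) w hw
      (fun i => Finset.le_sup (f := fun i => (w i).length) (Finset.mem_univ i)) _
  have h := hX (Matrix.scalar (Fin n) a)
  have h2 : star (Matrix.scalar (Fin n) a) = Matrix.scalar (Fin n) (star a) := by
    rw [Matrix.scalar_apply, Matrix.star_eq_conjTranspose, Matrix.diagonal_conjTranspose]
    rfl
  rw [h2, ← map_mul, trL_scalar] at h
  have := mul_nonneg hn1 h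
  rwa [inv_mul_cancel_left₀ hn'] at this

/-- The state given by a unital functional that vanishes on reduced words. -/
def IsFreeHaar.toState (hn : 1 ≤ n) (hL : IsFreeHaar (uPow n) L) (h1 : L 1 = 1) :
    State (UAlg n) :=
  ⟨L, h1, hL.nonneg hn h1⟩

end Spanning

/-! ### Absorption for the free convolution -/

section FreeConv

variable {n : ℕ}

theorem freeProd_spec {A B : Type*} [Ring A] [StarRing A] [Algebra ℂ A] [StarModule ℂ A]
    [Ring B] [StarRing B] [Algebra ℂ B] [StarModule ℂ B] (φ : State A) (ψ : State B) :
    IsFreeProduct φ.toLin ψ.toLin (freeProd φ ψ) :=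
  (exists_isFreeProduct φ.toLin ψ.toLin φ.map_one ψ.map_one).choose_spec

/-- Tr ⊗ φ is a trace on the matrices when φ is one, so conjugation by the unitary U does not change
it. This is where absorption for the free convolution needs φ to be tracial. -/
theorem trace_conj_uPow {φ : State (UAlg n)} (hφ : φ.IsTracial) (s : Bool)
    (d : Matrix (Fin n) (Fin n) ℂ) :
    φ (uPow n s * scal (Fin n) _ d * uPow n (!s)).trace = d.trace := by
  have h := IsTracial_trL (L := φ.toLin) hφ (uPow n s) (scal (Fin n) _ d * uPow n (!s))
  have h2 : uPow n (!s) * uPow n s = 1 := by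
    simpa using uPow_mul_uPow (n := n) (!s)
  rw [← mul_assoc, mul_assoc (scal _ _ _), h2, mul_one, trL_scal _ φ.map_one] at h
  exact h

theorem trace_one_conj {φ : State (UAlg n)} (d : Matrix (Fin n) (Fin n) ℂ) :
    φ (1 * scal (Fin n) (UAlg n) d * 1).trace = d.trace := by
  rw [one_mul, mul_one]
  exact trL_scal _ φ.map_one d

theorem freeConv_one (φ ψ : State (UAlg n)) : freeConv φ ψ 1 = 1 := by
  change freeProd φ ψ (UAlg.Δ n 1) = 1
  rw [map_one, (freeProd_spec φ ψ).1]

/-- Δ sends U to U⁽¹⁾U⁽²⁾ and U* to U⁽²⁾*U⁽¹⁾*, so U⁽²⁾ is the free Haar matrix, with U⁽¹⁾ before it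
and U⁽¹⁾* after its adjoint. At a change of exponent the matrix in between is d or U⁽¹⁾* d U⁽¹⁾, and
both have the trace of d. -/
theorem isFreeHaar_freeConv_left {φ h : State (UAlg n)} (hφ : φ.IsTracial)
    (hh : IsFreeHaar (uPow n) h.toLin) : IsFreeHaar (uPow n) (freeConv φ h) := by
  refine isFreeHaar_comp ?_
  have key := (freeProd_spec φ h).isFreeIn.isFreeHaar_mul φ.map_one hh
    (fun s => if s then uPow n true else 1) (fun s => if s then 1 else uPow n false) (by
      intro s d hd
      cases s
      · exact (trace_conj_uPow hφ false d).trans hd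
      · exact (trace_one_conj d).trans hd)
  convert key using 2 with s
  cases s
  · simp only [Bool.false_eq_true, if_false, map_one, one_mul]
    ext i j
    simp [Matrix.mul_apply, uPow_false_apply, Δ_star_u]
  · simp only [if_true, map_one, mul_one]
    ext i j
    simp [Matrix.mul_apply, uPow_true_apply, UAlg.Δ_u]

/-- Here U⁽¹⁾ is the free Haar matrix, and U⁽²⁾ stands behind it, so freeness is used with the legs
exchanged. -/
theorem isFreeHaar_freeConv_right {φ h : State (UAlg n)} (hφ : φ.IsTracial)
    (hh : IsFreeHaar (uPow n) h.toLin) : IsFreeHaar (uPow n) (freeConv h φ) := by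
  refine isFreeHaar_comp ?_
  have key := (freeProd_spec h φ).isFreeIn.swap.isFreeHaar_mul φ.map_one hh
    (fun s => if s then 1 else uPow n false) (fun s => if s then uPow n true else 1) (by
      intro s d hd
      cases s
      · exact (trace_one_conj d).trans hd
      · exact (trace_conj_uPow hφ true d).trans hd)
  convert key using 2 with s
  cases s
  · simp only [Bool.false_eq_true, if_false, map_one, mul_one]
    ext i j
    simp [Matrix.mul_apply, uPow_false_apply, Δ_star_u]
  · simp only [if_true, map_one, one_mul]
    ext i j
    simp [Matrix.mul_apply, uPow_true_apply, UAlg.Δ_u]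

theorem isHaarTrace_freeConv (hn : 1 ≤ n) {h : State (UAlg n)}
    (hh : IsFreeHaar (uPow n) h.toLin) : IsHaarTrace freeConv h :=
  ⟨hh.mul_comm hn h.map_one, fun φ hφ =>
    ⟨(isFreeHaar_freeConv_left hφ hh).unique hn hh (freeConv_one φ h) h.map_one,
      (isFreeHaar_freeConv_right hφ hh).unique hn hh (freeConv_one h φ) h.map_one⟩⟩

theorem State.ext' {A : Type*} [Ring A] [StarRing A] [Algebra ℂ A] {φ ψ : State A}
    (h : φ.toLin = ψ.toLin) : φ = ψ := by
  cases φ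
  cases ψ
  congr

/-- A Haar trace is unique. -/
theorem IsHaarTrace.unique {conv : State (UAlg n) → State (UAlg n) → (UAlg n →ₗ[ℂ] ℂ)}
    {h h' : State (UAlg n)} (hh : IsHaarTrace conv h) (hh' : IsHaarTrace conv h') : h' = h :=
  State.ext' ((hh'.2 h hh.1).1.symm.trans (hh.2 h' hh'.1).2)

end FreeConv

/-! ### The compression of a Haar unitary -/

section Compression

variable {n : ℕ} {A : Type*} [Ring A] [StarRing A] [Algebra ℂ A] [StarModule ℂ A]

/-- The element `∑ₖ Eₖᵢ x Eⱼₖ`, which commutes with the matrix units. -/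
def embEntry (x : Coprod A (Matrix (Fin n) (Fin n) ℂ)) (i j : Fin n) :
    Coprod A (Matrix (Fin n) (Fin n) ℂ) :=
  ∑ k, Coprod.inr A _ (Matrix.single k i 1) * x * Coprod.inr A _ (Matrix.single j k 1)

theorem inr_single_mul_inr_single (i j k l : Fin n) :
    Coprod.inr A (Matrix (Fin n) (Fin n) ℂ) (Matrix.single i j 1) *
      Coprod.inr A _ (Matrix.single k l 1) =
      if j = k then Coprod.inr A _ (Matrix.single i l 1) else 0 := by
  rw [← map_mul]
  split_ifs with h
  · subst h
    rw [Matrix.single_mul_single_same, mul_one]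
  · rw [Matrix.single_mul_single_of_ne (h := h), map_zero]

/-- Multiplying by E_{pq} keeps the summand k = q on the left and k = p on the right, with the same
result E_{pi} x E_{jq}. Hence these sums commute with the matrix units. -/
theorem inr_single_mul_embEntry (x : Coprod A (Matrix (Fin n) (Fin n) ℂ)) (p q i j : Fin n) :
    Coprod.inr A _ (Matrix.single p q 1) * embEntry x i j =
      Coprod.inr A _ (Matrix.single p i 1) * x * Coprod.inr A _ (Matrix.single j q 1) := by
  rw [embEntry, Finset.mul_sum]
  simp only [← mul_assoc, inr_single_mul_inr_single, ite_mul, zero_mul, Finset.sum_ite_eq,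
    Finset.mem_univ, if_true]

theorem embEntry_mul_inr_single (x : Coprod A (Matrix (Fin n) (Fin n) ℂ)) (p q i j : Fin n) :
    embEntry x i j * Coprod.inr A _ (Matrix.single p q 1) =
      Coprod.inr A _ (Matrix.single p i 1) * x * Coprod.inr A _ (Matrix.single j q 1) := by
  rw [embEntry, Finset.sum_mul]
  simp only [mul_assoc, inr_single_mul_inr_single, mul_ite, mul_zero, Finset.sum_ite_eq',
    Finset.mem_univ, if_true]

theorem sum_inr_single : ∑ k, Coprod.inr A (Matrix (Fin n) (Fin n) ℂ) (Matrix.single k k 1) = 1 := by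
  rw [← map_sum, ← map_one (Coprod.inr A (Matrix (Fin n) (Fin n) ℂ))]
  congr 1
  ext i j
  rw [Matrix.sum_apply]
  by_cases h : i = j
  · subst h
    simp [Matrix.single_apply]
  · rw [Finset.sum_eq_zero, Matrix.one_apply_ne h]
    intro m _
    rw [Matrix.single_apply, if_neg]
    rintro ⟨rfl, rfl⟩
    exact h rfl

/-- The matrix with entries `∑ₖ Eₖᵢ x Eⱼₖ`. -/
def embMat (x : Coprod A (Matrix (Fin n) (Fin n) ℂ)) :
    Matrix (Fin n) (Fin n) (Coprod A (Matrix (Fin n) (Fin n) ℂ)) :=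
  Matrix.of (embEntry x)

theorem embMat_apply (x : Coprod A (Matrix (Fin n) (Fin n) ℂ)) (i j : Fin n) :
    embMat x i j = embEntry x i j := rfl

/-- An algebra containing a system of matrix units is the algebra of matrices over the commutant of
that system. In the product the inner units E_{kk} add up to 1. -/
theorem embMat_mul (x y : Coprod A (Matrix (Fin n) (Fin n) ℂ)) :
    embMat (x * y) = embMat x * embMat y := by
  ext i j
  rw [Matrix.mul_apply]
  simp only [embMat_apply]
  have h : ∀ k, embEntry x i k * embEntry y k j = ∑ p, Coprod.inr A _ (Matrix.single p i 1) *
      (x * Coprod.inr A _ (Matrix.single k k 1) * y) * Coprod.inr A _ (Matrix.single j p 1) := by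
    intro k
    rw [embEntry, Finset.sum_mul]
    refine Finset.sum_congr rfl fun p _ => ?_
    rw [mul_assoc, inr_single_mul_embEntry]
    simp only [mul_assoc]
  simp only [h]
  rw [Finset.sum_comm, embEntry]
  refine Finset.sum_congr rfl fun p _ => ?_
  rw [← Finset.sum_mul, ← Finset.mul_sum, ← Finset.sum_mul, ← Finset.mul_sum, sum_inr_single,
    mul_one]

theorem embMat_inr (d : Matrix (Fin n) (Fin n) ℂ) :
    embMat (Coprod.inr A _ d) = scal (Fin n) _ d := by
  ext i j
  rw [embMat_apply, embEntry, scal_apply, Algebra.algebraMap_eq_smul_one, ← sum_inr_single,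
    Finset.smul_sum]
  refine Finset.sum_congr rfl fun k _ => ?_
  rw [← map_mul, ← map_mul, Matrix.single_mul_mul_single, ← map_smul]
  simp

theorem embMat_one : embMat (1 : Coprod A (Matrix (Fin n) (Fin n) ℂ)) = 1 := by
  rw [← map_one (Coprod.inr A (Matrix (Fin n) (Fin n) ℂ)), embMat_inr, map_one]

theorem embMat_star (x : Coprod A (Matrix (Fin n) (Fin n) ℂ)) :
    embMat (star x) = star (embMat x) := by
  have h : ∀ i j, star (Coprod.inr A (Matrix (Fin n) (Fin n) ℂ) (Matrix.single i j 1)) =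
      Coprod.inr A _ (Matrix.single j i 1) := by
    intro i j
    rw [← map_star, Matrix.star_eq_conjTranspose, Matrix.conjTranspose_single, star_one]
  ext i j
  rw [Matrix.star_apply, embMat_apply, embMat_apply, embEntry, embEntry, star_sum]
  simp only [star_mul, h, mul_assoc]

variable {U : A}

/-- The unital `*`-homomorphism `uᵢⱼ ↦ ∑ₖ Eₖᵢ U Eⱼₖ`. -/
def embHom (hU : U ∈ unitary A) : UAlg n →⋆ₐ[ℂ] Coprod A (Matrix (Fin n) (Fin n) ℂ) :=
  UAlg.lift ⟨embMat (Coprod.inl A _ U), by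
    rw [Unitary.mem_iff, ← embMat_star, ← embMat_mul, ← embMat_mul, ← map_star, ← map_mul,
      ← map_mul, Unitary.star_mul_self_of_mem hU, Unitary.mul_star_self_of_mem hU, map_one,
      embMat_one]
    exact ⟨rfl, rfl⟩⟩

theorem embHom_u (hU : U ∈ unitary A) (i j : Fin n) :
    embHom hU (UAlg.u i j) = embEntry (Coprod.inl A _ U) i j := UAlg.lift_u _ i j

theorem embHom_commute (hU : U ∈ unitary A) (p : Fin n) (a : UAlg n) :
    Coprod.inr A _ (Matrix.single p p 1) * embHom hU a =
      embHom hU a * Coprod.inr A _ (Matrix.single p p 1) := by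
  have h : ∀ (x : Coprod A (Matrix (Fin n) (Fin n) ℂ)) (i j : Fin n),
      Coprod.inr A _ (Matrix.single p p 1) * embEntry x i j =
      embEntry x i j * Coprod.inr A _ (Matrix.single p p 1) := fun x i j => by
    rw [inr_single_mul_embEntry, embEntry_mul_inr_single]
  induction a using UAlg.induct with
  | hs c => rw [AlgHomClass.commutes, Algebra.commutes]
  | hu i j => rw [embHom_u, h]
  | hu' i j =>
    have h2 := congrFun (congrFun (embMat_star (Coprod.inl A (Matrix (Fin n) (Fin n) ℂ) U)) j) i
    rw [Matrix.star_apply, embMat_apply, embMat_apply] at h2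
    rw [map_star, embHom_u, ← h2, h]
  | hm a b h1 h2 => rw [map_mul, ← mul_assoc, h1, mul_assoc, h2, mul_assoc]
  | ha a b h1 h2 => rw [map_add, mul_add, add_mul, h1, h2]

/-- The compression `a ↦ E₁₁ J(a)`, with `J` the homomorphism `embHom`. -/
def compression (hn : 1 ≤ n) (hU : U ∈ unitary A) :
    UAlg n →⋆ₙₐ[ℂ] Coprod A (Matrix (Fin n) (Fin n) ℂ) where
  toFun a := Coprod.inr A _ (Matrix.single ⟨0, hn⟩ ⟨0, hn⟩ 1) * embHom hU a
  map_smul' c a := by rw [map_smul, mul_smul_comm]; rfl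
  map_zero' := by rw [map_zero, mul_zero]
  map_add' a b := by rw [map_add, mul_add]
  map_mul' a b := by
    set e := Coprod.inr A (Matrix (Fin n) (Fin n) ℂ) (Matrix.single ⟨0, hn⟩ ⟨0, hn⟩ 1) with he
    have hee : e * e = e := by rw [he, inr_single_mul_inr_single, if_pos rfl]
    calc e * embHom hU (a * b) = e * (e * embHom hU a) * embHom hU b := by
          rw [← mul_assoc, hee, map_mul, mul_assoc]
      _ = e * (embHom hU a * e) * embHom hU b := by rw [he, embHom_commute hU _ a]
      _ = e * embHom hU a * (e * embHom hU b) := by simp only [mul_assoc]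
  map_star' a := by
    rw [star_mul, map_star, ← map_star (Coprod.inr A _), Matrix.star_eq_conjTranspose,
      Matrix.conjTranspose_single, star_one, ← map_star, embHom_commute]

theorem compression_apply (hn : 1 ≤ n) (hU : U ∈ unitary A) (a : UAlg n) :
    compression hn hU a = Coprod.inr A _ (Matrix.single ⟨0, hn⟩ ⟨0, hn⟩ 1) * embHom hU a := rfl

theorem isCompression_compression (hn : 1 ≤ n) (hU : U ∈ unitary A) :
    IsCompression hn U (compression hn hU) :=
  ⟨by rw [compression_apply, map_one, mul_one],
    fun k l => by rw [compression_apply, embHom_u, inr_single_mul_embEntry]⟩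

/-! ### The compression annihilates reduced words -/

/-- A unitary and its adjoint, as one-by-one matrices. -/
def unitPow (U : A) (s : Bool) : Matrix Unit Unit A := Matrix.of fun _ _ => if s then U else star U

/-- A traceless one-by-one scalar matrix is zero. So a reduced word with a change of exponent
vanishes, and any other is a multiple of a positive power of U or of U*. -/
theorem isFreeHaar_unitPow {φ : A →ₗ[ℂ] ℂ} (h1 : ∀ k : ℕ, 1 ≤ k → φ (U ^ k) = 0)
    (h2 : ∀ k : ℕ, 1 ≤ k → φ (star U ^ k) = 0) : IsFreeHaar (unitPow U) φ := by
  have key : ∀ (x : Bool × Matrix Unit Unit ℂ) (w : List (Bool × Matrix Unit Unit ℂ)),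
      Reduced (x :: w) → ∃ (c : ℂ) (k : ℕ), evalS (unitPow U) (x :: w) =
        c • (unitPow U x.1) ^ (k + 1) := by
    intro x w hw
    have hd : ∀ d : Matrix Unit Unit ℂ, d = d.trace • 1 := by
      intro d
      ext i j
      simp [Matrix.trace]
    induction w generalizing x with
    | nil =>
      refine ⟨x.2.trace, 0, ?_⟩
      rw [evalS_cons, evalS_nil]
      conv_lhs => rw [hd x.2]
      rw [map_smul, map_one, mul_smul_comm, mul_one, mul_one, zero_add, pow_one]
    | cons y w ih =>
      obtain ⟨c, k, h⟩ := ih y hw.tail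
      by_cases hxy : x.1 = y.1
      · refine ⟨x.2.trace * c, k + 1, ?_⟩
        rw [evalS_cons, h]
        conv_lhs => rw [hd x.2]
        simp only [map_smul, map_one, mul_smul_comm, mul_one, smul_mul_assoc, smul_smul]
        rw [hxy, pow_succ' _ (k + 1), mul_comm c]
      · refine ⟨0, 0, ?_⟩
        have := (List.isChain_cons_cons.1 hw).1 hxy
        rw [evalS_cons]
        conv_lhs => rw [hd x.2]
        rw [this, zero_smul, map_zero, mul_zero, zero_mul, zero_smul]
  have hpow : ∀ s (k : ℕ) i j, (unitPow U s ^ (k + 1)) i j = (if s then U else star U) ^ (k + 1) := by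
    intro s k i j
    induction k generalizing j with
    | zero => simp [unitPow]
    | succ k ih =>
      rw [pow_succ _ (k + 1), Matrix.mul_apply, Fintype.sum_unique, ih, pow_succ _ (k + 1)]
      rfl
  intro w hne hw i j
  obtain ⟨x, w, rfl⟩ := List.exists_cons_of_ne_nil hne
  obtain ⟨c, k, h⟩ := key x w hw
  rw [h, Matrix.smul_apply, hpow, map_smul]
  cases x.1
  · simp [h2 (k + 1) (by omega)]
  · simp [h1 (k + 1) (by omega)]

theorem IsFreeProduct.apply_inr {B : Type*} [Ring B] [StarRing B] [Algebra ℂ B] [StarModule ℂ B]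
    {φ : A →ₗ[ℂ] ℂ} {ψ : B →ₗ[ℂ] ℂ} {Φ : Coprod A B →ₗ[ℂ] ℂ} (h : IsFreeProduct φ ψ Φ)
    (hψ : ψ 1 = 1) (b : B) : Φ (Coprod.inr A B b) = ψ b := by
  have h1 := h.2 [.inr (b - ψ b • 1)] (by simp) (by simp [Alternating])
    (by simp [LettersInKer, hψ])
  rw [wordProd_cons_inr, wordProd_nil, mul_one, map_sub, map_sub, map_smul, map_one, map_smul, h.1,
    smul_eq_mul, mul_one, sub_eq_zero] at h1
  exact h1

/-- The functional `a ↦ n Φ(E₁₁ J(a))`. -/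
def compressionFun (hn : 1 ≤ n) (hU : U ∈ unitary A)
    (Φ : Coprod A (Matrix (Fin n) (Fin n) ℂ) →ₗ[ℂ] ℂ) : UAlg n →ₗ[ℂ] ℂ :=
  ((n : ℂ) • Φ ∘ₗ LinearMap.mulLeft ℂ (Coprod.inr A _ (Matrix.single ⟨0, hn⟩ ⟨0, hn⟩ 1))) ∘ₗ
    (embHom hU).toAlgHom.toLinearMap

theorem compressionFun_apply (hn : 1 ≤ n) (hU : U ∈ unitary A)
    (Φ : Coprod A (Matrix (Fin n) (Fin n) ℂ) →ₗ[ℂ] ℂ) (a : UAlg n) :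
    compressionFun hn hU Φ a = n * Φ (compression hn hU a) := rfl

variable {φ : A →ₗ[ℂ] ℂ} {Φ : Coprod A (Matrix (Fin n) (Fin n) ℂ) →ₗ[ℂ] ℂ}

theorem compressionFun_one (hn : 1 ≤ n) (hU : U ∈ unitary A) (hΦ : IsFreeProduct φ (ntr n) Φ) :
    compressionFun hn hU Φ 1 = 1 := by
  have hn' : (n : ℂ) ≠ 0 := by exact_mod_cast (by omega : n ≠ 0)
  rw [compressionFun_apply, compression_apply, map_one, mul_one,
    hΦ.apply_inr (trState n hn).map_one]
  simp [ntr, hn']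

/-- The word `U^{s₁} d₁ ⋯ U^{sₘ} dₘ` in `A ⊔ Mₙ`. -/
def coprodWord (U : A) : List (Bool × Matrix (Fin n) (Fin n) ℂ) →
    Coprod A (Matrix (Fin n) (Fin n) ℂ)
  | [] => 1
  | x :: w => Coprod.inl A _ (if x.1 then U else star U) * Coprod.inr A _ x.2 * coprodWord U w

theorem embHom_evalS (hU : U ∈ unitary A) (w : List (Bool × Matrix (Fin n) (Fin n) ℂ)) :
    (embHom hU).toAlgHom.mapMatrix (evalS (uPow n) w) = embMat (coprodWord U w) := by
  rw [mapMatrix_evalS]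
  have h : ∀ s, (embHom hU).toAlgHom.mapMatrix (uPow n s) =
      embMat (Coprod.inl A _ (if s then U else star U)) := by
    intro s
    cases s
    · simp only [Bool.false_eq_true, if_false]
      rw [map_star, embMat_star]
      ext i j
      rw [Matrix.star_apply, embMat_apply, ← embHom_u hU, ← map_star]
      rfl
    · ext i j
      exact embHom_u hU i j
  induction w with
  | nil => simp [evalS_nil, coprodWord, embMat_one]
  | cons x w ih => rw [evalS_cons, ih, h, coprodWord, embMat_mul, embMat_mul, embMat_inr]

/-- The compression of a Haar unitary is a free Haar unitary. -/
theorem isFreeHaar_compressionFun (hn : 1 ≤ n) (hU : U ∈ unitary A)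
    (h1 : ∀ k : ℕ, 1 ≤ k → φ (U ^ k) = 0) (h2 : ∀ k : ℕ, 1 ≤ k → φ (star U ^ k) = 0)
    (hΦ : IsFreeProduct φ (ntr n) Φ) : IsFreeHaar (uPow n) (compressionFun hn hU Φ) := by
  refine isFreeHaar_comp ?_
  intro w hne hw i j
  rw [← mapMatrix_evalS, embHom_evalS, embMat_apply]
  change (n : ℂ) * Φ (Coprod.inr A _ (Matrix.single ⟨0, hn⟩ ⟨0, hn⟩ 1) *
    embEntry (coprodWord U w) i j) = 0
  rw [inr_single_mul_embEntry]
  -- The freeness of A and Mₙ enters through one-by-one matrices: U is the Haar unitary, and Mₙ with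
  -- its normalized trace is the algebra of coefficients. Reducedness is the same condition up to
  -- the factor 1/n.
  let lft : Matrix (Fin n) (Fin n) ℂ → Matrix Unit Unit (Matrix (Fin n) (Fin n) ℂ) :=
    fun d => Matrix.of fun _ _ => d
  let τ : Matrix Unit Unit (Matrix (Fin n) (Fin n) ℂ) → ℂ := fun b => ntr n b.trace
  have hlft : ∀ d, τ (lft d) = (n : ℂ)⁻¹ * d.trace := fun d => by
    simp [τ, lft, Matrix.trace, ntr]
  let F := (Coprod.inr A (Matrix (Fin n) (Fin n) ℂ)).toAlgHom
  let V : Bool → Matrix Unit Unit (Coprod A (Matrix (Fin n) (Fin n) ℂ)) :=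
    fun s => (Coprod.inl A (Matrix (Fin n) (Fin n) ℂ)).toAlgHom.mapMatrix (unitPow U s)
  have hword : ∀ w : List (Bool × Matrix (Fin n) (Fin n) ℂ), evalW V
      ((w.map (Prod.map id lft)).map (Prod.map id F.mapMatrix)) =
      Matrix.of fun _ _ => coprodWord U w := by
    intro w
    induction w with
    | nil => ext; simp [evalW, coprodWord]
    | cons x w ih =>
      rw [List.map_cons, List.map_cons, evalW, ih]
      ext
      simp [Matrix.mul_apply, V, F, lft, coprodWord, unitPow]
  have hred : ReducedFor τ (w.map (Prod.map id lft)) := by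
    refine (List.isChain_map _).2 (List.IsChain.imp ?_ hw)
    intro x y h hxy
    change τ (lft x.2) = 0
    rw [hlft, h hxy, mul_zero]
  obtain ⟨x, w, rfl⟩ := List.exists_cons_of_ne_nil hne
  -- The element to evaluate is E₁ᵢ times a word times Eⱼ₁. The right unit goes into the last
  -- letter, the left one is the leading coefficient.
  obtain ⟨y, v, -, hyv, heq⟩ := exists_evalW_mul_right F V (lft (Matrix.single j ⟨0, hn⟩ 1)) _ _ hred
  have key := hΦ.isFreeIn.swap.apply_mul_evalW (trState n hn).map_one
    (isFreeHaar_unitPow h1 h2) (lft (Matrix.single ⟨0, hn⟩ i 1)) (List.cons_ne_nil y v) hyv () ()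
  change Φ ((F.mapMatrix (lft (Matrix.single ⟨0, hn⟩ i 1)) *
    evalW V ((y :: v).map (Prod.map id F.mapMatrix)) : Matrix Unit Unit _) () ()) = 0 at key
  rw [← heq, ← List.map_cons, hword, ← mul_assoc] at key
  simp [Matrix.mul_apply, F, lft] at key
  rw [key, mul_zero]

end Compression

/-! ### Existence of the free Haar trace -/

/-- Positivity at a, 1 + a and 1 + ia makes three values real; comparing imaginary parts gives both
components of the identity. -/
theorem State.map_star' {A : Type*} [Ring A] [StarRing A] [Algebra ℂ A] [StarModule ℂ A]
    (φ : State A) (a : A) : φ (star a) = star (φ a) := by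
  have h1 := φ.nonneg (1 + a)
  have h2 := φ.nonneg (1 + Complex.I • a)
  have h3 := φ.nonneg a
  rw [Complex.le_def] at h1 h2 h3
  simp [mul_add, add_mul, φ.map_one] at h1 h2 h3
  apply Complex.ext <;> simp <;> linarith [h1.2, h2.2, h3.2]

theorem IsHaarUnitary.star_pow {A : Type*} [Ring A] [StarRing A] [Algebra ℂ A] [StarModule ℂ A]
    {φ : State A} {U : A} (h : IsHaarUnitary φ U) (k : ℕ) (hk : 1 ≤ k) : φ (star U ^ k) = 0 := by
  rw [← _root_.star_pow, State.map_star', h.2 k hk, star_zero]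

open MeasureTheory in
/-- Integration over the circle. -/
def circleInt : C(AddCircle (1 : ℝ), ℂ) →ₗ[ℂ] ℂ where
  toFun f := ∫ t, f t ∂AddCircle.haarAddCircle
  map_add' f g := by
    have h : ∀ f : C(AddCircle (1 : ℝ), ℂ), Integrable f AddCircle.haarAddCircle := fun f =>
      f.continuous.integrable_of_hasCompactSupport (HasCompactSupport.of_compactSpace _)
    exact integral_add (h f) (h g)
  map_smul' c f := integral_const_mul c _

/-- Translation by half a period of the character changes its sign and preserves Haar measure. -/
theorem circleInt_fourier {k : ℤ} (hk : k ≠ 0) : circleInt (fourier k) = 0 :=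
  MeasureTheory.integral_eq_zero_of_add_right_eq_neg (fourier_add_half_inv_index hk one_pos)

/-- The first character of the circle is a Haar unitary for integration, and its compression has the
required properties. Positivity of the free product is not needed, because it follows afterwards
from vanishing on reduced words. -/
theorem exists_isFreeHaar {n : ℕ} (hn : 1 ≤ n) :
    ∃ L : UAlg n →ₗ[ℂ] ℂ, L 1 = 1 ∧ IsFreeHaar (uPow n) L := by
  have hstar : star (fourier 1 : C(AddCircle (1 : ℝ), ℂ)) = fourier (-1) := by
    ext t
    rw [fourier_neg]
    rfl
  have hadd : ∀ k l : ℤ, (fourier k * fourier l : C(AddCircle (1 : ℝ), ℂ)) = fourier (k + l) := by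
    intro k l
    ext t
    simp
  have hzero : (fourier 0 : C(AddCircle (1 : ℝ), ℂ)) = 1 := by
    ext t
    simp
  have hpow : ∀ (l : ℤ) (k : ℕ), (fourier l : C(AddCircle (1 : ℝ), ℂ)) ^ k = fourier (k * l) := by
    intro l k
    induction k with
    | zero => simp [hzero]
    | succ k ih => rw [pow_succ, ih, hadd]; congr 1; push_cast; ring
  have hU : (fourier 1 : C(AddCircle (1 : ℝ), ℂ)) ∈ unitary C(AddCircle (1 : ℝ), ℂ) := by
    rw [Unitary.mem_iff, hstar, hadd, hadd]
    simp [hzero]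
  have hone : circleInt 1 = 1 := by
    simp [circleInt]
  obtain ⟨Φ, hΦ⟩ := exists_isFreeProduct circleInt (ntr n) hone (trState n hn).map_one
  refine ⟨compressionFun hn hU Φ, compressionFun_one hn hU hΦ,
    isFreeHaar_compressionFun hn hU ?_ ?_ hΦ⟩
  · intro k hk
    rw [hpow]
    exact circleInt_fourier (by omega)
  · intro k hk
    rw [hstar, hpow]
    exact circleInt_fourier (by omega)

/-- Existence, uniqueness and description of the free Haar trace. -/
theorem exists_free_haar_trace {n : ℕ} (hn : 1 ≤ n) :
    ∃ h : State (UAlg n), IsHaarTrace freeConv h ∧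
      (∀ h' : State (UAlg n), IsHaarTrace freeConv h' → h' = h) ∧
      ∀ (A : Type*) [Ring A] [StarRing A] [Algebra ℂ A] [StarModule ℂ A]
        (φ : State A) (U : A), IsHaarUnitary φ U →
        ∃ j : UAlg n →⋆ₙₐ[ℂ] Coprod A (Matrix (Fin n) (Fin n) ℂ), IsCompression hn U j ∧
          ∀ a : UAlg n, h a = (n : ℂ) * freeProd φ (trState n hn) (j a) := by
  obtain ⟨L, h1, hL⟩ := exists_isFreeHaar hn
  have hh : IsHaarTrace freeConv (hL.toState hn h1) := isHaarTrace_freeConv hn hL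
  refine ⟨hL.toState hn h1, hh, fun h' hh' => hh.unique hh', ?_⟩
  intro A _ _ _ _ φ U hU
  have hΦ : IsFreeProduct φ.toLin (ntr n) (freeProd φ (trState n hn)) := freeProd_spec _ _
  refine ⟨compression hn hU.1, isCompression_compression hn hU.1, fun a => ?_⟩
  have h2 : L = compressionFun hn hU.1 (freeProd φ (trState n hn)) :=
    hL.unique hn (isFreeHaar_compressionFun hn hU.1 hU.2 hU.star_pow hΦ) h1
      (compressionFun_one hn hU.1 hΦ)
  exact LinearMap.congr_fun h2 a

/-! ### The Hilbert space of the tensor Haar trace -/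

section Kernel

/-- A positive semidefinite kernel is the Gram matrix of a total family in a Hilbert space. -/
theorem exists_hilbert_of_posSemidef {X : Type} {K : Matrix X X ℂ} (hK : K.PosSemidef) :
    ∃ (H : Type) (_ : NormedAddCommGroup H) (_ : InnerProductSpace ℂ H) (_ : CompleteSpace H)
      (e : X → H), (∀ x y, inner ℂ (e x) (e y) = K x y) ∧
      Dense (Submodule.span ℂ (Set.range e) : Set H) := by
  -- The scalar kernel is read as a kernel of operators on ℂ, so that its reproducing kernel space
  -- is the desired Hilbert space, with e x the kernel function at x applied to 1.
  let K' : Matrix X X (ℂ →L[ℂ] ℂ) := fun x y => K x y • ContinuousLinearMap.id ℂ ℂ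
  have hK' : K'.PosSemidef := by
    refine ((RKHS.posSemidef_tfae (K := K')).out 0 2).mpr (And.intro ?_ fun v => ?_)
    · ext x y : 2
      have : star (K y x) = K x y := hK.isHermitian.apply x y
      rw [Matrix.conjTranspose_apply]
      simp [K', ← this, ContinuousLinearMap.star_eq_adjoint, ContinuousLinearMap.adjoint_id]
    · have h := (Complex.nonneg_iff.1 (hK.2 v)).1
      refine h.trans_eq ?_
      change _ = Complex.re _
      congr 1
      refine Finsupp.sum_congr fun x _ => Finsupp.sum_congr fun y _ => ?_
      have : star (K y x) = K x y := hK.isHermitian.apply x y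
      simp [K', ← this]
      ring
  have : Fact K'.PosSemidef := ⟨hK'⟩
  refine ⟨RKHS.OfKernel K', inferInstance, inferInstance, inferInstance,
    fun x => RKHS.kerFun (RKHS.OfKernel K') x 1, fun x y => ?_, ?_⟩
  · rw [RKHS.kerFun_inner, RKHS.kerFun_apply, RKHS.OfKernel.kernel_ofKernel]
    simp [K']
  · have h := RKHS.kerFun_dense (𝕜 := ℂ) (RKHS.OfKernel K')
    rw [← Submodule.dense_iff_topologicalClosure_eq_top] at h
    refine h.mono (Submodule.span_le.2 ?_)
    rintro _ ⟨x, v, rfl⟩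
    have : RKHS.kerFun (RKHS.OfKernel K') x v = v • RKHS.kerFun (RKHS.OfKernel K') x 1 := by
      rw [← map_smul]
      simp
    rw [this]
    exact Submodule.smul_mem _ _ (Submodule.subset_span ⟨x, rfl⟩)

theorem posSemidef_rank_one {X : Type*} (a : X → ℂ) :
    (Matrix.of fun x y => star (a x) * a y : Matrix X X ℂ).PosSemidef := by
  refine ⟨?_, fun v => ?_⟩
  · ext x y
    simp [Matrix.conjTranspose_apply, mul_comm]
  · have h : (v.sum fun i xi => v.sum fun j xj => star xi * (Matrix.of fun x y => star (a x) * a y :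
        Matrix X X ℂ) i j * xj) = star (v.sum fun i xi => a i * xi) * v.sum fun i xi => a i * xi := by
      simp only [Finsupp.sum, star_sum, Finset.sum_mul_sum]
      refine Finset.sum_congr rfl fun x _ => Finset.sum_congr rfl fun y _ => ?_
      simp
      ring
    rw [h]
    exact star_mul_self_nonneg _

variable {n : ℕ}

theorem ntr_star_mul (M N : Matrix (Fin n) (Fin n) ℂ) :
    ntr n (star M * N) = ∑ x : Fin n × Fin n, (n : ℂ)⁻¹ * (star (M x.1 x.2) * N x.1 x.2) := by
  rw [← Finset.mul_sum, Fintype.sum_prod_type, Finset.sum_comm]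
  simp [ntr, Matrix.trace, Matrix.mul_apply]

theorem ntr_one (hn : 1 ≤ n) : ntr n 1 = 1 := (trState n hn).map_one

theorem ntr_mul_comm (M N : Matrix (Fin n) (Fin n) ℂ) : ntr n (M * N) = ntr n (N * M) := by
  simp [ntr, Matrix.trace_mul_comm M N]

theorem ntr_posSemidef : (Matrix.of fun M N => ntr n (star M * N) :
    Matrix (Matrix (Fin n) (Fin n) ℂ) (Matrix (Fin n) (Fin n) ℂ) ℂ).PosSemidef := by
  have h : (Matrix.of fun M N => ntr n (star M * N) :
      Matrix (Matrix (Fin n) (Fin n) ℂ) (Matrix (Fin n) (Fin n) ℂ) ℂ) =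
      ∑ x : Fin n × Fin n, (n : ℂ)⁻¹ • Matrix.of fun M N => star (M x.1 x.2) * N x.1 x.2 := by
    ext M N
    rw [Matrix.sum_apply]
    exact ntr_star_mul M N
  rw [h]
  refine Matrix.posSemidef_sum _ fun x _ => ?_
  exact (posSemidef_rank_one fun M : Matrix (Fin n) (Fin n) ℂ => M x.1 x.2).smul (by positivity)

/-- The inner products of the elementary tensors. -/
def siteInner (n : ℕ) (M N : MatFamily n) : ℂ := ∏ᶠ p, ntr n (star (M.1 p) * N.1 p)

theorem siteInner_eq_prod (hn : 1 ≤ n) {M N : MatFamily n} {F : Finset ℤ}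
    (hM : ∀ p ∉ F, M.1 p = 1) (hN : ∀ p ∉ F, N.1 p = 1) :
    siteInner n M N = ∏ p ∈ F, ntr n (star (M.1 p) * N.1 p) := by
  refine finprod_eq_prod_of_mulSupport_subset _ fun p hp => ?_
  by_contra hF
  exact hp (by simp [hM p hF, hN p hF, ntr_one hn])

theorem exists_sites (M : MatFamily n) : ∃ F : Finset ℤ, ∀ p ∉ F, M.1 p = 1 :=
  ⟨M.2.toFinset, fun p hp => by simpa using hp⟩

/-- For a finite set of sites the kernel is a Schur product of the kernels tr_n(M*N) and the kernel
δ_{kl}. A finitely supported vector involves only finitely many sites with nontrivial matrices, and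
all other factors are tr_n(1) = 1. -/
theorem siteInner_posSemidef (hn : 1 ≤ n) :
    (Matrix.of fun x y => if x.1 = y.1 then siteInner n x.2 y.2 else 0 :
      Matrix (ℤ × MatFamily n) (ℤ × MatFamily n) ℂ).PosSemidef := by
  have hfin : ∀ F : Finset ℤ, (Matrix.of fun x y => if x.1 = y.1 then
      ∏ p ∈ F, ntr n (star (x.2.1 p) * y.2.1 p) else 0 :
      Matrix (ℤ × MatFamily n) (ℤ × MatFamily n) ℂ).PosSemidef := by
    intro F
    induction F using Finset.induction_on with
    | empty =>
      have := (Matrix.PosSemidef.one (n := ℤ) (R := ℂ)).submatrix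
        (Prod.fst : ℤ × MatFamily n → ℤ)
      convert this using 1
      ext x y
      simp [Matrix.one_apply]
    | insert q F hq ih =>
      have := ih.hadamard (ntr_posSemidef.submatrix (fun x : ℤ × MatFamily n => x.2.1 q))
      have congr : ∀ {A B : Matrix (ℤ × MatFamily n) (ℤ × MatFamily n) ℂ}, A.PosSemidef → B = A →
          B.PosSemidef := by
        rintro _ _ h rfl
        exact h
      refine congr this ?_
      ext x y
      simp [Finset.prod_insert hq, mul_comm]
  choose F hF using exists_sites (n := n)
  have hs : ∀ x y : ℤ × MatFamily n, ∀ G : Finset ℤ, F x.2 ⊆ G → F y.2 ⊆ G →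
      siteInner n x.2 y.2 = ∏ p ∈ G, ntr n (star (x.2.1 p) * y.2.1 p) := fun x y G hx hy =>
    siteInner_eq_prod hn (fun p hp => hF _ p fun h => hp (hx h)) fun p hp => hF _ p fun h => hp (hy h)
  refine ⟨?_, fun v => ?_⟩
  · ext x y
    have h1 := hs x y (F x.2 ∪ F y.2) Finset.subset_union_left Finset.subset_union_right
    have h2 := hs y x (F x.2 ∪ F y.2) Finset.subset_union_right Finset.subset_union_left
    have h3 := (hfin (F x.2 ∪ F y.2)).isHermitian.apply x y
    simp only [Matrix.of_apply] at h3
    simp only [Matrix.conjTranspose_apply, Matrix.of_apply, h1, h2, h3]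
  · classical
    let G := v.support.biUnion fun x => F x.2
    refine ((hfin G).2 v).trans_eq ?_
    refine Finset.sum_congr rfl fun x hx => Finset.sum_congr rfl fun y hy => ?_
    simp only [Matrix.of_apply]
    rw [hs x y G (Finset.subset_biUnion_of_mem (fun x : ℤ × MatFamily n => F x.2) hx)
      (Finset.subset_biUnion_of_mem (fun x : ℤ × MatFamily n => F x.2) hy)]

theorem exists_isShiftSpace (hn : 1 ≤ n) :
    ∃ (H : Type) (_ : NormedAddCommGroup H) (_ : InnerProductSpace ℂ H) (_ : CompleteSpace H)
      (e : ℤ → MatFamily n → H), IsShiftSpace n e := by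
  obtain ⟨H, i1, i2, i3, e, he, hd⟩ := exists_hilbert_of_posSemidef (siteInner_posSemidef hn)
  refine ⟨H, i1, i2, i3, fun k M => e (k, M), fun k l M N => he _ _, ?_⟩
  convert hd using 3
  ext x
  simp [eq_comm]

end Kernel

/-! ### The shift operators -/

section Shift

variable {n : ℕ}

theorem MatFamily.mulAt_mulAt (q : ℤ) (X Y : Matrix (Fin n) (Fin n) ℂ) (M : MatFamily n) :
    (M.mulAt q Y).mulAt q X = M.mulAt q (X * Y) := by
  apply Subtype.ext
  simp [mulAt, mul_assoc]

theorem MatFamily.mulAt_one (q : ℤ) (M : MatFamily n) : M.mulAt q 1 = M := by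
  apply Subtype.ext
  simp [mulAt]

/-- Only the factor at site q involves X; c is the product over the remaining sites and is the same
for both arguments. -/
theorem exists_siteInner_mulAt (hn : 1 ≤ n) (q : ℤ) (M N : MatFamily n) : ∃ c : ℂ,
    (∀ X, siteInner n M (N.mulAt q X) = ntr n (star (M.1 q) * (X * N.1 q)) * c) ∧
    ∀ X, siteInner n (M.mulAt q X) N = ntr n (star (X * M.1 q) * N.1 q) * c := by
  obtain ⟨F, hF⟩ := exists_sites M
  obtain ⟨G, hG⟩ := exists_sites N
  let S := insert q (F ∪ G)
  have hq : q ∈ S := Finset.mem_insert_self _ _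
  have hM : ∀ p ∉ S, M.1 p = 1 := fun p hp => hF p (by simp [S] at hp; tauto)
  have hN : ∀ p ∉ S, N.1 p = 1 := fun p hp => hG p (by simp [S] at hp; tauto)
  have hu : ∀ (K : MatFamily n) (X), (∀ p ∉ S, K.1 p = 1) → ∀ p ∉ S, (K.mulAt q X).1 p = 1 := by
    intro K X hK p hp
    have : p ≠ q := by rintro rfl; exact hp hq
    simp [MatFamily.mulAt, Function.update_of_ne this, hK p hp]
  refine ⟨∏ p ∈ S.erase q, ntr n (star (M.1 p) * N.1 p), fun X => ?_, fun X => ?_⟩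
  · rw [siteInner_eq_prod hn hM (hu N X hN), ← Finset.mul_prod_erase _ _ hq]
    congr 1
    · simp [MatFamily.mulAt]
    · refine Finset.prod_congr rfl fun p hp => ?_
      simp [MatFamily.mulAt, Function.update_of_ne (Finset.ne_of_mem_erase hp)]
  · rw [siteInner_eq_prod hn (hu M X hM) hN, ← Finset.mul_prod_erase _ _ hq]
    congr 1
    · simp [MatFamily.mulAt]
    · refine Finset.prod_congr rfl fun p hp => ?_
      simp [MatFamily.mulAt, Function.update_of_ne (Finset.ne_of_mem_erase hp)]

theorem siteInner_mulAt (hn : 1 ≤ n) (q : ℤ) (X : Matrix (Fin n) (Fin n) ℂ) (M N : MatFamily n) :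
    siteInner n (M.mulAt q X) N = siteInner n M (N.mulAt q (star X)) := by
  obtain ⟨c, h1, h2⟩ := exists_siteInner_mulAt hn q M N
  rw [h1, h2, star_mul, mul_assoc]

variable {H : Type*} [NormedAddCommGroup H] [InnerProductSpace ℂ H] {e : ℤ → MatFamily n → H}

theorem IsShiftSpace.ext_inner (he : IsShiftSpace n e) {x y : H}
    (h : ∀ k M, inner ℂ (e k M) x = inner ℂ (e k M) y) : x = y := by
  refine he.dense.eq_of_inner_right ℂ fun v hv => ?_
  induction hv using Submodule.span_induction with
  | mem v hv => obtain ⟨k, M, rfl⟩ := hv; exact h k M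
  | zero => simp
  | add a b _ _ ha hb => rw [inner_add_left, inner_add_left, ha, hb]
  | smul c a _ ha => rw [inner_smul_left, inner_smul_left, ha]

theorem IsShiftSpace.ext_clm (he : IsShiftSpace n e) {E : Type*} [NormedAddCommGroup E]
    [NormedSpace ℂ E] {S T : H →L[ℂ] E} (h : ∀ k M, S (e k M) = T (e k M)) : S = T := by
  refine ContinuousLinearMap.ext_on he.dense ?_
  rintro _ ⟨k, M, rfl⟩
  exact h k M

theorem IsShiftSpace.inner_of_ne (he : IsShiftSpace n e) {k l : ℤ} (hkl : k ≠ l)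
    (M N : MatFamily n) : inner ℂ (e k M) (e l N) = 0 := by
  rw [he.inner_eq, if_neg hkl]

theorem IsShiftSpace.inner_self_level (he : IsShiftSpace n e) (k : ℤ)
    (M N : MatFamily n) : inner ℂ (e k M) (e k N) = siteInner n M N := by
  rw [he.inner_eq, if_pos rfl, siteInner]

theorem IsShiftSpace.inner_mulAt (he : IsShiftSpace n e) (hn : 1 ≤ n) {k k' l l' : ℤ}
    (hkl : k = l ↔ k' = l') (q : ℤ) (X : Matrix (Fin n) (Fin n) ℂ) (M N : MatFamily n) :
    inner ℂ (e k (M.mulAt q X)) (e l N) = inner ℂ (e k' M) (e l' (N.mulAt q (star X))) := by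
  by_cases h : k = l
  · obtain rfl := h
    obtain rfl := hkl.1 rfl
    rw [he.inner_self_level, he.inner_self_level, siteInner_mulAt hn]
  · rw [he.inner_of_ne h, he.inner_of_ne (mt hkl.2 h)]

/-- Multilinearity of the elementary tensors is not assumed. It follows from the inner products with
the total family, which depend linearly on the matrix at one site. -/
theorem IsShiftSpace.exists_site_linearMap (he : IsShiftSpace n e) (hn : 1 ≤ n) (l q : ℤ)
    (N : MatFamily n) : ∃ L : Matrix (Fin n) (Fin n) ℂ →ₗ[ℂ] H, ∀ X, L X = e l (N.mulAt q X) := by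
  have h : ∀ k M, ∃ L : Matrix (Fin n) (Fin n) ℂ →ₗ[ℂ] ℂ,
      ∀ X, L X = inner ℂ (e k M) (e l (N.mulAt q X)) := by
    intro k M
    by_cases hk : k = l
    · obtain rfl := hk
      obtain ⟨c, h1, -⟩ := exists_siteInner_mulAt hn q M N
      refine ⟨c • ntr n ∘ₗ LinearMap.mulLeft ℂ (star (M.1 q)) ∘ₗ LinearMap.mulRight ℂ (N.1 q),
        fun X => ?_⟩
      rw [he.inner_self_level, h1]
      simp [mul_comm]
    · exact ⟨0, fun X => by rw [he.inner_of_ne hk]; rfl⟩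
  refine ⟨{ toFun := fun X => e l (N.mulAt q X), map_add' := ?_, map_smul' := ?_ }, fun X => rfl⟩
  · intro X Y
    refine he.ext_inner fun k M => ?_
    obtain ⟨L, hL⟩ := h k M
    rw [inner_add_right, ← hL, ← hL, ← hL, map_add]
  · intro c X
    refine he.ext_inner fun k M => ?_
    obtain ⟨L, hL⟩ := h k M
    rw [RingHom.id_apply, inner_smul_right, ← hL, ← hL, map_smul, smul_eq_mul]

theorem IsShiftSpace.sum_mulAt (he : IsShiftSpace n e) (hn : 1 ≤ n) (l q : ℤ)
    (N : MatFamily n) {ι : Type*} (s : Finset ι) (X : ι → Matrix (Fin n) (Fin n) ℂ) :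
    ∑ i ∈ s, e l (N.mulAt q (X i)) = e l (N.mulAt q (∑ i ∈ s, X i)) := by
  obtain ⟨L, hL⟩ := he.exists_site_linearMap hn l q N
  simp only [← hL, map_sum]

theorem IsShiftSpace.mulAt_zero (he : IsShiftSpace n e) (hn : 1 ≤ n) (l q : ℤ)
    (N : MatFamily n) : e l (N.mulAt q 0) = 0 := by
  obtain ⟨L, hL⟩ := he.exists_site_linearMap hn l q N
  rw [← hL, map_zero]

theorem sum_single_mul_single (i j : Fin n) :
    ∑ k, Matrix.single k i (1 : ℂ) * Matrix.single j k 1 = if i = j then 1 else 0 := by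
  split_ifs with h
  · subst h
    simp only [Matrix.single_mul_single_same, mul_one]
    exact Matrix.sum_single_one
  · exact Finset.sum_eq_zero fun k _ => by rw [Matrix.single_mul_single_of_ne _ _ _ _ h]

/-- The site computation behind the unitarity of the matrix of shift operators. -/
theorem IsShiftSpace.sum_single_mul_single (he : IsShiftSpace n e) (hn : 1 ≤ n) (l q : ℤ)
    (N : MatFamily n) (i j : Fin n) :
    ∑ k, e l (N.mulAt q (Matrix.single k i 1 * Matrix.single j k 1)) =
      if i = j then e l N else 0 := by
  rw [he.sum_mulAt hn, UDual.sum_single_mul_single]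
  split_ifs
  · rw [MatFamily.mulAt_one]
  · exact he.mulAt_zero hn l q N

/-- A finite family of maps on a total set that together preserve inner products extends to bounded
operators. -/
theorem exists_clm_of_sum_inner {X ι H : Type*} [NormedAddCommGroup H] [InnerProductSpace ℂ H]
    [CompleteSpace H] [Fintype ι] {v : X → H} (hv : Dense (Submodule.span ℂ (Set.range v) : Set H))
    (w : ι → X → H)
    (h : ∀ x y, ∑ i, inner ℂ (w i x) (w i y) = inner ℂ (v x) (v y)) (i : ι) :
    ∃ T : H →L[ℂ] H, ∀ x, T (v x) = w i x := by
  let E := Finsupp.linearCombination ℂ v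
  let S : ι → (X →₀ ℂ) →ₗ[ℂ] H := fun i => Finsupp.linearCombination ℂ (w i)
  have hE : DenseRange E := by
    rw [DenseRange, ← LinearMap.coe_range, Finsupp.range_linearCombination]
    exact hv
  -- The column of all the maps is isometric, so each single one is a contraction and extends by
  -- density.
  have hnorm : ∀ c, ∑ i, ‖S i c‖ ^ 2 = ‖E c‖ ^ 2 := by
    intro c
    have h2 : ∑ i, inner ℂ (S i c) (S i c) = inner ℂ (E c) (E c) := by
      simp only [S, E, Finsupp.linearCombination_apply, Finsupp.sum, sum_inner, inner_sum,
        inner_smul_left, inner_smul_right]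
      rw [Finset.sum_comm]
      refine Finset.sum_congr rfl fun x _ => ?_
      rw [← Finset.mul_sum, Finset.sum_comm]
      congr 1
      refine Finset.sum_congr rfl fun y _ => ?_
      rw [← h, Finset.mul_sum]
    simp only [inner_self_eq_norm_sq_to_K] at h2
    exact_mod_cast h2
  have hb : ∃ C, ∀ c, ‖S i c‖ ≤ C * ‖E c‖ := by
    refine ⟨1, fun c => ?_⟩
    rw [one_mul]
    refine le_of_sq_le_sq ?_ (norm_nonneg _)
    rw [← hnorm]
    exact Finset.single_le_sum (f := fun i => ‖S i c‖ ^ 2) (fun _ _ => by positivity)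
      (Finset.mem_univ i)
  refine ⟨(S i).extendOfNorm E, fun x => ?_⟩
  have := LinearMap.extendOfNorm_eq hE hb (Finsupp.single x 1)
  simpa [E, S] using this

variable [CompleteSpace H]

/-- The adjoint of a shift operator. -/
theorem IsShiftSpace.adjoint_shift (he : IsShiftSpace n e) (hn : 1 ≤ n) {T : H →L[ℂ] H} {i l : Fin n}
    (hT : ∀ k M, T (e k M) = e (k + 1) (M.mulAt k (Matrix.single l i 1))) (k : ℤ)
    (M : MatFamily n) : star T (e k M) = e (k - 1) (M.mulAt (k - 1) (Matrix.single i l 1)) := by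
  refine he.ext_inner fun m N => ?_
  rw [ContinuousLinearMap.star_eq_adjoint, ContinuousLinearMap.adjoint_inner_right, hT]
  by_cases hm : m + 1 = k
  · obtain rfl := hm
    rw [he.inner_mulAt hn (k' := m) (l' := m) (by simp)]
    simp [Matrix.star_eq_conjTranspose]
  · rw [he.inner_of_ne hm, he.inner_of_ne (by omega)]

/-- Everything reduces to ∑ₖ Eₖᵢ Eⱼₖ = δᵢⱼ at one site. For i = j it makes the operators of a column
jointly isometric, hence bounded. It also gives both unitarity relations: U*U acts on level k at
site k, and UU* at site k - 1. -/
theorem IsShiftSpace.exists_isShiftRep (he : IsShiftSpace n e) (hn : 1 ≤ n) :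
    ∃ j : UAlg n →⋆ₐ[ℂ] (H →L[ℂ] H), IsShiftRep e j := by
  have hex : ∀ l i : Fin n, ∃ T : H →L[ℂ] H,
      ∀ k M, T (e k M) = e (k + 1) (M.mulAt k (Matrix.single l i 1)) := by
    intro l i
    have hd : Dense (Submodule.span ℂ (Set.range fun x : ℤ × MatFamily n => e x.1 x.2) : Set H) := by
      convert he.dense using 3
      ext x
      simp [eq_comm]
    obtain ⟨T, hT⟩ := exists_clm_of_sum_inner hd
      (fun (i : Fin n) x => e (x.1 + 1) (x.2.mulAt x.1 (Matrix.single l i 1))) (by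
        rintro ⟨k, M⟩ ⟨k', N⟩
        by_cases hk : k = k'
        · obtain rfl := hk
          simp only [he.inner_mulAt hn (k := k + 1) (k' := k) (l := k + 1) (l' := k) (by simp),
            MatFamily.mulAt_mulAt]
          rw [← inner_sum]
          have := he.sum_single_mul_single hn k k N l l
          simp only [Matrix.star_eq_conjTranspose, Matrix.conjTranspose_single, star_one]
          rw [this, if_pos rfl]
        · rw [he.inner_of_ne hk]
          exact Finset.sum_eq_zero fun i _ => he.inner_of_ne (by simpa using hk) _ _) i
    exact ⟨T, fun k M => hT (k, M)⟩
  choose T hT using hex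
  let V : Matrix (Fin n) (Fin n) (H →L[ℂ] H) := Matrix.of fun i l => T l i
  have hstar : ∀ (i l : Fin n) k M, star (T l i) (e k M) =
      e (k - 1) (M.mulAt (k - 1) (Matrix.single i l 1)) := fun i l k M =>
    he.adjoint_shift hn (hT l i) k M
  have hV : V ∈ unitary (Matrix (Fin n) (Fin n) (H →L[ℂ] H)) := by
    rw [Unitary.mem_iff]
    constructor
    · ext1 i j
      refine he.ext_clm fun k M => ?_
      have := he.sum_single_mul_single hn k k M i j
      rw [Matrix.mul_apply, sum_apply, Matrix.one_apply]
      simp only [Matrix.star_apply, V, Matrix.of_apply, mul_apply_eq_comp, hT, hstar,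
        add_sub_cancel_right, MatFamily.mulAt_mulAt, this]
      split_ifs <;> rfl
    · ext1 i j
      refine he.ext_clm fun k M => ?_
      have := he.sum_single_mul_single hn k (k - 1) M i j
      rw [Matrix.mul_apply, sum_apply, Matrix.one_apply]
      simp only [Matrix.star_apply, V, Matrix.of_apply, mul_apply_eq_comp, hT, hstar,
        sub_add_cancel, MatFamily.mulAt_mulAt, this]
      split_ifs <;> rfl
  refine ⟨UAlg.lift ⟨V, hV⟩, fun i l k M => ?_⟩
  rw [UAlg.lift_u]
  exact hT l i k M

end Shift

/-! ### The tensor product of functionals -/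

section TensorFun

variable {A B : Type*} [Ring A] [StarRing A] [Algebra ℂ A] [StarModule ℂ A]
  [Ring B] [StarRing B] [Algebra ℂ B] [StarModule ℂ B]

theorem Coprod.induct {p : Coprod A B → Prop} (hs : ∀ c : ℂ, p (algebraMap ℂ _ c))
    (hl : ∀ a, p (Coprod.inl A B a)) (hr : ∀ b, p (Coprod.inr A B b))
    (hm : ∀ a b, p a → p b → p (a * b)) (ha : ∀ a b, p a → p b → p (a + b)) (x : Coprod A B) :
    p x := by
  obtain ⟨a, rfl⟩ := Pres.mk_surjective _ x
  induction a using FreeStar.induct with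
  | hs c => rw [AlgHom.commutes]; exact hs c
  | hg x =>
    cases x with
    | left a => exact hl a
    | right b => exact hr b
  | hm a b h1 h2 => rw [map_mul]; exact hm _ _ h1 h2
  | ha a b h1 h2 => rw [map_add]; exact ha _ _ h1 h2

theorem span_range_wordProd : Submodule.span ℂ (Set.range (wordProd (A := A) (B := B))) = ⊤ := by
  let N := Submodule.span ℂ (Set.range (wordProd (A := A) (B := B)))
  have hgen : ∀ y : A ⊕ B, ∀ x ∈ N, Sum.elim (Coprod.inl A B) (Coprod.inr A B) y * x ∈ N := by
    intro y x hx
    induction hx using Submodule.span_induction with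
    | mem x hx =>
      obtain ⟨w, rfl⟩ := hx
      exact Submodule.subset_span ⟨y :: w, by simp [wordProd]⟩
    | zero => simp
    | add a b _ _ ha hb => rw [mul_add]; exact add_mem ha hb
    | smul c a _ ha => rw [mul_smul_comm]; exact Submodule.smul_mem _ _ ha
  have h : ∀ c : Coprod A B, ∀ x ∈ N, c * x ∈ N := by
    intro c
    induction c using Coprod.induct with
    | hs c => intro x hx; rw [← Algebra.smul_def]; exact Submodule.smul_mem _ _ hx
    | hl a => exact hgen (.inl a)
    | hr b => exact hgen (.inr b)
    | hm a b ha hb => intro x hx; rw [mul_assoc]; exact ha _ (hb _ hx)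
    | ha a b ha hb => intro x hx; rw [add_mul]; exact add_mem (ha _ hx) (hb _ hx)
  refine eq_top_iff.2 fun c _ => ?_
  rw [← mul_one c]
  exact h c 1 (Submodule.subset_span ⟨[], rfl⟩)

/-- Merging neighbouring letters from the same leg makes a word alternating. -/
theorem exists_alternating (w : List (A ⊕ B)) : ∃ v, Alternating v ∧ wordProd v = wordProd w ∧
    (lefts v).prod = (lefts w).prod ∧ (rights v).prod = (rights w).prod := by
  induction w with
  | nil => exact ⟨[], by simp [Alternating], rfl, rfl, rfl⟩
  | cons x w ih =>
    obtain ⟨v, h1, h2, h3, h4⟩ := ih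
    have keep : (∀ y v', v = y :: v' → x.isLeft ≠ y.isLeft) → Alternating (x :: v) := by
      intro h
      cases v with
      | nil => simp [Alternating]
      | cons y v => exact List.isChain_cons_cons.2 ⟨h y v rfl, h1⟩
    rcases v with _ | ⟨y, v⟩
    · refine ⟨[x], keep (by simp), ?_⟩
      cases x <;> simp [wordProd_cons_inl, wordProd_cons_inr, h2, lefts, rights, ← h3, ← h4]
    · have hv : ∀ z : A ⊕ B, z.isLeft = y.isLeft → Alternating (z :: v) := by
        intro z hz
        cases v with
        | nil => simp [Alternating]
        | cons y' v =>
          have := List.isChain_cons_cons.1 h1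
          exact List.isChain_cons_cons.2 ⟨by rw [hz]; exact this.1, this.2⟩
      cases x with
      | inl a =>
        cases y with
        | inl a' =>
          refine ⟨.inl (a * a') :: v, hv _ rfl, ?_⟩
          simp [wordProd_cons_inl, ← h2, lefts, rights, ← h3, ← h4, mul_assoc]
        | inr b =>
          refine ⟨.inl a :: .inr b :: v, keep (by rintro y v' h; cases h; simp), ?_⟩
          simp [wordProd_cons_inl, wordProd_cons_inr, ← h2, lefts, rights, ← h3, ← h4]
      | inr b =>
        cases y with
        | inr b' =>
          refine ⟨.inr (b * b') :: v, hv _ rfl, ?_⟩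
          simp [wordProd_cons_inr, ← h2, lefts, rights, ← h3, ← h4, mul_assoc]
        | inl a =>
          refine ⟨.inr b :: .inl a :: v, keep (by rintro y v' h; cases h; simp), ?_⟩
          simp [wordProd_cons_inl, wordProd_cons_inr, ← h2, lefts, rights, ← h3, ← h4]

/-- The canonical homomorphism from the free product to the tensor product. -/
def toTensor (A B : Type*) [Ring A] [StarRing A] [Algebra ℂ A] [StarModule ℂ A]
    [Ring B] [StarRing B] [Algebra ℂ B] [StarModule ℂ B] : Coprod A B →ₐ[ℂ] A ⊗[ℂ] B :=
  Coprod.liftAlg Algebra.TensorProduct.includeLeft Algebra.TensorProduct.includeRight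

theorem toTensor_wordProd (w : List (A ⊕ B)) :
    toTensor A B (wordProd w) = (lefts w).prod ⊗ₜ (rights w).prod := by
  induction w with
  | nil => simp [wordProd_nil, lefts, rights, Algebra.TensorProduct.one_def]
  | cons x w ih =>
    cases x with
    | inl a =>
      rw [wordProd_cons_inl, map_mul, ih]
      simp [lefts, rights, toTensor]
    | inr b =>
      rw [wordProd_cons_inr, map_mul, ih]
      simp [lefts, rights, toTensor]

/-- The defining condition concerns alternating words only. Merging neighbours of the same leg makes
any word alternating without changing the ordered product in each leg, and words span. -/
theorem IsTensorProduct.apply_eq {φ : A →ₗ[ℂ] ℂ} {ψ : B →ₗ[ℂ] ℂ} {Φ : Coprod A B →ₗ[ℂ] ℂ}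
    (h : IsTensorProduct φ ψ Φ) (x : Coprod A B) : Φ x = tmulFun φ ψ (toTensor A B x) := by
  have : Φ = tmulFun φ ψ ∘ₗ (toTensor A B).toLinearMap := by
    refine LinearMap.ext_on_range span_range_wordProd fun w => ?_
    obtain ⟨v, h1, h2, h3, h4⟩ := exists_alternating w
    rw [← h2, h v h1]
    simp [toTensor_wordProd, tmulFun_tmul]
  rw [this]
  rfl

theorem tensorProd_apply (φ : State A) (ψ : State B) (x : Coprod A B) :
    tensorProd φ ψ x = tmulFun φ.toLin ψ.toLin (toTensor A B x) :=
  (exists_isTensorProduct φ.toLin ψ.toLin).choose_spec.apply_eq x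

theorem tmulFun_mul_comm {φ : A →ₗ[ℂ] ℂ} {ψ : B →ₗ[ℂ] ℂ} (hφ : ∀ a b, φ (a * b) = φ (b * a))
    (hψ : ∀ a b, ψ (a * b) = ψ (b * a)) (x y : A ⊗[ℂ] B) :
    tmulFun φ ψ (x * y) = tmulFun φ ψ (y * x) := by
  induction x using TensorProduct.induction_on with
  | zero => simp
  | add x x' hx hx' => rw [add_mul, mul_add, map_add, map_add, hx, hx']
  | tmul a b =>
    induction y using TensorProduct.induction_on with
    | zero => simp
    | add x x' hx hx' => rw [add_mul, mul_add, map_add, map_add, hx, hx']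
    | tmul a' b' =>
      rw [Algebra.TensorProduct.tmul_mul_tmul, Algebra.TensorProduct.tmul_mul_tmul, tmulFun_tmul,
        tmulFun_tmul, hφ, hψ]

end TensorFun

/-! ### The coproduct with values in the tensor square -/

section TensorCoproduct

variable {n : ℕ}

/-- The coproduct followed by the map to the tensor square. -/
def tensorΔ (n : ℕ) : UAlg n →ₐ[ℂ] UAlg n ⊗[ℂ] UAlg n :=
  (toTensor (UAlg n) (UAlg n)).comp (UAlg.Δ n).toAlgHom

theorem tensorΔ_u (i j : Fin n) : tensorΔ n (UAlg.u i j) = ∑ k, UAlg.u i k ⊗ₜ UAlg.u k j := by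
  change toTensor _ _ (UAlg.Δ n (UAlg.u i j)) = _
  simp [UAlg.Δ_u, toTensor]

theorem tensorΔ_star_u (i j : Fin n) :
    tensorΔ n (star (UAlg.u i j)) = ∑ k, star (UAlg.u i k) ⊗ₜ star (UAlg.u k j) := by
  change toTensor _ _ (UAlg.Δ n (star (UAlg.u i j))) = _
  simp [Δ_star_u, toTensor]

theorem tensorConv_apply (φ ψ : State (UAlg n)) (a : UAlg n) :
    tensorConv φ ψ a = tmulFun φ.toLin ψ.toLin (tensorΔ n a) :=
  tensorProd_apply φ ψ _

theorem tensorConv_mul_comm {φ ψ : State (UAlg n)} (hφ : φ.IsTracial) (hψ : ψ.IsTracial)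
    (a b : UAlg n) : tensorConv φ ψ (a * b) = tensorConv φ ψ (b * a) := by
  rw [tensorConv_apply, tensorConv_apply, map_mul (tensorΔ n), map_mul (tensorΔ n),
    tmulFun_mul_comm hφ hψ]

/-! ### Transposition exchanges left and right absorption -/

/-- The transposition, the antiautomorphism with `uᵢⱼ ↦ uⱼᵢ`. -/
def UAlg.transpose (n : ℕ) : UAlg n →⋆ₐ[ℂ] (UAlg n)ᵐᵒᵖ :=
  UAlg.lift ⟨Matrix.of fun i j => MulOpposite.op (UAlg.u j i), by
    have h1 := congrArg Matrix.transpose (Unitary.star_mul_self_of_mem (UAlg.uMat n).2)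
    have h2 := congrArg Matrix.transpose (Unitary.mul_star_self_of_mem (UAlg.uMat n).2)
    rw [Unitary.mem_iff]
    constructor
    · ext i j
      have := congrArg MulOpposite.op (congrFun (congrFun h2 i) j)
      simpa [Matrix.mul_apply, Matrix.one_apply, UAlg.uMat, eq_comm, apply_ite] using this
    · ext i j
      have := congrArg MulOpposite.op (congrFun (congrFun h1 i) j)
      simpa [Matrix.mul_apply, Matrix.one_apply, UAlg.uMat, eq_comm, apply_ite] using this⟩

/-- The transposition as a linear map. -/
def UAlg.transposeLin (n : ℕ) : UAlg n →ₗ[ℂ] UAlg n :=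
  (MulOpposite.opLinearEquiv ℂ).symm.toLinearMap ∘ₗ (UAlg.transpose n).toAlgHom.toLinearMap

theorem UAlg.transposeLin_apply (a : UAlg n) :
    UAlg.transposeLin n a = (UAlg.transpose n a).unop := rfl

theorem UAlg.transposeLin_u (i j : Fin n) : UAlg.transposeLin n (UAlg.u i j) = UAlg.u j i := by
  rw [transposeLin_apply, transpose, UAlg.lift_u]
  rfl

theorem UAlg.transposeLin_mul (a b : UAlg n) :
    UAlg.transposeLin n (a * b) = UAlg.transposeLin n b * UAlg.transposeLin n a := by
  simp [transposeLin_apply]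

theorem UAlg.transposeLin_star (a : UAlg n) :
    UAlg.transposeLin n (star a) = star (UAlg.transposeLin n a) := by
  simp [transposeLin_apply, map_star]

theorem UAlg.transposeLin_one : UAlg.transposeLin n 1 = 1 := by
  simp [transposeLin_apply]

theorem UAlg.transposeLin_transposeLin (a : UAlg n) :
    UAlg.transposeLin n (UAlg.transposeLin n a) = a := by
  induction a using UAlg.induct with
  | hs c => simp [Algebra.algebraMap_eq_smul_one, transposeLin_one]
  | hu i j => rw [transposeLin_u, transposeLin_u]
  | hu' i j => rw [transposeLin_star, transposeLin_star, transposeLin_u, transposeLin_u]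
  | hm a b ha hb => rw [transposeLin_mul, transposeLin_mul, ha, hb]
  | ha a b ha hb => rw [map_add, map_add, ha, hb]

/-- The state `φ ∘ transpose`. -/
def State.transpose (φ : State (UAlg n)) : State (UAlg n) where
  toLin := φ.toLin ∘ₗ UAlg.transposeLin n
  map_one := by simp [UAlg.transposeLin_one, φ.map_one]
  nonneg a := by
    have := φ.nonneg (star (UAlg.transposeLin n a))
    rw [star_star] at this
    simpa [UAlg.transposeLin_mul, UAlg.transposeLin_star] using this

theorem State.transpose_apply (φ : State (UAlg n)) (a : UAlg n) :
    φ.transpose a = φ (UAlg.transposeLin n a) := rfl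

theorem State.IsTracial.transpose {φ : State (UAlg n)} (hφ : φ.IsTracial) :
    φ.transpose.IsTracial := by
  intro a b
  rw [State.transpose_apply, State.transpose_apply, UAlg.transposeLin_mul, UAlg.transposeLin_mul,
    hφ]

theorem State.transpose_transpose (φ : State (UAlg n)) : φ.transpose.transpose = φ := by
  refine State.ext' (LinearMap.ext fun a => ?_)
  change φ (UAlg.transposeLin n (UAlg.transposeLin n a)) = φ a
  rw [UAlg.transposeLin_transposeLin]

/-- The transposition of the tensor square, exchanging the legs. -/
def swapTranspose (n : ℕ) : UAlg n ⊗[ℂ] UAlg n →ₗ[ℂ] UAlg n ⊗[ℂ] UAlg n :=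
  TensorProduct.map (UAlg.transposeLin n) (UAlg.transposeLin n) ∘ₗ
    (TensorProduct.comm ℂ (UAlg n) (UAlg n)).toLinearMap

theorem swapTranspose_tmul (a b : UAlg n) : swapTranspose n (a ⊗ₜ b) =
    UAlg.transposeLin n b ⊗ₜ UAlg.transposeLin n a := rfl

theorem swapTranspose_mul (x y : UAlg n ⊗[ℂ] UAlg n) :
    swapTranspose n (x * y) = swapTranspose n y * swapTranspose n x := by
  induction x using TensorProduct.induction_on with
  | zero => simp
  | add x x' hx hx' => rw [add_mul, map_add, map_add, mul_add, hx, hx']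
  | tmul a b =>
    induction y using TensorProduct.induction_on with
    | zero => simp
    | add x x' hx hx' => rw [mul_add, map_add, map_add, add_mul, hx, hx']
    | tmul a' b' =>
      simp [swapTranspose_tmul, UAlg.transposeLin_mul]

/-- Both sides are antimultiplicative, so generators suffice: ∑ₖ uᵢₖ ⊗ uₖⱼ becomes ∑ₖ uⱼₖ ⊗ uₖᵢ, the
coproduct of uⱼᵢ. -/
theorem swapTranspose_tensorΔ (a : UAlg n) :
    swapTranspose n (tensorΔ n a) = tensorΔ n (UAlg.transposeLin n a) := by
  induction a using UAlg.induct with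
  | hs c =>
    simp [Algebra.algebraMap_eq_smul_one, UAlg.transposeLin_one, swapTranspose_tmul,
      Algebra.TensorProduct.one_def]
  | hu i j => simp [tensorΔ_u, UAlg.transposeLin_u, swapTranspose_tmul]
  | hu' i j =>
    simp [tensorΔ_star_u, UAlg.transposeLin_u, UAlg.transposeLin_star, swapTranspose_tmul]
  | hm a b ha hb => rw [map_mul, swapTranspose_mul, ha, hb, UAlg.transposeLin_mul, map_mul]
  | ha a b ha hb => rw [map_add, map_add, ha, hb, map_add, map_add]

theorem tensorConv_transpose (φ ψ : State (UAlg n)) (a : UAlg n) :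
    tensorConv ψ.transpose φ.transpose a = tensorConv φ ψ (UAlg.transposeLin n a) := by
  rw [tensorConv_apply, tensorConv_apply, ← swapTranspose_tensorΔ]
  induction tensorΔ n a using TensorProduct.induction_on with
  | zero => simp
  | add x y hx hy => rw [map_add, map_add, map_add, hx, hy]
  | tmul a b =>
    rw [swapTranspose_tmul, tmulFun_tmul, tmulFun_tmul, mul_comm]
    rfl

/-- A tracial state that absorbs tracial states from the left is a Haar trace. -/
theorem isHaarTrace_tensorConv_of_left {h : State (UAlg n)} (hh : h.IsTracial)
    (hl : ∀ φ : State (UAlg n), φ.IsTracial → tensorConv φ h = h.toLin) :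
    IsHaarTrace tensorConv h := by
  have hr : ∀ φ : State (UAlg n), φ.IsTracial → tensorConv h.transpose φ = h.transpose.toLin := by
    intro φ hφ
    ext a
    have := tensorConv_transpose φ.transpose h a
    rw [State.transpose_transpose, hl _ hφ.transpose] at this
    exact this
  -- The convolution of the transpose of h with h equals both factors: the left one by right
  -- absorption, the right one by left absorption.
  have ht : h.transpose = h := State.ext' ((hr h hh).symm.trans (hl _ hh.transpose))
  rw [ht] at hr
  exact ⟨hh, fun φ hφ => ⟨hl φ hφ, hr φ hφ⟩⟩

end TensorCoproduct

/-! ### Normal forms of words in the generators -/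

section NormalForm

variable {n : ℕ}

/-- Products in which each `u` is matched by a later `u*`, properly nested. -/
inductive Dyck : UAlg n → Prop
  | one : Dyck 1
  | mul {x y} : Dyck x → Dyck y → Dyck (x * y)
  | wrap {x} (i j k l : Fin n) : Dyck x → Dyck (UAlg.u i j * x * star (UAlg.u k l))

/-- Words with `p` unmatched letters `u*`, followed by `q` unmatched letters `u`. -/
inductive NormalForm : ℕ → ℕ → UAlg n → Prop
  | dyck {x} : Dyck x → NormalForm 0 0 x
  | append_u {p q x y} (i j : Fin n) : NormalForm p q x → Dyck y →
      NormalForm p (q + 1) (x * UAlg.u i j * y)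
  | append_star {p x y} (i j : Fin n) : NormalForm p 0 x → Dyck y →
      NormalForm (p + 1) 0 (x * star (UAlg.u i j) * y)

theorem NormalForm.mul_dyck {p q : ℕ} {x y : UAlg n} (h : NormalForm p q x) (hy : Dyck y) :
    NormalForm p q (x * y) := by
  cases h with
  | dyck hx => exact .dyck (hx.mul hy)
  | append_u i j hx hz => rw [mul_assoc]; exact .append_u i j hx (hz.mul hy)
  | append_star i j hx hz => rw [mul_assoc]; exact .append_star i j hx (hz.mul hy)

theorem NormalForm.dyck_mul {p q : ℕ} {x y : UAlg n} (h : NormalForm p q x) (hy : Dyck y) :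
    NormalForm p q (y * x) := by
  induction h with
  | dyck hx => exact .dyck (hy.mul hx)
  | append_u i j hx hz ih => rw [← mul_assoc, ← mul_assoc]; exact .append_u i j ih hz
  | append_star i j hx hz ih => rw [← mul_assoc, ← mul_assoc]; exact .append_star i j ih hz

theorem NormalForm.mul_u {p q : ℕ} {x : UAlg n} (h : NormalForm p q x) (i j : Fin n) :
    NormalForm p (q + 1) (x * UAlg.u i j) := by
  simpa using NormalForm.append_u i j h .one

/-- If some u is unmatched, the new u* closes the last one, wrapping the nested word behind it.
Otherwise there is one more unmatched u*. -/
theorem NormalForm.exists_mul_star {p q : ℕ} {x : UAlg n} (h : NormalForm p q x) (i j : Fin n) :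
    ∃ p' q', NormalForm p' q' (x * star (UAlg.u i j)) := by
  cases h with
  | dyck hx => exact ⟨1, 0, by simpa using NormalForm.append_star i j (.dyck hx) .one⟩
  | @append_u _ q x y k l hx hy =>
    refine ⟨p, q, ?_⟩
    rw [mul_assoc, mul_assoc, ← mul_assoc (UAlg.u k l)]
    exact hx.mul_dyck (.wrap _ _ _ _ hy)
  | @append_star p x y k l hx hy =>
    exact ⟨p + 1 + 1, 0, by simpa using NormalForm.append_star i j (.append_star k l hx hy) .one⟩

theorem span_normalForm :
    Submodule.span ℂ {x : UAlg n | ∃ p q, NormalForm p q x} = ⊤ := by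
  let N := Submodule.span ℂ {x : UAlg n | ∃ p q, NormalForm p q x}
  have hgen : ∀ c : UAlg n, (∀ p q x, NormalForm p q x → x * c ∈ N) → ∀ x ∈ N, x * c ∈ N := by
    intro c hc x hx
    induction hx using Submodule.span_induction with
    | mem x hx =>
      obtain ⟨p, q, hx⟩ := hx
      exact hc p q x hx
    | zero => simp
    | add a b _ _ ha hb => rw [add_mul]; exact add_mem ha hb
    | smul c a _ ha => rw [smul_mul_assoc]; exact Submodule.smul_mem _ _ ha
  have h : ∀ c : UAlg n, ∀ x ∈ N, x * c ∈ N := by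
    intro c
    induction c using UAlg.induct with
    | hs c =>
      intro x hx
      rw [← Algebra.commutes, ← Algebra.smul_def]
      exact Submodule.smul_mem _ _ hx
    | hu i j => exact hgen _ fun p q x hx => Submodule.subset_span ⟨_, _, hx.mul_u i j⟩
    | hu' i j => exact hgen _ fun p q x hx => Submodule.subset_span (hx.exists_mul_star i j)
    | hm a b ha hb => intro x hx; rw [← mul_assoc]; exact hb _ (ha _ hx)
    | ha a b ha hb => intro x hx; rw [mul_add]; exact add_mem (ha _ hx) (hb _ hx)
  refine eq_top_iff.2 fun c _ => ?_
  rw [← one_mul c]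
  exact h c 1 (Submodule.subset_span ⟨0, 0, .dyck .one⟩)

theorem NormalForm.exists_first_star {p q : ℕ} {x : UAlg n} (h : NormalForm (p + 1) q x) :
    ∃ y i j z, Dyck y ∧ NormalForm p q z ∧ x = y * star (UAlg.u i j) * z := by
  generalize hp : p + 1 = p' at h
  induction h generalizing p with
  | dyck hx => omega
  | append_u i j hx hy ih =>
    obtain ⟨w, k, l, z, hw, hz, rfl⟩ := ih hp
    exact ⟨w, k, l, _, hw, .append_u i j hz hy, by simp only [mul_assoc]⟩
  | @append_star p' x y i j hx hy ih =>
    obtain rfl : p = p' := by omega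
    cases p with
    | zero =>
      cases hx with
      | dyck hx => exact ⟨x, i, j, y, hx, .dyck hy, rfl⟩
    | succ p =>
      obtain ⟨w, k, l, z, hw, hz, rfl⟩ := ih rfl
      exact ⟨w, k, l, _, hw, .append_star i j hz hy, by simp only [mul_assoc]⟩

/-- Two traces agree if they agree on the properly nested words and on the unbalanced ones. -/
theorem ext_of_tracial {L L' : UAlg n →ₗ[ℂ] ℂ} (hL : ∀ a b, L (a * b) = L (b * a))
    (hL' : ∀ a b, L' (a * b) = L' (b * a)) (hd : ∀ x, Dyck x → L x = L' x)
    (hu : ∀ p q x, p ≠ q → NormalForm p q x → L x = L' x) : L = L' := by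
  have hb : ∀ p x, NormalForm p p x → L x = L' x := by
    intro p
    induction p with
    | zero =>
      rintro x (⟨hx⟩)
      exact hd x hx
    | succ p ih =>
      intro x hx
      cases hx with
      | @append_u _ _ x y i j hx hy =>
        -- Rotate cyclically: the last unmatched u, brought to the front, is matched with the first
        -- unmatched u*. The nested words y and w meet between them, and both counts drop by one.
        obtain ⟨w, k, l, z, hw, hz, rfl⟩ := hx.exists_first_star
        have e1 : w * star (UAlg.u k l) * z * UAlg.u i j * y =
            (w * star (UAlg.u k l) * z) * (UAlg.u i j * y) := by rw [mul_assoc]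
        have e2 : (UAlg.u i j * y) * (w * star (UAlg.u k l) * z) =
            (UAlg.u i j * (y * w) * star (UAlg.u k l)) * z := by simp only [mul_assoc]
        rw [e1, hL, hL', e2]
        exact ih _ (hz.dyck_mul (.wrap _ _ _ _ (hy.mul hw)))
  refine LinearMap.ext_on span_normalForm ?_
  rintro x ⟨p, q, hx⟩
  by_cases hpq : p = q
  · subst hpq
    exact hb p x hx
  · exact hu p q x hpq hx

end NormalForm

/-! ### The tensor Haar trace -/

section TensorHaar

variable {n : ℕ} {H : Type*} [NormedAddCommGroup H] [InnerProductSpace ℂ H] [CompleteSpace H]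
  {e : ℤ → MatFamily n → H} {j : UAlg n →⋆ₐ[ℂ] (H →L[ℂ] H)}

/-- The functional `T ↦ ⟨v, T v⟩`. -/
def vectorFun (v : H) : (H →L[ℂ] H) →ₗ[ℂ] ℂ where
  toFun T := inner ℂ v (T v)
  map_add' S T := by simp
  map_smul' c T := by simp

theorem vectorFun_apply (v : H) (T : H →L[ℂ] H) : vectorFun v T = inner ℂ v (T v) := rfl

theorem siteInner_one_one (hn : 1 ≤ n) : siteInner n (MatFamily.one n) (MatFamily.one n) = 1 := by
  simp [siteInner, MatFamily.one, ntr_one hn]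

/-- The vector state of `Ω`. -/
def vacuumState (he : IsShiftSpace n e) (hn : 1 ≤ n) (j : UAlg n →⋆ₐ[ℂ] (H →L[ℂ] H)) :
    State (UAlg n) where
  toLin := vectorFun (e 0 (MatFamily.one n)) ∘ₗ j.toAlgHom.toLinearMap
  map_one := by
    simp [vectorFun_apply, he.inner_self_level, siteInner_one_one hn, -inner_self_eq_norm_sq_to_K]
  nonneg a := by
    change 0 ≤ inner ℂ _ (j (star a * a) _)
    rw [map_mul, map_star, mul_apply_eq_comp, ContinuousLinearMap.star_eq_adjoint,
      ContinuousLinearMap.adjoint_inner_right, inner_self_eq_norm_sq_to_K]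
    exact (Complex.zero_le_real.2 (sq_nonneg ‖j a (e 0 (MatFamily.one n))‖)).trans_eq
      (by push_cast; rfl)

theorem vacuumState_apply (he : IsShiftSpace n e) (hn : 1 ≤ n) (a : UAlg n) :
    vacuumState he hn j a = inner ℂ (e 0 (MatFamily.one n)) (j a (e 0 (MatFamily.one n))) := rfl

theorem IsShiftRep.star_u (hj : IsShiftRep e j) (he : IsShiftSpace n e) (hn : 1 ≤ n) (i l : Fin n)
    (k : ℤ) (M : MatFamily n) : j (star (UAlg.u i l)) (e k M) =
      e (k - 1) (M.mulAt (k - 1) (Matrix.single i l 1)) := by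
  rw [map_star]
  exact he.adjoint_shift hn (hj i l) k M

/-! #### Traciality -/

/-- Shift the family to the right by one site and multiply by `D` from the right. -/
def MatFamily.shiftMul (M D : MatFamily n) : MatFamily n :=
  ⟨fun p => M.1 (p - 1) * D.1 p, ((M.2.image (· + 1)).union D.2).subset (by
    intro p hp
    by_cases h : D.1 p = 1
    · left
      refine ⟨p - 1, ?_, by simp⟩
      simpa [h] using hp
    · exact Or.inr h)⟩

/-- The adjoint of `shiftMul D`. -/
def MatFamily.shiftMulStar (M D : MatFamily n) : MatFamily n :=
  ⟨fun p => M.1 (p + 1) * star (D.1 (p + 1)), ((M.2.union D.2).image (· - 1)).subset (by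
    intro p hp
    refine ⟨p + 1, ?_, by simp⟩
    by_cases h : D.1 (p + 1) = 1
    · left
      simpa [h] using hp
    · exact Or.inr h)⟩

/-- After reindexing the sites by one, traciality of tr_n moves each right factor to the other
argument. -/
theorem siteInner_shiftMul (D M N : MatFamily n) :
    siteInner n M (N.shiftMul D) = siteInner n (M.shiftMulStar D) N := by
  unfold siteInner
  rw [← finprod_comp_equiv (Equiv.addRight (1 : ℤ))]
  refine finprod_congr fun p => ?_
  simp only [MatFamily.shiftMul, MatFamily.shiftMulStar, Equiv.coe_addRight, add_sub_cancel_right,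
    star_mul, star_star, ← mul_assoc]
  rw [ntr_mul_comm, ← mul_assoc]

theorem IsShiftSpace.inner_shiftMul (he : IsShiftSpace n e) (D M N : MatFamily n) (k l : ℤ) :
    inner ℂ (e k M) (e (l + 1) (N.shiftMul D)) = inner ℂ (e (k - 1) (M.shiftMulStar D)) (e l N) := by
  by_cases h : k = l + 1
  · subst h
    rw [add_sub_cancel_right, he.inner_self_level, he.inner_self_level, siteInner_shiftMul]
  · rw [he.inner_of_ne h, he.inner_of_ne (by omega)]

theorem MatFamily.shiftMul_mulAt (D M : MatFamily n) (q : ℤ) (X : Matrix (Fin n) (Fin n) ℂ) :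
    (M.mulAt q X).shiftMul D = (M.shiftMul D).mulAt (q + 1) X := by
  apply Subtype.ext
  funext p
  by_cases h : p = q + 1
  · subst h
    simp [mulAt, shiftMul, mul_assoc]
  · have hpq : p - 1 ≠ q := by omega
    simp [mulAt, shiftMul, Function.update_of_ne h, Function.update_of_ne hpq]

/-- Right multiplication commutes with the representation. -/
theorem IsShiftRep.inner_shiftMul (hj : IsShiftRep e j) (he : IsShiftSpace n e) (hn : 1 ≤ n)
    (D : MatFamily n) (a : UAlg n) (k l : ℤ) (M N : MatFamily n) :
    inner ℂ (e k M) (j a (e (l + 1) (N.shiftMul D))) =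
      inner ℂ (e (k - 1) (M.shiftMulStar D)) (j a (e l N)) := by
  -- A left factor b is carried along so that the letters of a can be removed from the right, each
  -- sending a vector of the family to another one. A letter acts at a site determined by the level,
  -- and right multiplication shifts site and level together.
  let Q : UAlg n → Prop := fun b => ∀ (l : ℤ) (N : MatFamily n),
    inner ℂ (e k M) (j b (e (l + 1) (N.shiftMul D))) =
      inner ℂ (e (k - 1) (M.shiftMulStar D)) (j b (e l N))
  have h : ∀ b, Q b → Q (b * a) := by
    induction a using UAlg.induct with
    | hs c =>
      intro b hb l N
      rw [← Algebra.commutes, ← Algebra.smul_def, map_smul, smul_apply, smul_apply,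
        inner_smul_right, inner_smul_right, hb]
    | hu i m =>
      intro b hb l N
      rw [map_mul, mul_apply_eq_comp, mul_apply_eq_comp, hj, hj, ← MatFamily.shiftMul_mulAt, hb]
    | hu' i m =>
      intro b hb l N
      rw [map_mul, mul_apply_eq_comp, mul_apply_eq_comp, hj.star_u he hn, hj.star_u he hn, ← hb,
        MatFamily.shiftMul_mulAt]
      simp
    | hm x y hx hy =>
      intro b hb
      rw [← mul_assoc]
      exact hy _ (hx _ hb)
    | ha x y hx hy =>
      intro b hb l N
      rw [mul_add, map_add, add_apply, add_apply, inner_add_right, inner_add_right, hx b hb,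
        hy b hb]
  have h1 : Q 1 := fun l N => by
    rw [map_one]
    exact he.inner_shiftMul D M N k l
  have := h 1 h1 l N
  rwa [one_mul] at this

/-- Let R be the shift combined with right multiplication by Eₗᵢ at site 0. It commutes with j, and
RΩ = j(u)Ω, R*Ω = j(u*)Ω for u = uᵢₗ. Hence ⟨Ω, j(a)j(u)Ω⟩ = ⟨R*Ω, j(a)Ω⟩ = ⟨Ω, j(u)j(a)Ω⟩. Adjoints
and products follow. -/
theorem vacuumState_isTracial (hj : IsShiftRep e j) (he : IsShiftSpace n e) (hn : 1 ≤ n) :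
    (vacuumState he hn j).IsTracial := by
  have hu : ∀ (a : UAlg n) (i l : Fin n), vacuumState he hn j (a * UAlg.u i l) =
      vacuumState he hn j (UAlg.u i l * a) := by
    intro a i l
    let D := (MatFamily.one n).mulAt 0 (Matrix.single l i 1)
    have h1 : (MatFamily.one n).shiftMul D = D := by
      apply Subtype.ext
      funext p
      simp [MatFamily.shiftMul, MatFamily.one]
    have h2 : (MatFamily.one n).shiftMulStar D =
        (MatFamily.one n).mulAt (0 - 1) (Matrix.single i l 1) := by
      apply Subtype.ext
      funext p
      by_cases hp : p = -1
      · subst hp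
        simp [MatFamily.shiftMulStar, MatFamily.one, MatFamily.mulAt, D,
          Matrix.star_eq_conjTranspose]
      · have hp' : p + 1 ≠ 0 := by omega
        simp [MatFamily.shiftMulStar, MatFamily.one, MatFamily.mulAt, D,
          Function.update_of_ne hp', Function.update_of_ne hp]
    have h3 := hj.inner_shiftMul he hn D a 0 0 (MatFamily.one n) (MatFamily.one n)
    rw [h1, h2, ← hj.star_u he hn, map_star, ContinuousLinearMap.star_eq_adjoint,
      ContinuousLinearMap.adjoint_inner_left] at h3
    rw [vacuumState_apply, vacuumState_apply, map_mul, map_mul, mul_apply_eq_comp,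
      mul_apply_eq_comp, hj i l]
    exact h3
  intro a b
  induction b using UAlg.induct generalizing a with
  | hs c => rw [Algebra.commutes]
  | hu i l => exact hu a i l
  | hu' i l =>
    have h := congrArg star (hu (star a) i l)
    rw [← State.map_star', ← State.map_star'] at h
    simpa using h.symm
  | hm x y hx hy => rw [← mul_assoc, hy, ← mul_assoc, hx, mul_assoc]
  | ha x y hx hy => rw [mul_add, add_mul, map_add, map_add, hx, hy]

/-! #### The action of nested words -/

/-- The sitewise product. -/
def MatFamily.mul (Z M : MatFamily n) : MatFamily n :=
  ⟨fun p => Z.1 p * M.1 p, (Z.2.union M.2).subset (by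
    intro p hp
    by_cases h : Z.1 p = 1
    · right
      simpa [h] using hp
    · exact Or.inl h)⟩

/-- A nested word acts on `e k M` by multiplication at the sites before `k`. -/
theorem IsShiftRep.exists_of_dyck (hj : IsShiftRep e j) (he : IsShiftSpace n e) (hn : 1 ≤ n)
    {x : UAlg n} (hx : Dyck x) : ∃ Z : ℤ → MatFamily n, (∀ k p, k ≤ p → (Z k).1 p = 1) ∧
      ∀ k M, j x (e k M) = e k ((Z k).mul M) := by
  induction hx with
  | one =>
    refine ⟨fun _ => MatFamily.one n, fun _ _ _ => rfl, fun k M => ?_⟩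
    have : (MatFamily.one n).mul M = M := Subtype.ext (by simp [MatFamily.mul, MatFamily.one])
    rw [this, map_one]
    rfl
  | mul hx hy ihx ihy =>
    obtain ⟨Z, hZ, hxe⟩ := ihx
    obtain ⟨Z', hZ', hye⟩ := ihy
    refine ⟨fun k => (Z k).mul (Z' k), fun k p hp => ?_, fun k M => ?_⟩
    · simp [MatFamily.mul, hZ k p hp, hZ' k p hp]
    · rw [map_mul, mul_apply_eq_comp, hye, hxe]
      congr 1
      exact Subtype.ext (by simp [MatFamily.mul, mul_assoc])
  | wrap i l i' l' hx ih =>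
    obtain ⟨Z, hZ, hxe⟩ := ih
    refine ⟨fun k => (Z (k - 1)).mulAt (k - 1) (Matrix.single l i 1 * Matrix.single i' l' 1),
      fun k p hp => ?_, fun k M => ?_⟩
    · have h : p ≠ k - 1 := by omega
      simp [MatFamily.mulAt, Function.update_of_ne h, hZ (k - 1) p (by omega)]
    · rw [map_mul, map_mul, mul_apply_eq_comp, mul_apply_eq_comp, hj.star_u he hn, hxe, hj,
        sub_add_cancel]
      congr 1
      apply Subtype.ext
      funext p
      by_cases h : p = k - 1
      · subst h
        simp [MatFamily.mulAt, MatFamily.mul, hZ (k - 1) (k - 1) le_rfl, mul_assoc]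
      · simp [MatFamily.mulAt, MatFamily.mul, Function.update_of_ne h]

/-- On level k both outer letters act at site k - 1, and the nested word between them acts only
before that site. So the matrix at site k - 1 is multiplied by Eₗₚ E_{qm} = δ_{pq} Eₗₘ, which does
not depend on p = q; the index r is an arbitrary representative. -/
theorem IsShiftRep.u_mul_dyck_mul_star_u (hj : IsShiftRep e j) (he : IsShiftSpace n e)
    (hn : 1 ≤ n) {x : UAlg n} (hx : Dyck x) (p q r l m : Fin n) :
    j (UAlg.u p l) * j x * j (star (UAlg.u q m)) =
      if p = q then j (UAlg.u r l) * j x * j (star (UAlg.u r m)) else 0 := by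
  obtain ⟨Z, hZ, hxe⟩ := hj.exists_of_dyck he hn hx
  have h : ∀ (p q : Fin n) k M, (j (UAlg.u p l) * j x * j (star (UAlg.u q m))) (e k M) =
      e k (((Z (k - 1)).mul M).mulAt (k - 1) (Matrix.single l p 1 * Matrix.single q m 1)) := by
    intro p q k M
    rw [mul_apply_eq_comp, mul_apply_eq_comp, hj.star_u he hn, hxe, hj, sub_add_cancel]
    congr 1
    apply Subtype.ext
    funext s
    by_cases h : s = k - 1
    · subst h
      simp [MatFamily.mulAt, MatFamily.mul, hZ (k - 1) (k - 1) le_rfl, mul_assoc]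
    · simp [MatFamily.mulAt, MatFamily.mul, Function.update_of_ne h]
  refine he.ext_clm fun k M => ?_
  rw [h]
  split_ifs with hpq
  · subst hpq
    rw [h, Matrix.single_mul_single_same, Matrix.single_mul_single_same]
  · rw [Matrix.single_mul_single_of_ne _ _ _ _ hpq, he.mulAt_zero hn]
    rfl

/-- The coproduct with the second leg represented on `H`. -/
def repΔ (j : UAlg n →⋆ₐ[ℂ] (H →L[ℂ] H)) : UAlg n →ₐ[ℂ] UAlg n ⊗[ℂ] (H →L[ℂ] H) :=
  (Algebra.TensorProduct.map (AlgHom.id ℂ (UAlg n)) j.toAlgHom).comp (tensorΔ n)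

theorem repΔ_u (i l : Fin n) :
    repΔ j (UAlg.u i l) = ∑ k, UAlg.u i k ⊗ₜ j (UAlg.u k l) := by
  simp [repΔ, tensorΔ_u]

theorem repΔ_star_u (i l : Fin n) :
    repΔ j (star (UAlg.u i l)) = ∑ k, star (UAlg.u i k) ⊗ₜ j (star (UAlg.u k l)) := by
  simp [repΔ, tensorΔ_star_u]

theorem sum_u_mul_star_u (i i' : Fin n) :
    ∑ k, UAlg.u i k * star (UAlg.u i' k) = if i = i' then (1 : UAlg n) else 0 := by
  have := congrArg (fun M : Matrix (Fin n) (Fin n) (UAlg n) => M i i')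
    (Unitary.mul_star_self_of_mem (UAlg.uMat n).2)
  simpa [Matrix.mul_apply, Matrix.one_apply, UAlg.uMat] using this

/-- For a wrapped word the second leg contributes δ_{pq} times an operator independent of p, so the
first leg collapses to ∑ₚ uᵢₚ uᵢ'ₚ* = δᵢᵢ'. The same rule shows that the operator on the right
carries the factor δᵢᵢ'. -/
theorem IsShiftRep.repΔ_dyck (hj : IsShiftRep e j) (he : IsShiftSpace n e) (hn : 1 ≤ n)
    {x : UAlg n} (hx : Dyck x) : repΔ j x = 1 ⊗ₜ j x := by
  induction hx with
  | one => exact (repΔ j).map_one'.trans (by rw [map_one j, Algebra.TensorProduct.one_def])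
  | mul hx hy ihx ihy =>
    rw [map_mul, map_mul, ihx, ihy, Algebra.TensorProduct.tmul_mul_tmul, mul_one]
  | @wrap x i l i' l' hx ih =>
    have h1 : repΔ j (UAlg.u i l * x * star (UAlg.u i' l')) =
        ∑ p, ∑ q, (UAlg.u i p * star (UAlg.u i' q)) ⊗ₜ
          (j (UAlg.u p l) * j x * j (star (UAlg.u q l'))) := by
      rw [map_mul, map_mul, repΔ_u, repΔ_star_u, ih, Finset.sum_mul, Finset.sum_mul_sum]
      simp only [Algebra.TensorProduct.tmul_mul_tmul, mul_one]
    have h2 : ∀ p q, (UAlg.u i p * star (UAlg.u i' q)) ⊗ₜ[ℂ]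
          (j (UAlg.u p l) * j x * j (star (UAlg.u q l'))) = if p = q then
        (UAlg.u i p * star (UAlg.u i' q)) ⊗ₜ[ℂ]
          (j (UAlg.u i l) * j x * j (star (UAlg.u i l'))) else 0 := by
      intro p q
      rw [hj.u_mul_dyck_mul_star_u he hn hx p q i]
      split_ifs <;> simp
    rw [h1]
    simp only [h2, Finset.sum_ite_eq, Finset.mem_univ, if_true]
    rw [← TensorProduct.sum_tmul, sum_u_mul_star_u, map_mul, map_mul,
      hj.u_mul_dyck_mul_star_u he hn hx i i' i]
    split_ifs <;> simp

/-! #### Unbalanced words -/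

/-- The operators that shift the level by `d`. -/
def levelShift (e : ℤ → MatFamily n → H) (d : ℤ) : Submodule ℂ (H →L[ℂ] H) where
  carrier := {T | ∀ k M, T (e k M) ∈ Submodule.span ℂ (Set.range (e (k + d)))}
  add_mem' hS hT k M := add_mem (hS k M) (hT k M)
  zero_mem' _ _ := zero_mem _
  smul_mem' c _ hT k M := Submodule.smul_mem _ c (hT k M)

theorem mul_mem_levelShift {d d' : ℤ} {S T : H →L[ℂ] H} (hS : S ∈ levelShift e d)
    (hT : T ∈ levelShift e d') : S * T ∈ levelShift e (d + d') := by
  intro k M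
  have h : Submodule.span ℂ (Set.range (e (k + d'))) ≤
      (Submodule.span ℂ (Set.range (e (k + (d + d'))))).comap (S : H →ₗ[ℂ] H) := by
    rw [Submodule.span_le]
    rintro _ ⟨N, rfl⟩
    have := hS (k + d') N
    rwa [add_assoc, add_comm d' d] at this
  exact h (hT k M)

/-- The span of the tensors whose second leg shifts the level by `d`. -/
def tensorShift (e : ℤ → MatFamily n → H) (d : ℤ) : Submodule ℂ (UAlg n ⊗[ℂ] (H →L[ℂ] H)) :=
  Submodule.span ℂ {x | ∃ a, ∃ T ∈ levelShift e d, x = a ⊗ₜ T}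

theorem mul_mem_tensorShift {d d' : ℤ} {x y : UAlg n ⊗[ℂ] (H →L[ℂ] H)}
    (hx : x ∈ tensorShift e d) (hy : y ∈ tensorShift e d') : x * y ∈ tensorShift e (d + d') := by
  induction hx, hy using Submodule.span_induction₂ with
  | mem_mem x y hx hy =>
    obtain ⟨a, S, hS, rfl⟩ := hx
    obtain ⟨b, T, hT, rfl⟩ := hy
    exact Submodule.subset_span ⟨a * b, S * T, mul_mem_levelShift hS hT, by simp⟩
  | zero_left y _ => rw [zero_mul]; exact zero_mem _
  | zero_right x _ => rw [mul_zero]; exact zero_mem _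
  | add_left x y z _ _ _ hx hy => rw [add_mul]; exact add_mem hx hy
  | add_right x y z _ _ _ hx hy => rw [mul_add]; exact add_mem hx hy
  | smul_left c x y _ _ h => rw [smul_mul_assoc]; exact Submodule.smul_mem _ c h
  | smul_right c x y _ _ h => rw [mul_smul_comm]; exact Submodule.smul_mem _ c h

/-- Different levels are orthogonal, and the second leg moves Ω from level 0 to level d. -/
theorem IsShiftSpace.tmulFun_tensorShift (he : IsShiftSpace n e) (φ : UAlg n →ₗ[ℂ] ℂ) {d : ℤ}
    (hd : d ≠ 0) {x : UAlg n ⊗[ℂ] (H →L[ℂ] H)} (hx : x ∈ tensorShift e d) :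
    tmulFun φ (vectorFun (e 0 (MatFamily.one n))) x = 0 := by
  have h : tensorShift e d ≤
      LinearMap.ker (tmulFun φ (vectorFun (e 0 (MatFamily.one n)))) := by
    rw [tensorShift, Submodule.span_le]
    rintro _ ⟨a, T, hT, rfl⟩
    have h2 : Submodule.span ℂ (Set.range (e (0 + d))) ≤
        LinearMap.ker (innerSL ℂ (e 0 (MatFamily.one n))).toLinearMap := by
      rw [Submodule.span_le]
      rintro _ ⟨N, rfl⟩
      exact he.inner_of_ne (by omega) _ _
    have h3 : inner ℂ (e 0 (MatFamily.one n)) (T (e 0 (MatFamily.one n))) = 0 := h2 (hT 0 _)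
    change tmulFun _ _ _ = 0
    rw [tmulFun_tmul, vectorFun_apply, h3, mul_zero]
  exact h hx

theorem IsShiftRep.u_mem_levelShift (hj : IsShiftRep e j) (i l : Fin n) :
    j (UAlg.u i l) ∈ levelShift e 1 := by
  intro k M
  rw [hj]
  exact Submodule.subset_span ⟨_, rfl⟩

theorem IsShiftRep.star_u_mem_levelShift (hj : IsShiftRep e j) (he : IsShiftSpace n e) (hn : 1 ≤ n)
    (i l : Fin n) : j (star (UAlg.u i l)) ∈ levelShift e (-1) := by
  intro k M
  rw [hj.star_u he hn]
  exact Submodule.subset_span ⟨_, rfl⟩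

/-- Every u raises the level by one and every u* lowers it, so nested words do not count. The
homomorphism is left general because both (id ⊗ j)Δ and 1 ⊗ j are needed. -/
theorem NormalForm.mem_tensorShift {θ : UAlg n →ₐ[ℂ] UAlg n ⊗[ℂ] (H →L[ℂ] H)}
    (hu : ∀ i l, θ (UAlg.u i l) ∈ tensorShift e 1)
    (hu' : ∀ i l, θ (star (UAlg.u i l)) ∈ tensorShift e (-1)) {p q : ℕ} {x : UAlg n}
    (hx : NormalForm p q x) : θ x ∈ tensorShift e (q - p : ℤ) := by
  have hd : ∀ x, Dyck x → θ x ∈ tensorShift e 0 := by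
    intro x hx
    induction hx with
    | one =>
      refine Submodule.subset_span ⟨1, 1, fun k M => ?_, θ.map_one'⟩
      exact Submodule.subset_span ⟨M, by simp⟩
    | mul _ _ hx hy => rw [map_mul]; simpa using mul_mem_tensorShift hx hy
    | wrap i l i' l' _ hx =>
      rw [map_mul, map_mul]
      simpa using mul_mem_tensorShift (mul_mem_tensorShift (hu i l) hx) (hu' i' l')
  induction hx with
  | dyck hx => simpa using hd _ hx
  | append_u i l _ hy ih =>
    rw [map_mul, map_mul]
    convert mul_mem_tensorShift (mul_mem_tensorShift ih (hu i l)) (hd _ hy) using 2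
    push_cast
    ring
  | append_star i l _ hy ih =>
    rw [map_mul, map_mul]
    convert mul_mem_tensorShift (mul_mem_tensorShift ih (hu' i l)) (hd _ hy) using 2
    push_cast
    ring

/-! #### Absorption -/

theorem tensorConv_vacuumState_apply (he : IsShiftSpace n e) (hn : 1 ≤ n) (φ : State (UAlg n))
    (a : UAlg n) : tensorConv φ (vacuumState he hn j) a =
      tmulFun φ.toLin (vectorFun (e 0 (MatFamily.one n))) (repΔ j a) := by
  rw [tensorConv_apply, repΔ, AlgHom.comp_apply]
  induction tensorΔ n a using TensorProduct.induction_on with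
  | zero => simp
  | add x y hx hy => rw [map_add, map_add, map_add, hx, hy]
  | tmul a b => rfl

/-- Both functionals are traces. On nested words the coproduct puts 1 in the first leg and φ(1) = 1;
on unbalanced words both vanish. Traciality of φ enters through that of the convolution. -/
theorem tensorConv_vacuumState (hj : IsShiftRep e j) (he : IsShiftSpace n e) (hn : 1 ≤ n)
    {φ : State (UAlg n)} (hφ : φ.IsTracial) :
    tensorConv φ (vacuumState he hn j) = (vacuumState he hn j).toLin := by
  have hh := vacuumState_isTracial hj he hn
  -- Writing h(a) as the value of φ ⊗ ⟨Ω, · Ω⟩ at 1 ⊗ j(a) lets the same level argument handle both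
  -- functionals.
  let θ : UAlg n →ₐ[ℂ] UAlg n ⊗[ℂ] (H →L[ℂ] H) :=
    Algebra.TensorProduct.includeRight.comp j.toAlgHom
  have hθ : ∀ a, vacuumState he hn j a =
      tmulFun φ.toLin (vectorFun (e 0 (MatFamily.one n))) (θ a) := by
    intro a
    change _ = φ 1 * _
    rw [φ.map_one, one_mul]
    rfl
  refine ext_of_tracial (tensorConv_mul_comm hφ hh) hh ?_ ?_
  · intro x hx
    rw [tensorConv_vacuumState_apply, hj.repΔ_dyck he hn hx, hθ]
    rfl
  · intro p q x hpq hx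
    have hd : (q - p : ℤ) ≠ 0 := by omega
    rw [tensorConv_vacuumState_apply, hθ,
      he.tmulFun_tensorShift _ hd (hx.mem_tensorShift ?_ ?_),
      he.tmulFun_tensorShift _ hd (hx.mem_tensorShift ?_ ?_)]
    · exact fun i l => Submodule.subset_span ⟨1, _, hj.u_mem_levelShift i l, rfl⟩
    · exact fun i l => Submodule.subset_span ⟨1, _, hj.star_u_mem_levelShift he hn i l, rfl⟩
    · intro i l
      rw [repΔ_u]
      exact sum_mem fun k _ => Submodule.subset_span ⟨_, _, hj.u_mem_levelShift k l, rfl⟩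
    · intro i l
      rw [repΔ_star_u]
      exact sum_mem fun k _ =>
        Submodule.subset_span ⟨_, _, hj.star_u_mem_levelShift he hn k l, rfl⟩

end TensorHaar

theorem exists_tensor_haar_trace {n : ℕ} (hn : 1 ≤ n) :
    ∃ h : State (UAlg n), IsHaarTrace tensorConv h ∧
      (∀ h' : State (UAlg n), IsHaarTrace tensorConv h' → h' = h) ∧
      ∃ (H : Type) (_ : NormedAddCommGroup H) (_ : InnerProductSpace ℂ H) (_ : CompleteSpace H)
        (e : ℤ → MatFamily n → H) (j : UAlg n →⋆ₐ[ℂ] (H →L[ℂ] H)),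
        IsShiftSpace n e ∧ IsShiftRep e j ∧
          ∀ a : UAlg n, h a =
            inner ℂ (e 0 (MatFamily.one n)) (j a (e 0 (MatFamily.one n))) := by
  obtain ⟨H, i1, i2, i3, e, he⟩ := exists_isShiftSpace hn
  obtain ⟨j, hj⟩ := he.exists_isShiftRep hn
  have hh : IsHaarTrace tensorConv (vacuumState he hn j) :=
    isHaarTrace_tensorConv_of_left (vacuumState_isTracial hj he hn) fun φ hφ =>
      tensorConv_vacuumState hj he hn hφ
  exact ⟨_, hh, fun h' hh' => hh.unique hh', H, i1, i2, i3, e, j, he, hj, fun a => rfl⟩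

end UDual

end

open UDual
theorem theorem2p2 :
    (∀ n : ℕ, 2 ≤ n →
      (¬ ∃ h : State (UAlg n), IsHaarTrace booleanConv h) ∧
      (¬ ∃ h : State (UAlg n), IsHaarTrace monotoneConv h) ∧
      (¬ ∃ h : State (UAlg n), IsHaarTrace antimonotoneConv h)) ∧
    (∀ (n : ℕ) (hn : 1 ≤ n),
      (∃ h : State (UAlg n), IsHaarTrace freeConv h ∧
        (∀ h' : State (UAlg n), IsHaarTrace freeConv h' → h' = h) ∧
        ∀ (A : Type*) [Ring A] [StarRing A] [Algebra ℂ A] [StarModule ℂ A]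
          (φ : State A) (U : A), IsHaarUnitary φ U →
          ∃ j : UAlg n →⋆ₙₐ[ℂ] Coprod A (Matrix (Fin n) (Fin n) ℂ), IsCompression hn U j ∧
            ∀ a : UAlg n, h a = (n : ℂ) * freeProd φ (trState n hn) (j a)) ∧
      (∃ h : State (UAlg n), IsHaarTrace tensorConv h ∧
        (∀ h' : State (UAlg n), IsHaarTrace tensorConv h' → h' = h) ∧
        ∃ (H : Type) (_ : NormedAddCommGroup H) (_ : InnerProductSpace ℂ H) (_ : CompleteSpace H)
          (e : ℤ → MatFamily n → H) (j : UAlg n →⋆ₐ[ℂ] (H →L[ℂ] H)),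
          IsShiftSpace n e ∧ IsShiftRep e j ∧
            ∀ a : UAlg n, h a =
              inner ℂ (e 0 (MatFamily.one n)) (j a (e 0 (MatFamily.one n))))) := by
  refine ⟨fun n hn => ⟨not_exists_isHaarTrace_booleanConv hn,
    not_exists_isHaarTrace_monotoneConv hn, not_exists_isHaarTrace_antimonotoneConv hn⟩,
    fun n hn => ⟨exists_free_haar_trace hn, exists_tensor_haar_trace hn⟩⟩
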